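/- Let $b$ be the characteristic function of the set of odd positive integers that are sums of two coprime squares, let $e(x)=e^{2\pi i x}$, and for real $\alpha$ and $N$ put $S(\alpha;N)=\sum_{1\le n\le N}b(n)e(n\alpha)$. There is a computable (recursive) function $C:\mathbb N\times\mathbb N\to\mathbb N$ with the following property. Let $A,B\ge1$ and $N\ge e^{e}$ be real numbers, let $q\ge1$ and $a$ be integers with $(a,q)=1$ and $q\le(\log N)^B$, and let $\alpha$ be a real number with $|\alpha-a/q|\le(\log N)^B/N$. Then $$\frac{|S(\alpha;N)|}{N/\sqrt{\log N}}\le C(\lceil A\rceil,\lceil B\rceil)\left(\frac{\sqrt{q\log\log N}\,\log\log\log N}{\varphi(q)}+\frac1{(\log N)^A}\right),$$ where $\varphi$ is Euler's totient function. In particular the implied constant depends only on $A$ and $B$ and is effectively computable. -/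

import Mathlib

/-- The set of odd positive integers that are sums of two coprime squares
(the odd primitive Gaussian integers). -/
def oddPrimitiveGaussian : Set ℕ :=
  {n | Odd n ∧ ∃ x y : ℕ, Nat.Coprime x y ∧ n = x ^ 2 + y ^ 2}

open Classical in
/-- The characteristic function of the odd primitive Gaussian integers. -/
noncomputable def bGauss (n : ℕ) : ℂ :=
  if n ∈ oddPrimitiveGaussian then 1 else 0

/-- The additive character `e(x) = exp(2πix)`. -/
noncomputable def eChar (x : ℝ) : ℂ :=
  Complex.exp (2 * Real.pi * Complex.I * x)

/-- The trigonometric polynomial `S(α; N)`, the sum of `b(n) e(nα)` over the positive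
integers `n ≤ N`. -/
noncomputable def trigS (α N : ℝ) : ℂ :=
  ∑ n ∈ Finset.Icc 1 ⌊N⌋₊, bGauss n * eChar (n * α)

/-! ### Selberg's upper bound sieve -/

/-! An integer is an odd primitive Gaussian integer exactly when it is 1 mod 4 and has no prime
factor p ≡ 3 mod 4 (`mem_oddPrimitiveGaussian_iff`), so S is a sieve sum. Take z = 2^j₁ with log z
of order log N / log log N (for fixed exponents A, B). Sifting only by the primes p < z leaves an
excess of integers n = pm, where p ≥ z is the least prime factor ≡ 3 mod 4. Since n ≡ 1, the
cofactor m is ≡ 3 mod 4, hence has a prime factor of the same kind, at least p, and so p ≤ √N. Thus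
S is a linear sum minus a bilinear sum over z ≤ p ≤ √N (`buchstab_identity`).

Linear sum (`norm_linear_sum_le`): Brun's truncated inclusion-exclusion gives sums over progressions
n ≡ 1 mod 4, d ∣ n. If q does not divide 4d, the frequency 4dα stays away from the integers and the
geometric sum is O(q). The remaining d are the multiples of g = q/(q,4). They are recombined before
being estimated and amount, up to a truncation error, to counting multiples of g with sifted
quotient, which is O(N / (φ(q) √log z)).

Bilinear sum (`norm_middle_sum_le`): cut the primes into short blocks, freeze the dependence of m on
p within a block, apply Cauchy-Schwarz and orthogonality mod q, and bound p and m in residue classes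
by Selberg's sieve (`norm_block_le`). At p of size 2^j the density of primes is 1/j and that of
sifted cofactors is at most of order 1/√j. Summing √q / (φ(q) j^(3/2)) over j ≥ j₁ gives √q / (φ(q)
√j₁), which is the main term with its √(log log N).

The sieve bounds need a lower bound of order √(log D) for the sum of 1/n over n ≤ D composed of
primes ≡ 3 mod 4 (`sqrt_le_harmonicIn_three`). It comes from the identity-like inequality "all odd n
≤ (primes 1 mod 4) × (primes 3 mod 4)" and the positivity and alternation of χ₄. Neither L-function
zeros nor primes in progressions to large moduli enter, so all constants are explicit. For large N
the factor log log log N is not needed; for bounded log N the bound |S| ≤ N suffices. -/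

open Finset ArithmeticFunction in
theorem sum_moebius_between {l m : ℕ} (hm : Squarefree m) :
    ∑ d ∈ m.divisors with l ∣ d, (moebius d : ℝ) = if m = l then (moebius l : ℝ) else 0 := by
  have hm0 : m ≠ 0 := hm.ne_zero
  by_cases hlm : l ∣ m
  · obtain ⟨t, rfl⟩ := hlm
    have hl0 : l ≠ 0 := left_ne_zero_of_mul hm0
    have ht0 : t ≠ 0 := right_ne_zero_of_mul hm0
    have hcop : Nat.Coprime l t := Nat.coprime_of_squarefree_mul hm
    have himg : (l * t).divisors.filter (l ∣ ·) = t.divisors.image (l * ·) := by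
      ext d
      simp only [mem_filter, Nat.mem_divisors, mem_image]
      constructor
      · rintro ⟨⟨hd, _⟩, e, rfl⟩
        exact ⟨e, ⟨Nat.dvd_of_mul_dvd_mul_left (Nat.pos_of_ne_zero hl0) hd, ht0⟩, rfl⟩
      · rintro ⟨e, ⟨he, _⟩, rfl⟩
        exact ⟨⟨mul_dvd_mul_left l he, hm0⟩, dvd_mul_right _ _⟩
    rw [himg, sum_image (fun x _ y _ h => Nat.eq_of_mul_eq_mul_left (Nat.pos_of_ne_zero hl0) h)]
    have hmul : ∀ e ∈ t.divisors, (moebius (l * e) : ℝ) = moebius l * moebius e := by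
      intro e he
      rw [isMultiplicative_moebius.map_mul_of_coprime
        (hcop.coprime_dvd_right (Nat.dvd_of_mem_divisors he))]
      push_cast; ring
    rw [sum_congr rfl hmul, ← mul_sum]
    have h := congrArg (fun f : ArithmeticFunction ℤ => f t) moebius_mul_coe_zeta
    simp only [coe_mul_zeta_apply, one_apply] at h
    have h' : ∑ e ∈ t.divisors, (moebius e : ℝ) = if t = 1 then 1 else 0 := by
      have := congrArg (fun z : ℤ => (z : ℝ)) h
      push_cast at this
      simpa using this
    rw [h']
    by_cases ht : t = 1
    · simp [ht]
    · have : l * t ≠ l := fun h => ht (by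
        apply Nat.eq_of_mul_eq_mul_left (Nat.pos_of_ne_zero hl0); simpa using h)
      simp [ht, this]
  · rw [if_neg (by rintro rfl; exact hlm dvd_rfl), sum_eq_zero]
    intro d hd
    simp only [mem_filter, Nat.mem_divisors] at hd
    exact absurd (hd.2.trans hd.1.1) hlm

-- The count is majorised by the sum of (Σ λ_d over d ∣ n)² with λ_1 = 1. Selberg's optimal λ make
-- the resulting quadratic form equal to 1/G, and the D⁴ collects the rounding errors of all pairs
-- (d, e).
open Finset ArithmeticFunction in
theorem selberg_card_le {A 𝒟 : Finset ℕ} {X : ℝ} {D : ℕ}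
    (hsq : ∀ d ∈ 𝒟, Squarefree d) (hdvd : ∀ d ∈ 𝒟, ∀ e, e ∣ d → e ∈ 𝒟) (h1 : 1 ∈ 𝒟)
    (hD : ∀ d ∈ 𝒟, d ≤ D)
    (hA : ∀ d ∈ 𝒟, ∀ e ∈ 𝒟,
      |((#{n ∈ A | Nat.lcm d e ∣ n} : ℕ) : ℝ) - X / (Nat.lcm d e : ℕ)| ≤ 1) :
    ((#{n ∈ A | ∀ d ∈ 𝒟, d ∣ n → d = 1} : ℕ) : ℝ) ≤
      X / ∑ d ∈ 𝒟, (1 : ℝ) / (Nat.totient d : ℝ) + (D : ℝ) ^ 4 := by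
  set G : ℝ := ∑ d ∈ 𝒟, (1 : ℝ) / (Nat.totient d : ℝ) with hG
  have hpos : ∀ d ∈ 𝒟, 0 < d := fun d hd => Nat.pos_of_ne_zero (hsq d hd).ne_zero
  have hGpos : 0 < G := by
    refine sum_pos (fun d hd => ?_) ⟨1, h1⟩
    have := Nat.totient_pos.2 (hpos d hd)
    positivity
  set lam : ℕ → ℝ := fun d =>
    (moebius d : ℝ) * d / G * ∑ l ∈ 𝒟 with d ∣ l, (1 : ℝ) / (Nat.totient l : ℝ) with hlam
  have hmu : ∀ d, |(moebius d : ℝ)| ≤ 1 := by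
    intro d
    have := abs_moebius_le_one (n := d)
    exact_mod_cast this
  have hlam1 : lam 1 = 1 := by
    simp only [hlam, isUnit_one, IsUnit.dvd, filter_true, moebius_apply_one]
    rw [← hG]
    push_cast
    field_simp
  -- The sharp bound is 1; the trivial bound D costs only a larger power of D in the error.
  have hlamD : ∀ d ∈ 𝒟, |lam d| ≤ D := by
    intro d hd
    have hs : ∑ l ∈ 𝒟 with d ∣ l, (1 : ℝ) / (Nat.totient l : ℝ) ≤ G :=
      sum_le_sum_of_subset_of_nonneg (filter_subset _ _) (fun _ _ _ => by positivity)
    have hs0 : 0 ≤ ∑ l ∈ 𝒟 with d ∣ l, (1 : ℝ) / (Nat.totient l : ℝ) :=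
      sum_nonneg fun _ _ => by positivity
    have e1 : |lam d| = |(moebius d : ℝ)| * d *
        ((∑ l ∈ 𝒟 with d ∣ l, (1 : ℝ) / (Nat.totient l : ℝ)) / G) := by
      simp only [hlam]
      rw [abs_mul, abs_div, abs_mul, abs_of_nonneg hs0, abs_of_pos hGpos, Nat.abs_cast]
      ring
    rw [e1]
    calc _ ≤ 1 * (D : ℝ) * 1 := by
          gcongr
          · exact hmu d
          · exact_mod_cast hD d hd
          · exact (div_le_one hGpos).2 hs
      _ = D := by ring
  set w : ℕ → ℝ := fun n => ∑ d ∈ 𝒟, if d ∣ n then lam d else 0 with hw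
  have hcount : ((#{n ∈ A | ∀ d ∈ 𝒟, d ∣ n → d = 1} : ℕ) : ℝ) ≤ ∑ n ∈ A, w n ^ 2 := by
    rw [card_eq_sum_ones, Nat.cast_sum, sum_filter]
    refine sum_le_sum fun n _ => ?_
    split_ifs with h
    · have : w n = 1 := by
        simp only [hw]
        rw [sum_eq_single_of_mem 1 h1 (fun d hd hd1 => if_neg fun hdn => hd1 (h d hd hdn))]
        simp [hlam1]
      simp [this]
    · positivity
  have hsqr : ∑ n ∈ A, w n ^ 2 =
      ∑ d ∈ 𝒟, ∑ e ∈ 𝒟, lam d * lam e * (#{n ∈ A | Nat.lcm d e ∣ n} : ℕ) := by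
    simp only [hw, sq, sum_mul_sum]
    rw [sum_comm]
    refine sum_congr rfl fun d _ => ?_
    rw [sum_comm]
    refine sum_congr rfl fun e _ => ?_
    rw [card_eq_sum_ones, Nat.cast_sum, sum_filter, mul_sum]
    refine sum_congr rfl fun n _ => ?_
    by_cases hd : d ∣ n <;> by_cases he : e ∣ n <;> simp [hd, he, Nat.lcm_dvd_iff]
  -- Writing 1/[d,e] = (d,e)/(de) and (d,e) = Σ φ(l) over l ∣ (d,e) diagonalises the form; Möbius
  -- inversion evaluates the new variables as μ(l)/(G φ(l)).
  have hQ : ∑ d ∈ 𝒟, ∑ e ∈ 𝒟, lam d * lam e * (1 / (Nat.lcm d e : ℕ) : ℝ) = 1 / G := by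
    have hgcd : ∀ d ∈ 𝒟, ∀ e ∈ 𝒟, lam d * lam e * (1 / (Nat.lcm d e : ℕ) : ℝ) =
        ∑ l ∈ 𝒟, (Nat.totient l : ℝ) * ((if l ∣ d then lam d / d else 0) *
          (if l ∣ e then lam e / e else 0)) := by
      intro d hd e he
      have hdp := hpos d hd
      have hep := hpos e he
      have hfil : 𝒟.filter (fun l => l ∣ d ∧ l ∣ e) = (Nat.gcd d e).divisors := by
        ext l
        simp only [mem_filter, Nat.mem_divisors]
        constructor
        · rintro ⟨_, h1, h2⟩
          exact ⟨Nat.dvd_gcd h1 h2, (Nat.gcd_pos_of_pos_left _ hdp).ne'⟩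
        · rintro ⟨h, _⟩
          have h' := Nat.dvd_gcd_iff.1 h
          exact ⟨hdvd d hd l h'.1, h'⟩
      have htot : ((Nat.gcd d e : ℕ) : ℝ) = ∑ l ∈ 𝒟 with (l ∣ d ∧ l ∣ e), (Nat.totient l : ℝ) := by
        rw [hfil, ← Nat.cast_sum, Nat.sum_totient]
      have hgl : ((Nat.gcd d e : ℕ) : ℝ) * (Nat.lcm d e : ℕ) = d * e := by
        exact_mod_cast Nat.gcd_mul_lcm d e
      have hlpos : (0 : ℝ) < (Nat.lcm d e : ℕ) := by
        exact_mod_cast Nat.lcm_pos hdp hep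
      have hd' : (0 : ℝ) < d := by exact_mod_cast hdp
      have he' : (0 : ℝ) < e := by exact_mod_cast hep
      have : (1 / (Nat.lcm d e : ℕ) : ℝ) = (Nat.gcd d e : ℕ) / (d * e) := by
        rw [← hgl]
        have : ((Nat.gcd d e : ℕ) : ℝ) ≠ 0 := by
          exact_mod_cast (Nat.gcd_pos_of_pos_left _ hdp).ne'
        field_simp
      rw [this, htot, sum_filter, sum_div, mul_sum]
      refine sum_congr rfl fun l _ => ?_
      by_cases h1 : l ∣ d <;> by_cases h2 : l ∣ e <;> simp [h1, h2]
      field_simp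
    have hy : ∀ l ∈ 𝒟, ∑ d ∈ 𝒟, (if l ∣ d then lam d / d else 0) =
        (moebius l : ℝ) / (G * Nat.totient l) := by
      intro l hl
      have h3 : ∀ d ∈ 𝒟, (if l ∣ d then lam d / d else 0) =
          1 / G * ∑ m ∈ 𝒟, (1 : ℝ) / (Nat.totient m : ℝ) *
            (if d ∣ m ∧ l ∣ d then (moebius d : ℝ) else 0) := by
        intro d hd
        have hd' : (0 : ℝ) < d := by exact_mod_cast hpos d hd
        by_cases h : l ∣ d
        · simp only [h, if_true, and_true, hlam]
          rw [sum_filter, mul_sum, mul_sum, sum_div]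
          refine sum_congr rfl fun m _ => ?_
          by_cases hdm : d ∣ m <;> simp [hdm]
          field_simp
        · simp [h]
      rw [sum_congr rfl h3, ← mul_sum, sum_comm]
      have h4 : ∀ m ∈ 𝒟, ∑ d ∈ 𝒟, (1 : ℝ) / (Nat.totient m : ℝ) *
            (if d ∣ m ∧ l ∣ d then (moebius d : ℝ) else 0) =
          if m = l then (1 : ℝ) / (Nat.totient m : ℝ) * moebius l else 0 := by
        intro m hm
        rw [← mul_sum, ← sum_filter]
        have : 𝒟.filter (fun d => d ∣ m ∧ l ∣ d) = m.divisors.filter (l ∣ ·) := by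
          ext d
          simp only [mem_filter, Nat.mem_divisors]
          constructor
          · rintro ⟨_, h1, h2⟩
            exact ⟨⟨h1, (hpos m hm).ne'⟩, h2⟩
          · rintro ⟨⟨h1, _⟩, h2⟩
            exact ⟨hdvd m hm d h1, h1, h2⟩
        rw [this, sum_moebius_between (hsq m hm)]
        split_ifs <;> simp
      rw [sum_congr rfl h4, sum_ite_eq' 𝒟 l, if_pos hl]
      have : (0 : ℝ) < Nat.totient l := by exact_mod_cast Nat.totient_pos.2 (hpos l hl)
      field_simp
    rw [sum_congr rfl fun d hd => sum_congr rfl fun e he => hgcd d hd e he]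
    have h5 : ∑ d ∈ 𝒟, ∑ e ∈ 𝒟, ∑ l ∈ 𝒟, (Nat.totient l : ℝ) *
        ((if l ∣ d then lam d / d else 0) * (if l ∣ e then lam e / e else 0)) =
        ∑ l ∈ 𝒟, (Nat.totient l : ℝ) * (∑ d ∈ 𝒟, (if l ∣ d then lam d / d else 0)) ^ 2 := by
      rw [sum_congr rfl fun d _ => sum_comm, sum_comm]
      refine sum_congr rfl fun l _ => ?_
      rw [sq, sum_mul_sum, mul_sum]
      refine sum_congr rfl fun d _ => ?_
      rw [mul_sum]
    rw [h5]
    have h6 : ∀ l ∈ 𝒟, (Nat.totient l : ℝ) *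
        (∑ d ∈ 𝒟, (if l ∣ d then lam d / d else 0)) ^ 2 =
        1 / G ^ 2 * ((1 : ℝ) / (Nat.totient l : ℝ)) := by
      intro l hl
      rw [hy l hl]
      have : (0 : ℝ) < Nat.totient l := by exact_mod_cast Nat.totient_pos.2 (hpos l hl)
      have hm2 : (moebius l : ℝ) ^ 2 = 1 := by
        exact_mod_cast moebius_sq_eq_one_of_squarefree (hsq l hl)
      rw [div_pow, hm2]
      field_simp
    rw [sum_congr rfl h6, ← mul_sum, ← hG]
    field_simp
  have hcard : ((#𝒟 : ℕ) : ℝ) ≤ D := by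
    have : 𝒟 ⊆ Icc 1 D := fun d hd => mem_Icc.2 ⟨hpos d hd, hD d hd⟩
    have := card_le_card this
    simp only [Nat.card_Icc, Nat.add_sub_cancel] at this
    exact_mod_cast this
  have hmain : ∑ n ∈ A, w n ^ 2 ≤ X * (1 / G) + (D : ℝ) ^ 4 := by
    rw [hsqr, ← hQ, mul_sum, ← sub_le_iff_le_add', ← sum_sub_distrib]
    have : ∀ d ∈ 𝒟, ∑ e ∈ 𝒟, lam d * lam e * ((#{n ∈ A | Nat.lcm d e ∣ n} : ℕ) : ℝ) -
        X * ∑ e ∈ 𝒟, lam d * lam e * (1 / (Nat.lcm d e : ℕ) : ℝ) ≤ ∑ e ∈ 𝒟, (D : ℝ) ^ 2 := by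
      intro d hd
      rw [mul_sum, ← sum_sub_distrib]
      refine sum_le_sum fun e he => ?_
      calc _ = lam d * lam e *
            (((#{n ∈ A | Nat.lcm d e ∣ n} : ℕ) : ℝ) - X / (Nat.lcm d e : ℕ)) := by ring
        _ ≤ |lam d * lam e *
            (((#{n ∈ A | Nat.lcm d e ∣ n} : ℕ) : ℝ) - X / (Nat.lcm d e : ℕ))| := le_abs_self _
        _ ≤ D * D * 1 := by
            rw [abs_mul, abs_mul]
            have h1 := hlamD d hd
            have h2 := hlamD e he
            have h3 := hA d hd e he
            gcongr
        _ = (D : ℝ) ^ 2 := by ring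
    refine (sum_le_sum this).trans ?_
    simp only [sum_const, nsmul_eq_mul]
    calc ((#𝒟 : ℕ) : ℝ) * ((#𝒟 : ℕ) * (D : ℝ) ^ 2) ≤ D * (D * (D : ℝ) ^ 2) := by gcongr
      _ = (D : ℝ) ^ 4 := by ring
  calc _ ≤ _ := hcount
    _ ≤ _ := hmain
    _ = _ := by ring

/-! ### Lower bounds for the Selberg denominators -/

open Finset in
theorem sum_one_div_le_prod_of_factored {s T : Finset ℕ} (hs : ∀ p ∈ s, p.Prime)
    (hT : ∀ n ∈ T, n ∈ Nat.factoredNumbers s) :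
    ∑ n ∈ T, (1 : ℝ) / n ≤ ∏ p ∈ s, (1 - (p : ℝ)⁻¹)⁻¹ := by
  let f : ℕ →* ℝ := ⟨⟨fun n => (n : ℝ)⁻¹, by simp⟩, fun a b => by push_cast; rw [mul_inv]⟩
  have h := EulerProduct.summable_and_hasSum_factoredNumbers_prod_filter_prime_geometric
    (f := f) (fun {p} hp => by
      have : (1 : ℝ) < p := by exact_mod_cast hp.one_lt
      simpa [f] using inv_lt_one_of_one_lt₀ this) s
  have hfil : s.filter Nat.Prime = s := filter_true_of_mem hs
  rw [hfil] at h
  classical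
  have h2 := h.2.summable.sum_le_tsum (T.attach.image fun n => (⟨n.1, hT n.1 n.2⟩ :
    Nat.factoredNumbers s)) (fun n _ => by simp [f])
  rw [h.2.tsum_eq, sum_image (fun a _ b _ hab => by
    simp only [Subtype.mk.injEq] at hab; exact Subtype.ext hab)] at h2
  rw [← sum_attach]
  simpa [f, one_div] using h2

theorem totient_pos_real {n : ℕ} (hn : n ≠ 0) : (0 : ℝ) < Nat.totient n := by
  exact_mod_cast Nat.totient_pos.2 (Nat.pos_of_ne_zero hn)

theorem prod_primeFactors_inv_one_sub {n : ℕ} (hn : n ≠ 0) :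
    ∏ p ∈ n.primeFactors, (1 - (p : ℝ)⁻¹)⁻¹ = n / Nat.totient n := by
  have h := Nat.totient_eq_mul_prod_factors n
  have h' : (Nat.totient n : ℝ) = n * ∏ p ∈ n.primeFactors, (1 - (p : ℝ)⁻¹) := by
    have := congrArg (fun x : ℚ => (x : ℝ)) h
    push_cast at this
    exact this
  have hpos := totient_pos_real hn
  rw [Finset.prod_inv_distrib]
  have hn' : (0 : ℝ) < n := by exact_mod_cast Nat.pos_of_ne_zero hn
  have : ∏ p ∈ n.primeFactors, (1 - (p : ℝ)⁻¹) = Nat.totient n / n := by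
    rw [h']; field_simp
  rw [this, inv_div]

/-- All prime factors of `n` satisfy `c`. -/
def PrimesIn (c : ℕ → Prop) (n : ℕ) : Prop := ∀ p, p.Prime → p ∣ n → c p

open Classical Finset in
/-- The squarefree `d ≤ D` composed of primes satisfying `c` and not dividing `Q`. -/
noncomputable def sieveSupport (c : ℕ → Prop) (Q D : ℕ) : Finset ℕ :=
  {d ∈ Icc 1 D | Squarefree d ∧ PrimesIn (fun p => c p ∧ ¬ p ∣ Q) d}

open Classical Finset in
/-- The sum of `1 / n` over the `n ≤ D` composed of primes satisfying `c`. -/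
noncomputable def harmonicIn (c : ℕ → Prop) (D : ℕ) : ℝ :=
  ∑ n ∈ Icc 1 D with PrimesIn c n, (1 : ℝ) / n

-- Group the n ≤ D by d = r(n), the product of the primes of n not dividing Q. Then n = dt with t
-- composed of primes dividing d or Q, and the Euler product bounds the sum of 1/t by (d/φ(d))
-- (Q/φ(Q)).
open Classical Finset in
theorem harmonicIn_le (c : ℕ → Prop) {Q : ℕ} (hQ : Q ≠ 0) (D : ℕ) :
    harmonicIn c D ≤
      (Q / Nat.totient Q : ℝ) * ∑ d ∈ sieveSupport c Q D, (1 : ℝ) / (Nat.totient d : ℝ) := by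
  set r : ℕ → ℕ := fun n => ∏ p ∈ n.primeFactors.filter (fun p => ¬ p ∣ Q), p with hr
  have hrdvd : ∀ n, n ≠ 0 → r n ∣ n := fun n hn =>
    (prod_dvd_prod_of_subset _ _ _ (filter_subset _ _)).trans (Nat.prod_primeFactors_dvd n)
  have hrpf : ∀ n, (r n).primeFactors = n.primeFactors.filter (fun p => ¬ p ∣ Q) := fun n =>
    Nat.primeFactors_prod fun p hp => Nat.prime_of_mem_primeFactors (mem_filter.1 hp).1
  have hrsq : ∀ n, Squarefree (r n) := fun n => by
    simp only [hr]
    refine Finset.squarefree_prod_of_pairwise_isCoprime ?_ ?_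
    · intro p hp q hq hpq
      have h1 := Nat.prime_of_mem_primeFactors (mem_filter.1 hp).1
      have h2 := Nat.prime_of_mem_primeFactors (mem_filter.1 hq).1
      exact Nat.coprime_iff_isRelPrime.1 ((Nat.coprime_primes h1 h2).2 hpq)
    · intro p hp
      exact (Nat.prime_of_mem_primeFactors (mem_filter.1 hp).1).prime.squarefree
  have hmaps : ∀ n ∈ (Icc 1 D).filter (PrimesIn c), r n ∈ sieveSupport c Q D := by
    intro n hn
    simp only [mem_filter, mem_Icc] at hn
    have hn0 : n ≠ 0 := by omega
    simp only [sieveSupport, mem_filter, mem_Icc]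
    refine ⟨⟨Nat.pos_of_ne_zero (hrsq n).ne_zero,
      (Nat.le_of_dvd (by omega) (hrdvd n hn0)).trans hn.1.2⟩, hrsq n, ?_⟩
    intro p hp hpd
    have : p ∈ (r n).primeFactors := Nat.mem_primeFactors.2 ⟨hp, hpd, (hrsq n).ne_zero⟩
    rw [hrpf, mem_filter] at this
    exact ⟨hn.2 p hp (Nat.dvd_of_mem_primeFactors this.1), this.2⟩
  unfold harmonicIn
  rw [← sum_fiberwise_of_maps_to hmaps, mul_sum]
  refine sum_le_sum fun d hd => ?_
  simp only [sieveSupport, mem_filter, mem_Icc] at hd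
  have hd0 : d ≠ 0 := by omega
  set T := ((Icc 1 D).filter (PrimesIn c)).filter (fun n => r n = d) with hT
  have hTd : ∀ n ∈ T, d ∣ n ∧ n ≠ 0 := by
    intro n hn
    simp only [hT, mem_filter, mem_Icc] at hn
    have hn0 : n ≠ 0 := by omega
    exact ⟨hn.2 ▸ hrdvd n hn0, hn0⟩
  have hsum : ∑ n ∈ T, (1 : ℝ) / n = 1 / d * ∑ t ∈ T.image (· / d), (1 : ℝ) / t := by
    rw [sum_image, mul_sum]
    · refine sum_congr rfl fun n hn => ?_
      obtain ⟨⟨t, rfl⟩, _⟩ := hTd n hn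
      rw [Nat.mul_div_cancel_left _ (Nat.pos_of_ne_zero hd0)]
      push_cast
      rw [one_div_mul_one_div]
    · intro a ha b hb hab
      obtain ⟨⟨t, rfl⟩, _⟩ := hTd a ha
      obtain ⟨⟨u, rfl⟩, _⟩ := hTd b hb
      simp only [Nat.mul_div_cancel_left _ (Nat.pos_of_ne_zero hd0)] at hab
      rw [hab]
  rw [hsum]
  have hfac : ∀ t ∈ T.image (· / d), t ∈ Nat.factoredNumbers (d.primeFactors ∪ Q.primeFactors) := by
    intro t ht
    obtain ⟨n, hn, rfl⟩ := mem_image.1 ht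
    obtain ⟨hdn, hn0⟩ := hTd n hn
    have hrn : r n = d := (mem_filter.1 hn).2
    refine Nat.mem_factoredNumbers_of_primeFactors_subset ?_ ?_
    · exact (Nat.div_pos (Nat.le_of_dvd (Nat.pos_of_ne_zero hn0) hdn)
        (Nat.pos_of_ne_zero hd0)).ne'
    · intro p hp
      have hpn : p ∈ n.primeFactors :=
        Nat.primeFactors_mono (Nat.div_dvd_of_dvd hdn) hn0 hp
      by_cases hpQ : p ∣ Q
      · exact mem_union_right _ (Nat.mem_primeFactors.2
          ⟨Nat.prime_of_mem_primeFactors hp, hpQ, hQ⟩)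
      · refine mem_union_left _ ?_
        rw [← hrn, hrpf]
        exact mem_filter.2 ⟨hpn, hpQ⟩
  have hdisj : Disjoint d.primeFactors Q.primeFactors := by
    rw [disjoint_left]
    intro p hp hq
    exact (hd.2.2 p (Nat.prime_of_mem_primeFactors hp) (Nat.dvd_of_mem_primeFactors hp)).2
      (Nat.dvd_of_mem_primeFactors hq)
  have hle := sum_one_div_le_prod_of_factored (s := d.primeFactors ∪ Q.primeFactors)
    (fun p hp => by
      rcases mem_union.1 hp with h | h <;> exact Nat.prime_of_mem_primeFactors h) hfac
  rw [prod_union hdisj, prod_primeFactors_inv_one_sub hd0, prod_primeFactors_inv_one_sub hQ] at hle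
  have hd' : (0 : ℝ) < d := by exact_mod_cast Nat.pos_of_ne_zero hd0
  calc _ ≤ (1 : ℝ) / d * ((d : ℝ) / Nat.totient d * (Q / Nat.totient Q)) := by gcongr
    _ = _ := by
      have := totient_pos_real hd0
      have := totient_pos_real hQ
      field_simp

open Classical Finset in
theorem sum_sieveSupport_pos (c : ℕ → Prop) (Q : ℕ) {D : ℕ} (hD : 1 ≤ D) :
    1 ∈ sieveSupport c Q D := by
  simp only [sieveSupport, mem_filter, mem_Icc]
  refine ⟨⟨le_rfl, hD⟩, squarefree_one, fun p hp h => absurd (Nat.dvd_one.1 h) hp.one_lt.ne'⟩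

/-! ### Harmonic sums over integers composed of primes in a residue class modulo 4 -/

-- This is the convolution 1 ∗ χ₄, nonnegative because χ₄ is quadratic; the fact is transported from
-- complex characters.
open ZMod in
theorem sum_divisors_chi_four_nonneg (n : ℕ) : 0 ≤ ∑ d ∈ n.divisors, χ₄ (d : ZMod 4) := by
  set χ : DirichletCharacter ℂ 4 := χ₄.ringHomComp (Int.castRingHom ℂ) with hχ
  have hq : χ.IsQuadratic := isQuadratic_χ₄.comp _
  have h := DirichletCharacter.zetaMul_nonneg (MulChar.IsQuadratic.sq_eq_one hq) n
  have h2 : DirichletCharacter.zetaMul χ n = ((∑ d ∈ n.divisors, χ₄ (d : ZMod 4) : ℤ) : ℂ) := by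
    simp only [DirichletCharacter.zetaMul, ArithmeticFunction.coe_zeta_mul_apply]
    push_cast
    refine Finset.sum_congr rfl fun d hd => ?_
    have : d ≠ 0 := (Nat.pos_of_mem_divisors hd).ne'
    simp [toArithmeticFunction, this, hχ, MulChar.ringHomComp_apply]
  rw [h2] at h
  have h3 := (Complex.le_def.1 h).1
  rw [Complex.intCast_re] at h3
  simpa using (by exact_mod_cast h3 : (0 : ℤ) ≤ ∑ d ∈ n.divisors, χ₄ (d : ZMod 4))

-- Only odd d count, with alternating signs, so the sum g(1) − g(3) + g(5) − … is at most its first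
-- term. The cut after 4n + 1 leaves every later positive term paired with the negative one before
-- it.
open ZMod in
theorem sum_range_chi_four_mul_le {g : ℕ → ℝ} (hg : ∀ d ≥ 1, g (d + 1) ≤ g d) (n : ℕ) :
    ∑ d ∈ Finset.range (4 * n + 2), (χ₄ (d : ZMod 4) : ℝ) * g d ≤ g 1 := by
  induction n with
  | zero => simp [Finset.sum_range_succ]
  | succ k ih =>
    rw [show 4 * (k + 1) + 2 = 4 * k + 2 + 1 + 1 + 1 + 1 by ring]
    simp only [Finset.sum_range_succ _ (4 * k + 2 + 1 + 1 + 1),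
      Finset.sum_range_succ _ (4 * k + 2 + 1 + 1), Finset.sum_range_succ _ (4 * k + 2 + 1),
      Finset.sum_range_succ _ (4 * k + 2), χ₄_nat_eq_if_mod_four]
    have e1 : (4 * k + 2) % 2 = 0 := by omega
    have e2 : (4 * k + 2 + 1) % 2 = 1 := by omega
    have e3 : (4 * k + 2 + 1) % 4 = 3 := by omega
    have e4 : (4 * k + 2 + 1 + 1) % 2 = 0 := by omega
    have e5 : (4 * k + 2 + 1 + 1 + 1) % 2 = 1 := by omega
    have e6 : (4 * k + 2 + 1 + 1 + 1) % 4 = 1 := by omega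
    simp only [e1, e2, e3, e4, e5, e6]
    simp only [χ₄_nat_eq_if_mod_four] at ih
    have h1 := hg (4 * k + 2 + 1) (by omega)
    have h2 := hg (4 * k + 2 + 1 + 1) (by omega)
    norm_num at ih ⊢
    linarith

-- Exchanging summations leaves Σ χ₄(d) g(d), where g(d) is the sum of 1/n over multiples n ≤ X of
-- d. Since g decreases, the alternating sum is at most g(1).
open Finset ZMod in
theorem sum_sum_divisors_chi_four_div_le (X : ℕ) :
    ∑ n ∈ Icc 1 X, (1 : ℝ) / n * ((∑ d ∈ n.divisors, χ₄ (d : ZMod 4) : ℤ) : ℝ) ≤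
      ∑ n ∈ Icc 1 X, (1 : ℝ) / n := by
  set g : ℕ → ℝ := fun d => ∑ m ∈ Icc 1 X, if d * m ≤ X then (1 : ℝ) / ((d * m : ℕ) : ℝ) else 0
    with hg
  have hg1 : g 1 = ∑ n ∈ Icc 1 X, (1 : ℝ) / n := by
    simp only [hg, one_mul]
    exact sum_congr rfl fun m hm => if_pos (mem_Icc.1 hm).2
  have hanti : ∀ d ≥ 1, g (d + 1) ≤ g d := by
    intro d hd
    refine sum_le_sum fun m hm => ?_
    have hm1 := (mem_Icc.1 hm).1
    have hle : d * m ≤ (d + 1) * m := Nat.mul_le_mul_right m (Nat.le_succ d)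
    by_cases h : (d + 1) * m ≤ X
    · rw [if_pos h, if_pos (hle.trans h)]
      have : 0 < d * m := Nat.mul_pos hd hm1
      apply one_div_le_one_div_of_le
      · exact_mod_cast this
      · exact_mod_cast hle
    · rw [if_neg h]
      split_ifs <;> positivity
  have hgd : ∀ d ≥ 1, g d = ∑ n ∈ Icc 1 X with d ∣ n, (1 : ℝ) / n := by
    intro d hd
    simp only [hg]
    rw [← sum_filter]
    symm
    have : (Icc 1 X).filter (d ∣ ·) = ((Icc 1 X).filter (fun m => d * m ≤ X)).image (d * ·) := by
      ext n
      simp only [mem_filter, mem_Icc, mem_image]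
      constructor
      · rintro ⟨⟨h1, h2⟩, t, rfl⟩
        have ht : 1 ≤ t := Nat.pos_of_ne_zero (by rintro rfl; simp at h1)
        exact ⟨t, ⟨⟨ht, (Nat.le_mul_of_pos_left t hd).trans h2⟩, h2⟩, rfl⟩
      · rintro ⟨t, ⟨⟨h1, h2⟩, h3⟩, rfl⟩
        exact ⟨⟨Nat.mul_pos hd h1, h3⟩, dvd_mul_right _ _⟩
    rw [this, sum_image (fun a _ b _ h => Nat.eq_of_mul_eq_mul_left hd h)]
  -- The range is padded up to 4X + 1 to fit the alternating lemma; g vanishes beyond X and χ₄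
  -- vanishes at 0.
  have hswap : ∑ n ∈ Icc 1 X, (1 : ℝ) / n * ((∑ d ∈ n.divisors, χ₄ (d : ZMod 4) : ℤ) : ℝ) =
      ∑ d ∈ range (4 * X + 2), (χ₄ (d : ZMod 4) : ℝ) * g d := by
    have hsub : Icc 1 X ⊆ range (4 * X + 2) := fun d hd => by
      simp only [mem_Icc] at hd; simp only [mem_range]; omega
    have hzero : ∀ d ∈ range (4 * X + 2), d ∉ Icc 1 X → (χ₄ (d : ZMod 4) : ℝ) * g d = 0 := by
      intro d _ hd
      rcases Nat.eq_zero_or_pos d with rfl | hd0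
      · simp
      · have hdX : X < d := by
          by_contra h
          exact hd (mem_Icc.2 ⟨hd0, by omega⟩)
        have : g d = 0 := sum_eq_zero fun m hm => if_neg (by
          have := (mem_Icc.1 hm).1
          have := Nat.le_mul_of_pos_right d this
          omega)
        rw [this, mul_zero]
    rw [← sum_subset hsub hzero]
    have h1 : ∀ d ∈ Icc 1 X, (χ₄ (d : ZMod 4) : ℝ) * g d =
        ∑ n ∈ Icc 1 X, if d ∣ n then (1 : ℝ) / n * (χ₄ (d : ZMod 4) : ℝ) else 0 := by
      intro d hd
      rw [hgd d (mem_Icc.1 hd).1, mul_sum, sum_filter]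
      refine sum_congr rfl fun n _ => ?_
      split_ifs <;> ring
    rw [sum_congr rfl h1, sum_comm]
    refine sum_congr rfl fun n hn => ?_
    have hn' := mem_Icc.1 hn
    rw [← sum_filter]
    have : (Icc 1 X).filter (fun d => d ∣ n) = n.divisors := by
      ext d
      simp only [mem_filter, mem_Icc, Nat.mem_divisors]
      constructor
      · rintro ⟨_, h⟩; exact ⟨h, by omega⟩
      · rintro ⟨h, _⟩
        have := Nat.le_of_dvd (by omega) h
        exact ⟨⟨Nat.pos_of_dvd_of_pos h (by omega), by omega⟩, h⟩
    rw [this, ← mul_sum]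
    push_cast
    rfl
  rw [hswap, ← hg1]
  exact sum_range_chi_four_mul_le hanti X

theorem PrimesIn.mul {c : ℕ → Prop} {m n : ℕ} (hm : PrimesIn c m) (hn : PrimesIn c n) :
    PrimesIn c (m * n) := fun p hp h => (hp.dvd_mul.1 h).elim (hm p hp) (hn p hp)

theorem PrimesIn.mod_four_eq_one {n : ℕ} (hn : n ≠ 0) (h : PrimesIn (· % 4 = 1) n) :
    n % 4 = 1 := by
  induction n using induction_on_primes with
  | zero => exact absurd rfl hn
  | one => rfl
  | prime_mul p m hp ih =>
    have h1 : p % 4 = 1 := h p hp (dvd_mul_right _ _)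
    have h2 := ih (right_ne_zero_of_mul hn) (fun r hr hrm => h r hr (hrm.mul_left p))
    rw [Nat.mul_mod, h1, h2]

-- In the expanded square, n occurs at most as often as it has divisors. If it occurs at all, every
-- divisor is 1 mod 4, so that number is Σ χ₄(d) over d ∣ n; the other n contribute nonnegatively to
-- the right side.
open Classical Finset ZMod in
theorem harmonicIn_one_sq_le (D : ℕ) :
    harmonicIn (· % 4 = 1) D ^ 2 ≤ ∑ n ∈ Icc 1 (D * D), (1 : ℝ) / n := by
  refine le_trans ?_ (sum_sum_divisors_chi_four_div_le (D * D))
  unfold harmonicIn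
  set S := (Icc 1 D).filter (PrimesIn (· % 4 = 1)) with hS
  rw [sq, sum_mul_sum, ← sum_product']
  have hmaps : ∀ x ∈ S ×ˢ S, x.1 * x.2 ∈ Icc 1 (D * D) := by
    intro x hx
    simp only [hS, mem_product, mem_filter, mem_Icc] at hx
    exact mem_Icc.2 ⟨Nat.mul_pos hx.1.1.1 hx.2.1.1, Nat.mul_le_mul hx.1.1.2 hx.2.1.2⟩
  rw [← sum_fiberwise_of_maps_to hmaps]
  refine sum_le_sum fun n hn => ?_
  have h1 : ∀ x ∈ (S ×ˢ S).filter (fun x => x.1 * x.2 = n),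
      (1 : ℝ) / x.1 * ((1 : ℝ) / x.2) = 1 / n := by
    intro x hx
    rw [← (mem_filter.1 hx).2]
    push_cast
    rw [one_div_mul_one_div]
  rw [sum_congr rfl h1, sum_const, nsmul_eq_mul, mul_comm]
  refine mul_le_mul_of_nonneg_left ?_ (by positivity)
  rcases ((S ×ˢ S).filter (fun x => x.1 * x.2 = n)).eq_empty_or_nonempty with he | ⟨x, hx⟩
  · rw [he]
    simpa using (by exact_mod_cast sum_divisors_chi_four_nonneg n :
      (0 : ℝ) ≤ ((∑ d ∈ n.divisors, χ₄ (d : ZMod 4) : ℤ) : ℝ))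
  · have hn0 : n ≠ 0 := by have := (mem_Icc.1 hn).1; omega
    have hnP : PrimesIn (· % 4 = 1) n := by
      simp only [hS, mem_product, mem_filter] at hx
      rw [← hx.2]
      exact hx.1.1.2.mul hx.1.2.2
    have hr : ∑ d ∈ n.divisors, χ₄ (d : ZMod 4) = #n.divisors := by
      rw [card_eq_sum_ones, Nat.cast_sum]
      refine sum_congr rfl fun d hd => ?_
      have hd' := Nat.mem_divisors.1 hd
      rw [χ₄_nat_one_mod_four (PrimesIn.mod_four_eq_one (Nat.pos_of_mem_divisors hd).ne'
        fun p hp h => hnP p hp (h.trans hd'.1))]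
      rfl
    rw [hr]
    have : #((S ×ˢ S).filter (fun x => x.1 * x.2 = n)) ≤ #n.divisors := by
      refine card_le_card_of_injOn (fun x => x.1) ?_ ?_
      · intro x hx
        have := (mem_filter.1 hx).2
        exact Nat.mem_divisors.2 ⟨⟨x.2, this.symm⟩, hn0⟩
      · intro x hx y hy hxy
        have h1 := (mem_filter.1 hx).2
        have h2 := (mem_filter.1 hy).2
        have hx1 : 0 < x.1 := Nat.pos_of_ne_zero fun h => hn0 (by rw [← h1, h, zero_mul])
        simp only at hxy
        refine Prod.ext hxy (Nat.eq_of_mul_eq_mul_left hx1 ?_)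
        rw [h1, hxy, h2]
    exact_mod_cast this

theorem exists_mul_primesIn_mod_four {n : ℕ} (hn : n % 2 = 1) :
    ∃ x : ℕ × ℕ, x.1 * x.2 = n ∧ PrimesIn (· % 4 = 1) x.1 ∧ PrimesIn (· % 4 = 3) x.2 := by
  have hone : ∀ c, PrimesIn c 1 := fun c p hp h => absurd (Nat.dvd_one.1 h) hp.one_lt.ne'
  have hprime : ∀ {c : ℕ → Prop} {p : ℕ}, p.Prime → c p → PrimesIn c p := fun hp hc r hr h => by
    rwa [(Nat.prime_dvd_prime_iff_eq hr hp).1 h]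
  induction n using induction_on_primes with
  | zero => simp at hn
  | one => exact ⟨(1, 1), rfl, hone _, hone _⟩
  | prime_mul p m hp ih =>
    have h1 : p % 2 = 1 := by
      by_contra h
      have : p % 2 = 0 := by omega
      simp [Nat.mul_mod, this] at hn
    have h2 : m % 2 = 1 := by
      by_contra h
      have : m % 2 = 0 := by omega
      simp [Nat.mul_mod, this] at hn
    obtain ⟨⟨a, b⟩, rfl, ha, hb⟩ := ih h2
    have h4 : p % 4 = 1 ∨ p % 4 = 3 := by omega
    rcases h4 with h | h
    · exact ⟨(p * a, b), by ring, (hprime hp h).mul ha, hb⟩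
    · exact ⟨(a, p * b), by ring, ha, (hprime hp h).mul hb⟩

-- Each odd n ≤ D factors as ab, with a and b composed of primes ≡ 1 and ≡ 3 mod 4 respectively, and
-- a, b ≤ D.
open Classical Finset in
theorem sum_odd_le_harmonicIn_mul (D : ℕ) :
    ∑ n ∈ Icc 1 D with n % 2 = 1, (1 : ℝ) / n ≤
      harmonicIn (· % 4 = 1) D * harmonicIn (· % 4 = 3) D := by
  unfold harmonicIn
  rw [sum_mul_sum, ← sum_product']
  have hex : ∀ n : ℕ, ∃ x : ℕ × ℕ, n % 2 = 1 → x.1 * x.2 = n ∧ PrimesIn (· % 4 = 1) x.1 ∧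
      PrimesIn (· % 4 = 3) x.2 := by
    intro n
    by_cases h : n % 2 = 1
    · obtain ⟨x, hx⟩ := exists_mul_primesIn_mod_four h
      exact ⟨x, fun _ => hx⟩
    · exact ⟨(0, 0), fun h' => absurd h' h⟩
  choose f hf using hex
  have hinj : Set.InjOn f ((Icc 1 D).filter (fun n => n % 2 = 1)) := by
    intro a ha b hb hab
    have h1 := (hf a (mem_filter.1 ha).2).1
    have h2 := (hf b (mem_filter.1 hb).2).1
    rw [← h1, ← h2, hab]
  have hval : ∑ n ∈ Icc 1 D with n % 2 = 1, (1 : ℝ) / n =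
      ∑ x ∈ ((Icc 1 D).filter (fun n => n % 2 = 1)).image f, (1 : ℝ) / x.1 * (1 / x.2) := by
    rw [sum_image hinj]
    refine sum_congr rfl fun n hn => ?_
    have h1 := (hf n (mem_filter.1 hn).2).1
    rw [one_div_mul_one_div, ← Nat.cast_mul, h1]
  rw [hval]
  refine sum_le_sum_of_subset_of_nonneg ?_ (fun _ _ _ => by positivity)
  intro x hx
  obtain ⟨n, hn, rfl⟩ := mem_image.1 hx
  simp only [mem_filter, mem_Icc] at hn
  obtain ⟨h1, h2, h3⟩ := hf n hn.2
  have hx1 : 0 < (f n).1 := Nat.pos_of_ne_zero fun h => by rw [h, zero_mul] at h1; omega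
  have hx2 : 0 < (f n).2 := Nat.pos_of_ne_zero fun h => by rw [h, mul_zero] at h1; omega
  have h4 := Nat.le_mul_of_pos_right (f n).1 hx2
  have h5 := Nat.le_mul_of_pos_left (f n).2 hx1
  simp only [mem_product, mem_filter, mem_Icc]
  exact ⟨⟨⟨hx1, by omega⟩, h2⟩, ⟨hx2, by omega⟩, h3⟩

theorem sum_Icc_one_div_eq_harmonic (n : ℕ) :
    ∑ i ∈ Finset.Icc 1 n, (1 : ℝ) / i = harmonic n := by
  rw [harmonic_eq_sum_Icc]
  push_cast
  simp [one_div]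

open Finset in
theorem log_le_two_mul_sum_odd (D : ℕ) :
    Real.log ((D + 1) / 2 : ℕ) ≤ 2 * ∑ n ∈ Icc 1 D with n % 2 = 1, (1 : ℝ) / n := by
  have h1 : Real.log ((D + 1) / 2 : ℕ) ≤ harmonic ((D + 1) / 2) := by
    rcases Nat.eq_zero_or_pos ((D + 1) / 2) with h | h
    · rw [h]; simp
    · refine le_trans (Real.log_le_log (by exact_mod_cast h) ?_) (log_add_one_le_harmonic _)
      push_cast
      linarith
  refine h1.trans ?_
  rw [← sum_Icc_one_div_eq_harmonic, mul_sum]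
  have himg : (Icc 1 D).filter (fun n => n % 2 = 1) =
      (Icc 1 ((D + 1) / 2)).image (fun i => 2 * i - 1) := by
    ext n
    simp only [mem_filter, mem_Icc, mem_image]
    constructor
    · rintro ⟨⟨h1, h2⟩, h3⟩
      exact ⟨(n + 1) / 2, by omega, by omega⟩
    · rintro ⟨i, h1, rfl⟩
      omega
  rw [himg, sum_image]
  · refine sum_le_sum fun i hi => ?_
    have hi1 := (mem_Icc.1 hi).1
    have hi' : (1 : ℝ) ≤ i := by exact_mod_cast hi1
    rw [Nat.cast_sub (by omega)]
    push_cast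
    rw [mul_one_div, div_le_div_iff₀ (by linarith) (by linarith)]
    linarith
  · intro a ha b hb hab
    have h1 := mem_Icc.1 ha
    have h2 := mem_Icc.1 hb
    simp only at hab
    omega

theorem harmonicIn_nonneg (c : ℕ → Prop) (D : ℕ) : 0 ≤ harmonicIn c D :=
  Finset.sum_nonneg fun _ _ => by positivity

/-- Odd integers contribute at least h/6, while the primes ≡ 1 mod 4 account for at most 2√h; the
quotient is left for the primes ≡ 3 mod 4. -/
theorem sqrt_le_harmonicIn_three (h : ℕ) :
    Real.sqrt h / 12 ≤ harmonicIn (· % 4 = 3) (2 ^ h) := by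
  rcases Nat.eq_zero_or_pos h with rfl | hh
  · simpa using harmonicIn_nonneg _ _
  have hh' : (1 : ℝ) ≤ h := by exact_mod_cast hh
  have hlog2 := Real.log_two_gt_d9
  have hlog2' := Real.log_two_lt_d9
  have hO : (h : ℝ) / 6 ≤ ∑ n ∈ Finset.Icc (1 : ℕ) (2 ^ h) with n % 2 = 1, (1 : ℝ) / n := by
    -- For h < 3 the single term n = 1 suffices; the logarithmic bound is too weak there.
    rcases Nat.lt_or_ge h 3 with h3 | h3
    · have : (1 : ℝ) ≤ ∑ n ∈ Finset.Icc (1 : ℕ) (2 ^ h) with n % 2 = 1, (1 : ℝ) / n := by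
        have hm : 1 ∈ (Finset.Icc (1 : ℕ) (2 ^ h)).filter (fun n => n % 2 = 1) := by
          simp [Nat.one_le_two_pow]
        have := Finset.single_le_sum (f := fun n : ℕ => (1 : ℝ) / n)
          (fun _ _ => by positivity) hm
        simpa using this
      have h3' : (h : ℝ) < 3 := by exact_mod_cast h3
      linarith
    · have h1 := log_le_two_mul_sum_odd (2 ^ h)
      have h2 : (2 ^ h + 1) / 2 = 2 ^ (h - 1) := by
        obtain ⟨k, rfl⟩ : ∃ k, h = k + 1 := ⟨h - 1, by omega⟩
        simp only [pow_succ, Nat.add_sub_cancel]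
        omega
      rw [h2] at h1
      push_cast at h1
      rw [Real.log_pow, Nat.cast_sub hh] at h1
      have h3' : (3 : ℝ) ≤ h := by exact_mod_cast h3
      push_cast at h1
      nlinarith
  have hH1 : harmonicIn (· % 4 = 1) (2 ^ h) ≤ 2 * Real.sqrt h := by
    have h1 := harmonicIn_one_sq_le (2 ^ h)
    rw [sum_Icc_one_div_eq_harmonic] at h1
    have h2 := harmonic_le_one_add_log (2 ^ h * 2 ^ h)
    push_cast at h2
    rw [Real.log_mul (by positivity) (by positivity), Real.log_pow] at h2
    refine abs_le_of_sq_le_sq' ?_ (by positivity) |>.2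
    rw [mul_pow, Real.sq_sqrt (by positivity)]
    nlinarith
  have hprod := sum_odd_le_harmonicIn_mul (2 ^ h)
  have h3 := harmonicIn_nonneg (· % 4 = 3) (2 ^ h)
  have hs : 0 < Real.sqrt h := Real.sqrt_pos.2 (by linarith)
  have hss : Real.sqrt h * Real.sqrt h = h := Real.mul_self_sqrt (by linarith)
  have : Real.sqrt h * (Real.sqrt h / 12) ≤
      Real.sqrt h * harmonicIn (· % 4 = 3) (2 ^ h) := by
    nlinarith [mul_le_mul_of_nonneg_right hH1 h3]
  exact le_of_mul_le_mul_left this hs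

theorem log_le_harmonicIn_true (h : ℕ) :
    (h : ℝ) / 2 ≤ harmonicIn (fun _ => True) (2 ^ h) := by
  classical
  have h1 : harmonicIn (fun _ => True) (2 ^ h) = harmonic (2 ^ h) := by
    rw [← sum_Icc_one_div_eq_harmonic, harmonicIn, Finset.filter_true_of_mem]
    exact fun _ _ _ _ _ => trivial
  rw [h1]
  refine le_trans ?_ (log_add_one_le_harmonic _)
  have h2 : Real.log ((2 : ℝ) ^ h) ≤ Real.log (((2 ^ h : ℕ) : ℝ) + 1) := by
    apply Real.log_le_log (by positivity)
    push_cast; linarith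
  rw [Real.log_pow] at h2
  push_cast at h2 ⊢
  have := Real.log_two_gt_d9
  have h0 : (0 : ℝ) ≤ h := by positivity
  nlinarith

/-! ### Sifting arithmetic progressions in intervals -/

theorem abs_card_Ico_modEq_sub_le {k : ℕ} (hk : 0 < k) (r x H : ℕ) :
    |((((Finset.Ico x (x + H)).filter (fun n => n ≡ r [MOD k])).card : ℕ) : ℝ) - H / k| ≤ 1 := by
  have h := Nat.Ico_filter_modEq_card x (x + H) hk r
  have hle : ⌈((x : ℚ) - r) / k⌉ ≤ ⌈(((x + H : ℕ) : ℚ) - r) / k⌉ := by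
    apply Int.ceil_le_ceil
    have : (0 : ℚ) < k := by exact_mod_cast hk
    gcongr
    have : (0 : ℚ) ≤ H := by positivity
    linarith
  have h' : ((((Finset.Ico x (x + H)).filter (fun n => n ≡ r [MOD k])).card : ℕ) : ℚ) =
      ⌈(((x + H : ℕ) : ℚ) - r) / k⌉ - ⌈((x : ℚ) - r) / k⌉ := by
    have h2 : max (⌈(((x + H : ℕ) : ℚ) - r) / k⌉ - ⌈((x : ℚ) - r) / k⌉) 0 =
      ⌈(((x + H : ℕ) : ℚ) - r) / k⌉ - ⌈((x : ℚ) - r) / k⌉ := max_eq_left (by omega)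
    rw [h2] at h
    exact_mod_cast h
  have key : |((((Finset.Ico x (x + H)).filter (fun n => n ≡ r [MOD k])).card : ℕ) : ℚ) - H / k|
      ≤ 1 := by
    rw [h']
    have a1 := Int.le_ceil ((((x + H : ℕ) : ℚ) - r) / k)
    have a2 := Int.ceil_lt_add_one ((((x + H : ℕ) : ℚ) - r) / k)
    have a3 := Int.le_ceil (((x : ℚ) - r) / k)
    have a4 := Int.ceil_lt_add_one (((x : ℚ) - r) / k)
    have e : (((x + H : ℕ) : ℚ) - r) / k = ((x : ℚ) - r) / k + H / k := by
      push_cast; ring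
    rw [e] at a1 a2 ⊢
    rw [abs_le]
    constructor <;> linarith
  have key' := (Rat.cast_le (K := ℝ)).2 key
  push_cast at key'
  exact key'

theorem harmonicIn_pos (c : ℕ → Prop) {D : ℕ} (hD : 1 ≤ D) : 0 < harmonicIn c D := by
  classical
  refine Finset.sum_pos' (fun _ _ => by positivity) ⟨1, ?_, by norm_num⟩
  simp only [Finset.mem_filter, Finset.mem_Icc]
  exact ⟨⟨le_rfl, hD⟩, fun p hp h => absurd (Nat.dvd_one.1 h) hp.one_lt.ne'⟩

open Classical Finset in
/-- The elements of the progression `r` modulo `k` in `[x, x + H)` free of prime factors `p ≤ D`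
satisfying `c` and not dividing `Q`. -/
noncomputable def siftedProgression (c : ℕ → Prop) (Q D k r x H : ℕ) : Finset ℕ :=
  {n ∈ Ico x (x + H) | n ≡ r [MOD k] ∧ ∀ p, p.Prime → c p → p ≤ D → ¬ p ∣ Q → ¬ p ∣ n}

-- Selberg's sieve in a progression. As k ∣ Q, the sieve moduli are coprime to k, so the Chinese
-- remainder theorem applies; leaving out the primes dividing Q costs the factor Q/φ(Q).
open Classical Finset in
theorem card_siftedProgression_le (c : ℕ → Prop) {Q D k : ℕ} (hQ : Q ≠ 0) (hkQ : k ∣ Q)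
    (hD : 1 ≤ D) (r x H : ℕ) :
    ((#(siftedProgression c Q D k r x H) : ℕ) : ℝ) ≤
      (H / k : ℝ) * (Q / Nat.totient Q) / harmonicIn c D + (D : ℝ) ^ 4 := by
  have hk : 0 < k := Nat.pos_of_ne_zero fun h => hQ (by rw [h] at hkQ; exact Nat.zero_dvd.1 hkQ)
  set A := (Ico x (x + H)).filter (fun n => n ≡ r [MOD k]) with hA
  set 𝒟 := sieveSupport c Q D with h𝒟
  have hmem : ∀ d ∈ 𝒟, 1 ≤ d ∧ d ≤ D ∧ Squarefree d ∧ PrimesIn (fun p => c p ∧ ¬ p ∣ Q) d := by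
    intro d hd
    simp only [h𝒟, sieveSupport, mem_filter, mem_Icc] at hd
    exact ⟨hd.1.1, hd.1.2, hd.2.1, hd.2.2⟩
  have hcop : ∀ d ∈ 𝒟, Nat.Coprime k d := by
    intro d hd
    refine Nat.Coprime.symm (Nat.Coprime.coprime_dvd_right hkQ ?_)
    exact Nat.coprime_of_dvd fun p hp hpd hpQ => ((hmem d hd).2.2.2 p hp hpd).2 hpQ
  have hsel := selberg_card_le (A := A) (𝒟 := 𝒟) (X := H / k) (D := D)
    (fun d hd => (hmem d hd).2.2.1)
    (fun d hd e hed => by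
      obtain ⟨h1, h2, h3, h4⟩ := hmem d hd
      simp only [h𝒟, sieveSupport, mem_filter, mem_Icc]
      exact ⟨⟨Nat.pos_of_dvd_of_pos hed h1, (Nat.le_of_dvd h1 hed).trans h2⟩,
        h3.squarefree_of_dvd hed, fun p hp h => h4 p hp (h.trans hed)⟩)
    (sum_sieveSupport_pos c Q hD) (fun d hd => (hmem d hd).2.1)
    (fun d hd e he => by
      set m := Nat.lcm d e with hm
      have hmpos : 0 < m := Nat.lcm_pos (hmem d hd).1 (hmem e he).1
      have hkm : Nat.Coprime k m := (Nat.Coprime.mul_right (hcop d hd) (hcop e he)).coprime_dvd_right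
        (Nat.lcm_dvd_mul d e)
      obtain ⟨s, hs1, hs2⟩ := Nat.chineseRemainder hkm r 0
      have : A.filter (fun n => m ∣ n) = (Ico x (x + H)).filter (fun n => n ≡ s [MOD k * m]) := by
        rw [hA, filter_filter]
        refine filter_congr fun n _ => ?_
        rw [← Nat.modEq_and_modEq_iff_modEq_mul hkm, ← Nat.modEq_zero_iff_dvd]
        exact ⟨fun h => ⟨h.1.trans hs1.symm, h.2.trans hs2.symm⟩,
          fun h => ⟨h.1.trans hs1, h.2.trans hs2⟩⟩
      rw [this]
      have h := abs_card_Ico_modEq_sub_le (Nat.mul_pos hk hmpos) s x H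
      rw [div_div]
      push_cast at h
      exact h)
  have hsub : siftedProgression c Q D k r x H ⊆ A.filter (fun n => ∀ d ∈ 𝒟, d ∣ n → d = 1) := by
    intro n hn
    simp only [siftedProgression, mem_filter] at hn
    refine mem_filter.2 ⟨mem_filter.2 ⟨hn.1, hn.2.1⟩, fun d hd hdn => ?_⟩
    by_contra hd1
    obtain ⟨p, hp, hpd⟩ := Nat.exists_prime_and_dvd hd1
    obtain ⟨h1, h2, h3, h4⟩ := hmem d hd
    exact hn.2.2 p hp (h4 p hp hpd).1 ((Nat.le_of_dvd h1 hpd).trans h2) (h4 p hp hpd).2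
      (hpd.trans hdn)
  have hcard : ((#(siftedProgression c Q D k r x H) : ℕ) : ℝ) ≤
      (#(A.filter (fun n => ∀ d ∈ 𝒟, d ∣ n → d = 1)) : ℕ) := by
    exact_mod_cast card_le_card hsub
  refine (hcard.trans hsel).trans ?_
  refine add_le_add ?_ le_rfl
  have hG := harmonicIn_le c hQ D
  have hpos := harmonicIn_pos c hD
  have hφ := totient_pos_real hQ
  have hQ' : (0 : ℝ) < Q := by exact_mod_cast Nat.pos_of_ne_zero hQ
  set G := ∑ d ∈ 𝒟, (1 : ℝ) / (Nat.totient d : ℝ) with hGdef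
  have hGpos : 0 < G := by
    by_contra h
    have : (Q / Nat.totient Q : ℝ) * G ≤ 0 :=
      mul_nonpos_of_nonneg_of_nonpos (by positivity) (not_lt.1 h)
    linarith
  rw [mul_div_assoc]
  have : 1 / G ≤ (Q / Nat.totient Q : ℝ) / harmonicIn c D := by
    rw [div_le_div_iff₀ hGpos hpos]
    linarith
  calc (H / k : ℝ) / G = (H / k : ℝ) * (1 / G) := by ring
    _ ≤ _ := by gcongr

/-! ### Odd primitive Gaussian integers and a Buchstab identity -/

/-- Multiply a primitive representation of m by p = u² + v² in the Gaussian integers, using u + iv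
or its conjugate. If both products were imprimitive, p would divide both x and y. -/
theorem exists_isCoprime_sq_add_sq {n : ℕ} (hn : n ≠ 0) (h : PrimesIn (· % 4 = 1) n) :
    ∃ x y : ℤ, IsCoprime x y ∧ (n : ℤ) = x ^ 2 + y ^ 2 := by
  induction n using induction_on_primes with
  | zero => exact absurd rfl hn
  | one => exact ⟨1, 0, isCoprime_one_left, by norm_num⟩
  | prime_mul p m hp ih =>
    have hp4 : p % 4 = 1 := h p hp (dvd_mul_right _ _)
    obtain ⟨x, y, ⟨a, b, hab⟩, hm⟩ :=
      ih (right_ne_zero_of_mul hn) (fun r hr hrm => h r hr (hrm.mul_left p))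
    have : Fact p.Prime := ⟨hp⟩
    obtain ⟨u, v, huv⟩ := Nat.Prime.sq_add_sq (p := p) (by omega)
    have hpZ : Prime (p : ℤ) := Nat.prime_iff_prime_int.1 hp
    have huv' : (p : ℤ) = (u : ℤ) ^ 2 + (v : ℤ) ^ 2 := by exact_mod_cast huv.symm
    have hnot : ∀ s t : ℕ, s ^ 2 + t ^ 2 = p → ¬ (p : ℤ) ∣ (s : ℤ) := by
      intro s t hst hdvd
      have hd : p ∣ s := by exact_mod_cast hdvd
      rcases Nat.eq_zero_or_pos s with rfl | hs
      · have : p = t * t := by rw [← hst]; ring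
        exact Nat.not_prime_mul (a := t) (b := t)
          (fun h => by rw [h] at this; exact hp.one_lt.ne' this)
          (fun h => by rw [h] at this; exact hp.one_lt.ne' this) (this ▸ hp)
      · have h1 := Nat.le_of_dvd hs hd
        have h2 := hp.two_le
        nlinarith [Nat.zero_le (t ^ 2)]
    have hu := hnot u v huv
    have hv := hnot v u (by rw [add_comm]; exact huv)
    have h2 : ¬ (p : ℤ) ∣ 2 := by
      intro hd
      have : p ∣ 2 := by exact_mod_cast hd
      have := (Nat.prime_dvd_prime_iff_eq hp Nat.prime_two).1 this
      omega
    have key : ∀ w : ℤ, (p : ℤ) = (u : ℤ) ^ 2 + w ^ 2 → ¬ (p : ℤ) ∣ x * u - y * w →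
        ∃ x' y' : ℤ, IsCoprime x' y' ∧ ((p * m : ℕ) : ℤ) = x' ^ 2 + y' ^ 2 := by
      intro w hw hX
      refine ⟨x * u - y * w, x * w + y * u, ?_, ?_⟩
      -- The ideal generated by the two new coordinates contains p, by `e2`; the first coordinate is
      -- prime to p, so the ideal contains 1.
      · obtain ⟨s, t, hst⟩ := ((hpZ.coprime_iff_not_dvd).2 hX).symm
        refine ⟨s + t * (a * u - b * w), t * (a * w + b * u), ?_⟩
        have e : (p : ℤ) = a * (x * p) + b * (y * p) := by
          linear_combination (-(p : ℤ)) * hab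
        have e2 : (p : ℤ) = (a * u - b * w) * (x * u - y * w) +
            (a * w + b * u) * (x * w + y * u) := by
          rw [e, hw]; ring
        linear_combination hst - t * e2
      · push_cast
        rw [hm, hw]; ring
    by_cases hX : (p : ℤ) ∣ x * u - y * v
    · refine key (-v) (by rw [huv']; ring) fun hX' => ?_
      have h3 : (p : ℤ) ∣ 2 * (x * u) := by
        have := dvd_add hX hX'; ring_nf at this ⊢; exact this
      have h4 : (p : ℤ) ∣ 2 * (y * v) := by
        have := dvd_sub hX' hX; ring_nf at this ⊢; exact this
      have hx : (p : ℤ) ∣ x :=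
        (hpZ.dvd_or_dvd ((hpZ.dvd_or_dvd h3).resolve_left h2)).resolve_right hu
      have hy : (p : ℤ) ∣ y :=
        (hpZ.dvd_or_dvd ((hpZ.dvd_or_dvd h4).resolve_left h2)).resolve_right hv
      exact hpZ.not_isUnit (isUnit_of_dvd_one (hab ▸ dvd_add (hx.mul_left a) (hy.mul_left b)))
    · exact key v huv' hX

theorem primesIn_one_of_odd {n : ℕ} (hn : n % 2 = 1)
    (h : ∀ p, p.Prime → p % 4 = 3 → ¬ p ∣ n) : PrimesIn (· % 4 = 1) n := by
  intro p hp hpn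
  have h2 : p % 2 = 1 := by
    by_contra h2
    have : 2 ∣ n := (Nat.dvd_of_mod_eq_zero (by omega)).trans hpn
    omega
  have h3 : p % 4 ≠ 3 := fun h3 => h p hp h3 hpn
  change p % 4 = 1
  omega

theorem mem_oddPrimitiveGaussian_iff {n : ℕ} :
    n ∈ oddPrimitiveGaussian ↔ n % 4 = 1 ∧ ∀ p, p.Prime → p % 4 = 3 → ¬ p ∣ n := by
  constructor
  · rintro ⟨hodd, x, y, hxy, hn⟩
    constructor
    · have h2 := Nat.odd_iff.1 hodd
      have hx : x % 4 = 0 ∨ x % 4 = 1 ∨ x % 4 = 2 ∨ x % 4 = 3 := by omega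
      have hy : y % 4 = 0 ∨ y % 4 = 1 ∨ y % 4 = 2 ∨ y % 4 = 3 := by omega
      have h4 : n % 4 = ((x % 4) ^ 2 + (y % 4) ^ 2) % 4 := by
        rw [hn, Nat.add_mod, Nat.pow_mod, Nat.pow_mod y]
        simp [Nat.add_mod, Nat.pow_mod]
      rcases hx with h | h | h | h <;> rcases hy with h' | h' | h' | h' <;>
        rw [h, h'] at h4 <;> omega
    · intro p hp hp3 hpn
      have hsq := ZMod.isSquare_neg_one_of_eq_sq_add_sq_of_coprime hn hxy
      have hn0 : n ≠ 0 := by rintro rfl; simp at hodd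
      exact Nat.mod_four_ne_three_of_mem_primeFactors_of_isSquare_neg_one
        (Nat.mem_primeFactors.2 ⟨hp, hpn, hn0⟩) hsq hp3
  · rintro ⟨h1, h⟩
    have hn0 : n ≠ 0 := by rintro rfl; simp at h1
    obtain ⟨x, y, hxy, hn⟩ := exists_isCoprime_sq_add_sq hn0
      (primesIn_one_of_odd (by omega) h)
    refine ⟨Nat.odd_iff.2 (by omega), x.natAbs, y.natAbs,
      Int.isCoprime_iff_gcd_eq_one.1 hxy, ?_⟩
    zify
    simpa using hn

theorem eChar_add (x y : ℝ) : eChar (x + y) = eChar x * eChar y := by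
  simp only [eChar]
  rw [← Complex.exp_add]
  push_cast; ring_nf

theorem norm_eChar (x : ℝ) : ‖eChar x‖ = 1 := by
  have : eChar x = Complex.exp ((2 * Real.pi * x : ℝ) * Complex.I) := by
    simp only [eChar]; push_cast; ring_nf
  rw [this, Complex.norm_exp_ofReal_mul_I]

theorem eChar_int (n : ℤ) : eChar n = 1 := by
  have : eChar n = Complex.exp (n * (2 * Real.pi * Complex.I)) := by
    simp only [eChar]; push_cast; ring_nf
  rw [this, Complex.exp_int_mul_two_pi_mul_I]

/-- `n` has no prime factor `p < z` with `p ≡ 3` modulo `4`. -/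
def SiftedThree (z n : ℕ) : Prop := ∀ p, p.Prime → p % 4 = 3 → p < z → ¬ p ∣ n

/-- The least prime factor of `n` congruent to `3` modulo `4`. -/
noncomputable def minFacThree (n : ℕ) : ℕ := sInf {p | p.Prime ∧ p % 4 = 3 ∧ p ∣ n}

theorem minFacThree_spec {n : ℕ} (h : ∃ p, p.Prime ∧ p % 4 = 3 ∧ p ∣ n) :
    (minFacThree n).Prime ∧ minFacThree n % 4 = 3 ∧ minFacThree n ∣ n := Nat.sInf_mem h

theorem minFacThree_le {n p : ℕ} (hp : p.Prime) (h3 : p % 4 = 3) (hpn : p ∣ n) :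
    minFacThree n ≤ p := Nat.sInf_le ⟨hp, h3, hpn⟩

theorem exists_prime_three_dvd {m : ℕ} (hm : m % 4 = 3) :
    ∃ p, p.Prime ∧ p % 4 = 3 ∧ p ∣ m := by
  by_contra h
  push Not at h
  have := PrimesIn.mod_four_eq_one (n := m) (by rintro rfl; simp at hm)
    (primesIn_one_of_odd (by omega) h)
  omega

open Classical Finset in
/-- The primes `p ≡ 3` modulo `4` with `z ≤ p` and `p ^ 2 ≤ M`. -/
noncomputable def middlePrimes (z M : ℕ) : Finset ℕ :=
  {p ∈ Icc 1 M | p.Prime ∧ p % 4 = 3 ∧ z ≤ p ∧ p * p ≤ M}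

open Classical Finset in
/-- The `m ≤ X`, `m ≡ 3` modulo `4`, without prime factors `≡ 3` modulo `4` below `p`. -/
noncomputable def cofactors (p X : ℕ) : Finset ℕ :=
  {m ∈ Icc 1 X | m % 4 = 3 ∧ SiftedThree p m}

-- The sifted n that are not odd primitive Gaussian are classified by their least prime factor p ≡ 3
-- mod 4; the cofactor then has no such prime factor below p.
open Classical Finset in
theorem buchstab_identity (z M : ℕ) (f : ℕ → ℂ) :
    ∑ n ∈ Icc 1 M with n % 4 = 1 ∧ SiftedThree z n, f n =
      ∑ n ∈ Icc 1 M, bGauss n * f n +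
        ∑ p ∈ middlePrimes z M, ∑ m ∈ cofactors p (M / p), f (p * m) := by
  set S := (Icc 1 M).filter (fun n => n % 4 = 1 ∧ SiftedThree z n) with hS
  rw [← sum_filter_add_sum_filter_not S (fun n => n ∈ oddPrimitiveGaussian)]
  congr 1
  · have : S.filter (fun n => n ∈ oddPrimitiveGaussian) =
        (Icc 1 M).filter (fun n => n ∈ oddPrimitiveGaussian) := by
      ext n
      simp only [hS, mem_filter]
      constructor
      · rintro ⟨⟨h1, _⟩, h2⟩; exact ⟨h1, h2⟩
      · rintro ⟨h1, h2⟩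
        have h3 := mem_oddPrimitiveGaussian_iff.1 h2
        exact ⟨⟨h1, h3.1, fun p hp hp3 _ => h3.2 p hp hp3⟩, h2⟩
    rw [this, sum_filter]
    refine sum_congr rfl fun n _ => ?_
    simp only [bGauss]
    split_ifs <;> simp
  · rw [sum_sigma']
    have hspec : ∀ n ∈ S.filter (fun n => ¬ n ∈ oddPrimitiveGaussian),
        ∃ m, n = minFacThree n * m ∧ (minFacThree n).Prime ∧ minFacThree n ∈ middlePrimes z M ∧
          m ∈ cofactors (minFacThree n) (M / minFacThree n) := by
      intro n hn
      simp only [hS, mem_filter, mem_Icc] at hn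
      obtain ⟨⟨⟨h1, hM⟩, h4, hz⟩, hnot⟩ := hn
      have hex : ∃ p, p.Prime ∧ p % 4 = 3 ∧ p ∣ n := by
        by_contra h
        push Not at h
        exact hnot (mem_oddPrimitiveGaussian_iff.2 ⟨h4, h⟩)
      obtain ⟨hp, hp3, hpn⟩ := minFacThree_spec hex
      have hleast := fun r hr h3 hrn => minFacThree_le (n := n) (p := r) hr h3 hrn
      set p := minFacThree n with hpdef
      obtain ⟨m, hm⟩ := hpn
      have hm3 : m % 4 = 3 := by
        have : n % 4 = (p % 4) * (m % 4) % 4 := by rw [hm, Nat.mul_mod]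
        rw [h4, hp3] at this
        omega
      -- The second prime factor r ≡ 3 mod 4 satisfies p ≤ r ≤ m, which forces p² ≤ n ≤ M.
      obtain ⟨r, hr, hr3, hrm⟩ := exists_prime_three_dvd hm3
      have hpr := hleast r hr hr3 (by rw [hm]; exact hrm.mul_left p)
      have hmpos : 0 < m := by omega
      have hrm' := Nat.le_of_dvd hmpos hrm
      have hpp : p * p ≤ M := by
        calc p * p ≤ p * m := Nat.mul_le_mul_left p (hpr.trans hrm')
          _ = n := hm.symm
          _ ≤ M := hM
      refine ⟨m, hm, hp, ?_, ?_⟩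
      · simp only [middlePrimes, mem_filter, mem_Icc]
        refine ⟨⟨hp.one_lt.le, (Nat.le_mul_self p).trans hpp⟩, hp, hp3, ?_, hpp⟩
        by_contra hlt
        exact hz p hp hp3 (not_le.1 hlt) (by rw [hm]; exact dvd_mul_right _ _)
      · simp only [cofactors, mem_filter, mem_Icc]
        refine ⟨⟨hmpos, (Nat.le_div_iff_mul_le hp.pos).2 (by rw [mul_comm, ← hm]; exact hM)⟩,
          hm3, ?_⟩
        intro s hs hs3 hsp hsm
        exact absurd (hleast s hs hs3 (by rw [hm]; exact hsm.mul_left p)) (not_le.2 hsp)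
    refine sum_nbij' (fun n => ⟨minFacThree n, n / minFacThree n⟩) (fun x => x.1 * x.2) ?_ ?_ ?_ ?_ ?_
    · intro n hn
      obtain ⟨m, hm, hp, h1, h2⟩ := hspec n hn
      have : n / minFacThree n = m := by
        conv_lhs => rw [hm]
        rw [← hm]
        exact Nat.div_eq_of_eq_mul_right hp.pos hm
      simp only [mem_sigma, this]
      exact ⟨h1, h2⟩
    · rintro ⟨p, m⟩ hx
      simp only [mem_sigma, middlePrimes, cofactors, mem_filter, mem_Icc] at hx
      obtain ⟨⟨⟨hp1, hpM⟩, hp, hp3, hzp, hpp⟩, ⟨hm1, hmM⟩, hm3, hsift⟩ := hx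
      simp only [hS, mem_filter, mem_Icc]
      refine ⟨⟨⟨Nat.mul_pos hp1 hm1, ?_⟩, ?_, ?_⟩, ?_⟩
      · rw [mul_comm]; exact (Nat.le_div_iff_mul_le hp.pos).1 hmM
      · rw [Nat.mul_mod, hp3, hm3]
      · intro r hr hr3 hrz hrpm
        rcases hr.dvd_mul.1 hrpm with h | h
        · have := (Nat.prime_dvd_prime_iff_eq hr hp).1 h
          omega
        · exact hsift r hr hr3 (by omega) h
      · intro hmem
        exact (mem_oddPrimitiveGaussian_iff.1 hmem).2 p hp hp3 (dvd_mul_right _ _)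
    · intro n hn
      obtain ⟨m, hm, hp, -, -⟩ := hspec n hn
      exact Nat.mul_div_cancel' (Dvd.intro m hm.symm)
    · rintro ⟨p, m⟩ hx
      simp only [mem_sigma, middlePrimes, cofactors, mem_filter, mem_Icc] at hx
      obtain ⟨⟨⟨hp1, hpM⟩, hp, hp3, hzp, hpp⟩, ⟨hm1, hmM⟩, hm3, hsift⟩ := hx
      have hmin : minFacThree (p * m) = p := by
        apply le_antisymm (minFacThree_le hp hp3 (dvd_mul_right _ _))
        obtain ⟨h1, h2, h3⟩ := minFacThree_spec ⟨p, hp, hp3, dvd_mul_right p m⟩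
        by_contra hlt
        rcases h1.dvd_mul.1 h3 with h | h
        · have := (Nat.prime_dvd_prime_iff_eq h1 hp).1 h
          omega
        · exact hsift _ h1 h2 (not_le.1 hlt) h
      simp only [hmin, Nat.mul_div_cancel_left m hp.pos]
    · intro n hn
      obtain ⟨m, hm, hp, -, -⟩ := hspec n hn
      rw [Nat.mul_div_cancel' (Dvd.intro m hm.symm)]

/-! ### Tools for Brun's sieve and sums over progressions -/

-- Bonferroni: for nonempty U the truncated alternating sum equals ± C(#U − 1, k), which is at most
-- C(#U, k + 1).
open Finset in
theorem abs_sum_powerset_card_le_sub_le {ι : Type*} [DecidableEq ι] (U : Finset ι) (k : ℕ) :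
    |(∑ A ∈ U.powerset with #A ≤ k, (-1 : ℝ) ^ #A) - (if U = ∅ then 1 else 0)| ≤
      #(powersetCard (k + 1) U) := by
  have h1 : ∑ A ∈ U.powerset with #A ≤ k, (-1 : ℝ) ^ #A =
      ((∑ i ∈ range (k + 1), (-1 : ℤ) ^ i * (#U).choose i : ℤ) : ℝ) := by
    have hmaps : ∀ A ∈ U.powerset.filter (fun A => #A ≤ k), #A ∈ range (k + 1) := by
      intro A hA
      have := (mem_filter.1 hA).2
      simp only [mem_range]; omega
    rw [← sum_fiberwise_of_maps_to hmaps]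
    push_cast
    refine sum_congr rfl fun i hi => ?_
    have hfil : (U.powerset.filter (fun A => #A ≤ k)).filter (fun A => #A = i) =
        powersetCard i U := by
      ext A
      simp only [mem_filter, mem_powerset, mem_powersetCard]
      simp only [mem_range] at hi
      constructor
      · rintro ⟨⟨h1, _⟩, h2⟩; exact ⟨h1, h2⟩
      · rintro ⟨h1, h2⟩; exact ⟨⟨h1, by omega⟩, h2⟩
    rw [hfil, sum_congr rfl (fun A hA => by rw [(mem_powersetCard.1 hA).2]), sum_const,
      card_powersetCard, nsmul_eq_mul, mul_comm]
  rw [h1]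
  rcases U.eq_empty_or_nonempty with rfl | hU
  · have : (∑ i ∈ range (k + 1), (-1 : ℤ) ^ i * ((#(∅ : Finset ι)).choose i : ℕ)) = 1 := by
      rw [sum_range_succ']
      simp
    rw [this]; simp
  · obtain ⟨n, hn⟩ : ∃ n, #U = n + 1 := ⟨#U - 1, by have := hU.card_pos; omega⟩
    rw [hn, Int.alternating_sum_range_choose_eq_choose, if_neg hU.ne_empty, card_powersetCard, hn]
    push_cast
    rw [sub_zero, abs_mul, abs_pow, abs_neg, abs_one, one_pow, one_mul, Nat.abs_cast]
    rw [Nat.choose_succ_succ]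
    push_cast
    linarith [(Nat.cast_nonneg (n.choose (k + 1)) : (0 : ℝ) ≤ _)]

-- Rankin's trick: weight each prime by y and compare with the product of the factors 1 + y/p.
open Finset in
theorem sum_powersetCard_inv_prod_le (P : Finset ℕ) (m : ℕ) {y : ℝ} (hy : 0 < y) :
    ∑ A ∈ powersetCard m P, (1 : ℝ) / ((∏ p ∈ A, p : ℕ) : ℝ) ≤
      Real.exp (y * ∑ p ∈ P, (1 : ℝ) / p) / y ^ m := by
  have h1 : ∑ A ∈ P.powerset, ∏ p ∈ A, (y / (p : ℝ)) ≤ Real.exp (y * ∑ p ∈ P, (1 : ℝ) / p) := by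
    rw [← prod_one_add, mul_sum, Real.exp_sum]
    refine prod_le_prod (fun p _ => by positivity) fun p _ => ?_
    have := Real.add_one_le_exp (y * (1 / (p : ℝ)))
    rw [mul_one_div] at this ⊢
    linarith
  rw [le_div_iff₀ (by positivity), sum_mul]
  refine le_trans ?_ h1
  calc _ = ∑ A ∈ powersetCard m P, ∏ p ∈ A, (y / (p : ℝ)) := by
        refine sum_congr rfl fun A hA => ?_
        rw [prod_div_distrib, prod_const, (mem_powersetCard.1 hA).2]
        push_cast
        ring
    _ ≤ _ := by
        refine sum_le_sum_of_subset_of_nonneg ?_ (fun A _ _ => prod_nonneg fun p _ => by positivity)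
        intro A hA
        exact mem_powerset.2 (mem_powersetCard.1 hA).1

theorem norm_sum_geometric_le {w : ℂ} (hw : ‖w‖ = 1) (n : ℕ) {η : ℝ} (hη : 0 < η)
    (h : η ≤ ‖w - 1‖) : ‖∑ l ∈ Finset.range n, w ^ l‖ ≤ 2 / η := by
  have hw1 : w ≠ 1 := by
    rintro rfl
    simp at h
    linarith
  rw [geom_sum_eq hw1, norm_div]
  have : ‖w ^ n - 1‖ ≤ 2 := by
    calc _ ≤ ‖w ^ n‖ + ‖(1 : ℂ)‖ := norm_sub_le _ _
      _ = 2 := by rw [norm_pow, hw]; norm_num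
  gcongr

/-- The powers of w sum to zero, so q is the sum of the 1 − w^l over l < q; each is at most l |w −
1| in norm, and Σ l = q(q − 1)/2. -/
theorem two_div_le_norm_sub_one {q : ℕ} (hq : 0 < q) {w : ℂ} (hw : w ^ q = 1) (hw1 : w ≠ 1) :
    2 / (q : ℝ) ≤ ‖w - 1‖ := by
  have hnorm : ‖w‖ = 1 := by
    have : ‖w‖ ^ q = 1 := by rw [← norm_pow, hw, norm_one]
    exact (pow_eq_one_iff_of_nonneg (norm_nonneg _) hq.ne').1 this
  have hgeom : ∑ l ∈ Finset.range q, w ^ l = 0 := by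
    rw [geom_sum_eq hw1, hw, sub_self, zero_div]
  have hpow : ∀ l : ℕ, ‖w ^ l - 1‖ ≤ l * ‖w - 1‖ := by
    intro l
    rw [← geom_sum_mul, norm_mul]
    refine mul_le_mul_of_nonneg_right ?_ (norm_nonneg _)
    refine (norm_sum_le _ _).trans ?_
    simp [norm_pow, hnorm]
  have h1 : (q : ℂ) = -∑ l ∈ Finset.range q, (w ^ l - 1) := by
    rw [Finset.sum_sub_distrib, hgeom]
    simp
  have h2 : (q : ℝ) ≤ ∑ l ∈ Finset.range q, (l : ℝ) * ‖w - 1‖ := by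
    have : (q : ℝ) = ‖(q : ℂ)‖ := by simp
    rw [this, h1, norm_neg]
    exact (norm_sum_le _ _).trans (Finset.sum_le_sum fun l _ => hpow l)
  rw [← Finset.sum_mul] at h2
  have h3 : (∑ l ∈ Finset.range q, (l : ℝ)) * 2 = q * (q - 1) := by
    have := Finset.sum_range_id_mul_two q
    have h' : ((∑ i ∈ Finset.range q, i : ℕ) : ℝ) * 2 = (q * (q - 1 : ℕ) : ℕ) := by
      exact_mod_cast this
    push_cast [Nat.cast_sub (show 1 ≤ q from hq)] at h'
    exact h'
  have hq' : (0 : ℝ) < q := by exact_mod_cast hq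
  rw [div_le_iff₀ hq']
  have h4 : (q : ℝ) * 2 ≤ q * (q * ‖w - 1‖) := by
    nlinarith [norm_nonneg (w - 1)]
  have := le_of_mul_le_mul_left h4 hq'
  linarith

theorem norm_eChar_sub_one_le (x : ℝ) : ‖eChar x - 1‖ ≤ 2 * Real.pi * |x| := by
  have h := Real.norm_exp_I_mul_ofReal_sub_one_le (x := 2 * Real.pi * x)
  have : eChar x = Complex.exp (Complex.I * (2 * Real.pi * x : ℝ)) := by
    simp only [eChar]; push_cast; ring_nf
  rw [this]
  refine h.trans (le_of_eq ?_)
  rw [Real.norm_eq_abs, abs_mul, abs_of_pos Real.two_pi_pos]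

theorem norm_eChar_sub_eChar_le (x y : ℝ) : ‖eChar x - eChar y‖ ≤ 2 * Real.pi * |x - y| := by
  have : eChar x - eChar y = (eChar (x - y) - 1) * eChar y := by
    rw [sub_mul, ← eChar_add, sub_add_cancel, one_mul]
  rw [this, norm_mul, norm_eChar, mul_one]
  exact norm_eChar_sub_one_le _

theorem eChar_nat_mul (n : ℕ) (x : ℝ) : eChar (n * x) = eChar x ^ n := by
  simp only [eChar]
  rw [← Complex.exp_nat_mul]
  push_cast; ring_nf

theorem eChar_eq_one_iff (x : ℝ) : eChar x = 1 ↔ ∃ n : ℤ, x = n := by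
  simp only [eChar]
  rw [Complex.exp_eq_one_iff]
  constructor
  · rintro ⟨n, hn⟩
    refine ⟨n, ?_⟩
    have h : (2 * Real.pi * Complex.I) * (x : ℂ) = (2 * Real.pi * Complex.I) * (n : ℂ) := by
      rw [hn]; ring
    have := mul_left_cancel₀ Complex.two_pi_I_ne_zero h
    exact_mod_cast this
  · rintro ⟨n, rfl⟩
    exact ⟨n, by push_cast; ring⟩

theorem eChar_div_pow (c : ℤ) {q : ℕ} (hq : 0 < q) : eChar ((c : ℝ) / q) ^ q = 1 := by
  rw [← eChar_nat_mul]
  have hq' : (q : ℝ) ≠ 0 := by exact_mod_cast hq.ne'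
  rw [mul_div_cancel₀ _ hq', eChar_int]

theorem eChar_div_eq_one_iff (c : ℤ) {q : ℕ} (hq : 0 < q) :
    eChar ((c : ℝ) / q) = 1 ↔ (q : ℤ) ∣ c := by
  have hq' : (q : ℝ) ≠ 0 := by exact_mod_cast hq.ne'
  rw [eChar_eq_one_iff]
  constructor
  · rintro ⟨n, hn⟩
    rw [div_eq_iff hq'] at hn
    exact ⟨n, by rw [mul_comm]; exact_mod_cast hn⟩
  · rintro ⟨n, rfl⟩
    refine ⟨n, ?_⟩
    push_cast
    field_simp

open Finset in
theorem exists_filter_modEq_eq_image (M s : ℕ) {K : ℕ} (hK : 0 < K) :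
    ∃ s' L : ℕ, (Icc 1 M).filter (fun n => n ≡ s [MOD K]) =
      (range L).image (fun l => s' + K * l) := by
  -- The representative lies in [1, K] rather than [0, K), since the summation starts at 1.
  obtain ⟨s', h1, h2, hs⟩ : ∃ s', 1 ≤ s' ∧ s' ≤ K ∧ s' ≡ s [MOD K] := by
    rcases Nat.eq_zero_or_pos (s % K) with h | h
    · exact ⟨K, hK, le_rfl, by rw [Nat.ModEq, Nat.mod_self, h]⟩
    · exact ⟨s % K, h, (Nat.mod_lt _ hK).le, Nat.mod_modEq _ _⟩
  refine ⟨s', (M + K - s') / K, ?_⟩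
  have hlt : ∀ l, l < (M + K - s') / K ↔ s' + K * l ≤ M := by
    intro l
    rw [← Nat.add_one_le_iff, Nat.le_div_iff_mul_le hK, add_mul, one_mul, mul_comm l]
    omega
  ext n
  simp only [mem_filter, mem_Icc, mem_image, mem_range, hlt]
  constructor
  · rintro ⟨⟨hn1, hnM⟩, hn⟩
    have hmod : s' ≡ n [MOD K] := hs.trans hn.symm
    have hle : s' ≤ n := by
      by_contra hlt'
      have hd := (Nat.modEq_iff_dvd' (not_le.1 hlt').le).1 hmod.symm
      have := Nat.le_of_dvd (by omega) hd
      omega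
    obtain ⟨l, hl⟩ := (Nat.modEq_iff_dvd' hle).1 hmod
    exact ⟨l, by omega, by omega⟩
  · rintro ⟨l, hl, rfl⟩
    refine ⟨⟨by omega, hl⟩, ?_⟩
    have : s' + K * l ≡ s' [MOD K] := by simp [Nat.ModEq]
    exact this.trans hs

open Finset in
theorem norm_sum_progression_le (M s : ℕ) {K : ℕ} (hK : 0 < K) (α : ℝ) {η : ℝ} (hη : 0 < η)
    (h : η ≤ ‖eChar (K * α) - 1‖) :
    ‖∑ n ∈ Icc 1 M with n ≡ s [MOD K], eChar (n * α)‖ ≤ 2 / η := by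
  obtain ⟨s', L, hL⟩ := exists_filter_modEq_eq_image M s hK
  rw [hL, sum_image (fun a _ b _ hab => Nat.eq_of_mul_eq_mul_left hK (by simpa using hab))]
  have : ∀ l ∈ range L, eChar ((s' + K * l : ℕ) * α) = eChar (s' * α) * eChar (K * α) ^ l := by
    intro l _
    rw [← eChar_nat_mul, ← eChar_add]
    congr 1
    push_cast; ring
  rw [sum_congr rfl this, ← mul_sum, norm_mul, norm_eChar, one_mul]
  exact norm_sum_geometric_le (norm_eChar _) L hη h

theorem totient_two_mul_le (n : ℕ) : Nat.totient (2 * n) ≤ 2 * Nat.totient n := by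
  rcases Nat.even_or_odd n with h | h
  · exact (Nat.totient_two_mul_of_even h).le
  · rw [Nat.totient_two_mul_of_odd h]; omega

theorem totient_le_four_mul_totient_div_gcd {q : ℕ} (hq : 0 < q) :
    Nat.totient q ≤ 4 * Nat.totient (q / Nat.gcd q 4) := by
  set g := q / Nat.gcd q 4
  have hg : q / Nat.gcd q 4 * Nat.gcd q 4 = q := Nat.div_mul_cancel (Nat.gcd_dvd_left q 4)
  have hdvd : q ∣ 2 * (2 * g) := by
    obtain ⟨c, hc⟩ := Nat.gcd_dvd_right q 4
    refine ⟨c, ?_⟩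
    conv_rhs => rw [← hg]
    calc 2 * (2 * g) = g * 4 := by ring
      _ = g * (Nat.gcd q 4 * c) := by rw [← hc]
      _ = _ := by ring
  have hgpos : 0 < g := Nat.pos_of_ne_zero fun h => by
    rw [show q / Nat.gcd q 4 = g from rfl, h, zero_mul] at hg; omega
  have h1 := Nat.le_of_dvd (Nat.totient_pos.2 (by omega)) (Nat.totient_dvd_of_dvd hdvd)
  have h2 := totient_two_mul_le (2 * g)
  have h3 := totient_two_mul_le g
  omega

/-! ### The linear sums -/

open Classical Finset in
/-- The primes `p < z` congruent to `3` modulo `4`. -/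
noncomputable def primesThree (z : ℕ) : Finset ℕ := {p ∈ range z | p.Prime ∧ p % 4 = 3}

open Classical Finset in
/-- The primes `p < z` congruent to `3` modulo `4` dividing `n`. -/
noncomputable def primesThreeOf (z n : ℕ) : Finset ℕ := {p ∈ primesThree z | p ∣ n}

section

open Finset

theorem prime_of_mem_primesThree {z p : ℕ} (h : p ∈ primesThree z) : p.Prime := by
  classical
  exact (mem_filter.1 h).2.1

theorem siftedThree_iff (z n : ℕ) : SiftedThree z n ↔ primesThreeOf z n = ∅ := by
  classical
  simp only [SiftedThree, primesThreeOf, primesThree, filter_eq_empty_iff, mem_filter, mem_range]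
  exact ⟨fun h p hp => h p hp.2.1 hp.2.2 hp.1, fun h p hp h3 hz => h ⟨hz, hp, h3⟩⟩

theorem prod_dvd_iff_of_primes {A : Finset ℕ} (hA : ∀ p ∈ A, p.Prime) (n : ℕ) :
    ∏ p ∈ A, p ∣ n ↔ ∀ p ∈ A, p ∣ n :=
  ⟨fun h _ hp => (dvd_prod_of_mem _ hp).trans h,
    fun h => prod_primes_dvd n (fun p hp => (hA p hp).prime) h⟩

theorem subset_primesThreeOf_iff {z n : ℕ} {A : Finset ℕ} :
    A ⊆ primesThreeOf z n ↔ A ⊆ primesThree z ∧ ∏ p ∈ A, p ∣ n := by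
  classical
  constructor
  · intro h
    have h1 : A ⊆ primesThree z := h.trans (filter_subset _ _)
    exact ⟨h1, (prod_dvd_iff_of_primes (fun p hp => prime_of_mem_primesThree (h1 hp)) n).2
      fun p hp => (mem_filter.1 (h hp)).2⟩
  · rintro ⟨h1, h2⟩ p hp
    exact mem_filter.2 ⟨h1 hp, (dvd_prod_of_mem _ hp).trans h2⟩

theorem squarefree_prod_primes {A : Finset ℕ} (hA : ∀ p ∈ A, p.Prime) :
    Squarefree (∏ p ∈ A, p) :=
  Finset.squarefree_prod_of_pairwise_isCoprime
    (fun p hp q hq hpq => Nat.coprime_iff_isRelPrime.1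
      ((Nat.coprime_primes (hA p hp) (hA q hq)).2 hpq))
    (fun p hp => (hA p hp).prime.squarefree)

theorem card_filter_dvd_le (M d : ℕ) : ((#{n ∈ Icc 1 M | d ∣ n} : ℕ) : ℝ) ≤ M / d := by
  have h := Nat.Ioc_filter_dvd_card_eq_div M d
  have : Ioc 0 M = Icc 1 M := rfl
  rw [this] at h
  rw [h]
  exact Nat.cast_div_le

theorem sum_card_powersetCard_le (z M m : ℕ) :
    ∑ n ∈ Icc 1 M, (#(powersetCard m (primesThreeOf z n)) : ℝ) ≤
      M * ∑ A ∈ powersetCard m (primesThree z), (1 : ℝ) / ((∏ p ∈ A, p : ℕ) : ℝ) := by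
  have h1 : ∀ n ∈ Icc 1 M, (#(powersetCard m (primesThreeOf z n)) : ℝ) =
      ∑ A ∈ powersetCard m (primesThree z), if ∏ p ∈ A, p ∣ n then (1 : ℝ) else 0 := by
    intro n _
    rw [← sum_filter, sum_const, nsmul_eq_mul, mul_one]
    congr 2
    ext A
    simp only [mem_powersetCard, mem_filter, subset_primesThreeOf_iff]
    tauto
  rw [sum_congr rfl h1, sum_comm, mul_sum]
  refine sum_le_sum fun A _ => ?_
  rw [← sum_filter, sum_const, nsmul_eq_mul, mul_one, mul_one_div]
  exact card_filter_dvd_le _ _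

/-- Write n = gm and sift m ≤ M/g by the primes not dividing g; the sieve loss g/φ(g) turns 1/g into
1/φ(g). -/
theorem card_coprime_part_le {g D z : ℕ} (hg : g ≠ 0) (hD : 1 ≤ D) (hDz : D < z) (M : ℕ) :
    ((#{n ∈ Icc 1 M | g ∣ n ∧ primesThreeOf z n \ g.primeFactors = ∅} : ℕ) : ℝ) ≤
      M / Nat.totient g / harmonicIn (· % 4 = 3) D + (D : ℝ) ^ 4 := by
  classical
  have hsub : (Icc 1 M).filter (fun n => g ∣ n ∧ primesThreeOf z n \ g.primeFactors = ∅) ⊆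
      (siftedProgression (· % 4 = 3) g D 1 0 1 (M / g)).image (g * ·) := by
    intro n hn
    simp only [mem_filter, mem_Icc] at hn
    obtain ⟨⟨h1, hM⟩, ⟨m, rfl⟩, hem⟩ := hn
    refine mem_image.2 ⟨m, ?_, rfl⟩
    have hm : m ≤ M / g := (Nat.le_div_iff_mul_le (Nat.pos_of_ne_zero hg)).2
      (by rw [mul_comm]; exact hM)
    have hm1 : 1 ≤ m := Nat.pos_of_ne_zero (by rintro rfl; simp at h1)
    simp only [siftedProgression, mem_filter, mem_Ico]
    refine ⟨⟨hm1, by omega⟩, Nat.modEq_one, fun p hp h3 hpD hpg hpm => ?_⟩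
    have : p ∈ primesThreeOf z (g * m) \ g.primeFactors := by
      simp only [primesThreeOf, primesThree, mem_sdiff, mem_filter, mem_range, Nat.mem_primeFactors]
      exact ⟨⟨⟨by omega, hp, h3⟩, hpm.mul_left g⟩, fun h => hpg h.2.1⟩
    rw [hem] at this
    simp at this
  have h1 := (card_le_card hsub).trans card_image_le
  have h2 := card_siftedProgression_le (· % 4 = 3) hg (one_dvd g) hD 0 1 (M / g)
  have h3 : ((#{n ∈ Icc 1 M | g ∣ n ∧ primesThreeOf z n \ g.primeFactors = ∅} : ℕ) : ℝ) ≤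
      (#(siftedProgression (· % 4 = 3) g D 1 0 1 (M / g)) : ℕ) := by exact_mod_cast h1
  refine (h3.trans h2).trans (add_le_add ?_ le_rfl)
  have hH := harmonicIn_pos (· % 4 = 3) hD
  have hφ := totient_pos_real hg
  have hg' : (0 : ℝ) < g := by exact_mod_cast Nat.pos_of_ne_zero hg
  gcongr
  have h4 : ((M / g : ℕ) : ℝ) ≤ M / g := Nat.cast_div_le
  calc ((M / g : ℕ) : ℝ) / (1 : ℕ) * (g / Nat.totient g)
      ≤ (M / g : ℝ) / (1 : ℕ) * (g / Nat.totient g) := by gcongr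
    _ = _ := by push_cast; field_simp

/-- The sets A with g ∣ ∏ A are the prime set of g joined with a free subset of the other primes.
What remains is again a truncated inclusion-exclusion, at level k − ω(g); if g is not squarefree
with all its primes available, the sum is empty. -/
theorem abs_sum_powerset_dvd_le {z g k : ℕ} (hk : #g.primeFactors ≤ k) (n : ℕ) :
    |∑ A ∈ (primesThreeOf z n).powerset with #A ≤ k ∧ g ∣ ∏ p ∈ A, p, (-1 : ℝ) ^ #A| ≤
      (if g ∣ n ∧ primesThreeOf z n \ g.primeFactors = ∅ then 1 else 0) +
        #(powersetCard (k - #g.primeFactors + 1) (primesThreeOf z n)) := by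
  set U := primesThreeOf z n with hU
  set Γ := g.primeFactors with hΓ
  have hUp : ∀ p ∈ U, p.Prime := fun p hp => by
    classical
    exact prime_of_mem_primesThree (mem_filter.1 hp).1
  have hpf : ∀ A ⊆ U, (∏ p ∈ A, p).primeFactors = A := fun A hA =>
    Nat.primeFactors_prod fun p hp => hUp p (hA hp)
  by_cases hg : Squarefree g ∧ Γ ⊆ U
  · obtain ⟨hsq, hsub⟩ := hg
    have hgprod : ∏ p ∈ Γ, p = g := Nat.prod_primeFactors_of_squarefree hsq
    have hgn : g ∣ n := by
      rw [← hgprod]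
      exact (subset_primesThreeOf_iff.1 hsub).2
    have hbij : ∑ A ∈ U.powerset with #A ≤ k ∧ g ∣ ∏ p ∈ A, p, (-1 : ℝ) ^ #A =
        (-1) ^ #Γ * ∑ A ∈ (U \ Γ).powerset with #A ≤ k - #Γ, (-1 : ℝ) ^ #A := by
      rw [mul_sum]
      symm
      refine sum_nbij' (fun A => Γ ∪ A) (fun A => A \ Γ) ?_ ?_ ?_ ?_ ?_
      · intro A hA
        simp only [mem_filter, mem_powerset] at hA ⊢
        have hdis : Disjoint Γ A := disjoint_of_subset_right hA.1 disjoint_sdiff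
        refine ⟨union_subset hsub (hA.1.trans sdiff_subset), ?_, ?_⟩
        · rw [card_union_of_disjoint hdis]; omega
        · rw [← hgprod]
          exact prod_dvd_prod_of_subset _ _ _ subset_union_left
      · intro A hA
        simp only [mem_filter, mem_powerset] at hA ⊢
        have hΓA : Γ ⊆ A := by
          rw [← hpf A hA.1]
          exact Nat.primeFactors_mono hA.2.2 (squarefree_prod_primes
            fun p hp => hUp p (hA.1 hp)).ne_zero
        refine ⟨sdiff_subset_sdiff hA.1 (Subset.refl _), ?_⟩
        rw [card_sdiff_of_subset hΓA]; omega
      · intro A hA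
        simp only [mem_filter, mem_powerset] at hA
        have hdis : Disjoint Γ A := disjoint_of_subset_right hA.1 disjoint_sdiff
        exact union_sdiff_cancel_left hdis
      · intro A hA
        simp only [mem_filter, mem_powerset] at hA
        have hΓA : Γ ⊆ A := by
          rw [← hpf A hA.1]
          exact Nat.primeFactors_mono hA.2.2 (squarefree_prod_primes
            fun p hp => hUp p (hA.1 hp)).ne_zero
        exact union_sdiff_of_subset hΓA
      · intro A hA
        simp only [mem_filter, mem_powerset] at hA
        have hdis : Disjoint Γ A := disjoint_of_subset_right hA.1 disjoint_sdiff
        rw [card_union_of_disjoint hdis, pow_add]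
    rw [hbij, abs_mul, abs_pow, abs_neg, abs_one, one_pow, one_mul]
    have hB := abs_sum_powerset_card_le_sub_le (U \ Γ) (k - #Γ)
    have hC : ((#(powersetCard (k - #Γ + 1) (U \ Γ)) : ℕ) : ℝ) ≤
        (#(powersetCard (k - #Γ + 1) U) : ℕ) := by
      exact_mod_cast card_le_card (powersetCard_mono sdiff_subset)
    simp only [hgn, true_and]
    rw [abs_le] at hB ⊢
    have h0 : (0 : ℝ) ≤ if U \ Γ = ∅ then 1 else 0 := by split_ifs <;> norm_num
    constructor <;> linarith [hB.1, hB.2]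
  · have hem : (U.powerset.filter (fun A => #A ≤ k ∧ g ∣ ∏ p ∈ A, p)) = ∅ := by
      rw [filter_eq_empty_iff]
      intro A hA h
      rw [mem_powerset] at hA
      have hs := squarefree_prod_primes fun p hp => hUp p (hA hp)
      refine hg ⟨hs.squarefree_of_dvd h.2, ?_⟩
      have := Nat.primeFactors_mono h.2 hs.ne_zero
      rw [hpf A hA] at this
      exact this.trans hA
    rw [hem, sum_empty, abs_zero]
    positivity

theorem card_powerset_card_le_le {z k : ℕ} (hz : 1 ≤ z) (q : ℕ → Prop) [DecidablePred q] :
    #{A ∈ (primesThree z).powerset | #A ≤ k ∧ q (∏ p ∈ A, p)} ≤ z ^ k := by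
  have h : #{A ∈ (primesThree z).powerset | #A ≤ k ∧ q (∏ p ∈ A, p)} ≤ #(Icc 1 (z ^ k)) := by
    refine card_le_card_of_injOn (fun A => ∏ p ∈ A, p) ?_ ?_
    · intro A hA
      have hA' := mem_filter.1 hA
      have hsub := mem_powerset.1 hA'.1
      refine mem_coe.2 (mem_Icc.2 ⟨Nat.pos_of_ne_zero (squarefree_prod_primes
        fun p hp => prime_of_mem_primesThree (hsub hp)).ne_zero, ?_⟩)
      refine (prod_le_pow_card A _ z fun p hp => ?_).trans (Nat.pow_le_pow_right hz hA'.2.1)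
      classical
      have := (mem_filter.1 (hsub hp)).1
      exact (mem_range.1 this).le
    · intro A hA B hB hAB
      have h1 := mem_powerset.1 (mem_filter.1 hA).1
      have h2 := mem_powerset.1 (mem_filter.1 hB).1
      have e1 : (∏ p ∈ A, p).primeFactors = A :=
        Nat.primeFactors_prod fun p hp => prime_of_mem_primesThree (h1 hp)
      have e2 : (∏ p ∈ B, p).primeFactors = B :=
        Nat.primeFactors_prod fun p hp => prime_of_mem_primesThree (h2 hp)
      simp only at hAB
      rw [← e1, ← e2, hAB]
  simpa using h

theorem not_dvd_four_mul {q d : ℕ} (hq : 0 < q) (h : ¬ q / Nat.gcd q 4 ∣ d) : ¬ q ∣ 4 * d := by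
  intro hd
  refine h ?_
  have hc : 0 < Nat.gcd q 4 := Nat.gcd_pos_of_pos_left _ hq
  have hcop := Nat.coprime_div_gcd_div_gcd hc
  have h1 : q / Nat.gcd q 4 * Nat.gcd q 4 = q := Nat.div_mul_cancel (Nat.gcd_dvd_left q 4)
  have h2 : 4 / Nat.gcd q 4 * Nat.gcd q 4 = 4 := Nat.div_mul_cancel (Nat.gcd_dvd_right q 4)
  refine hcop.dvd_of_dvd_mul_left (Nat.dvd_of_mul_dvd_mul_right hc ?_)
  calc q / Nat.gcd q 4 * Nat.gcd q 4 = q := h1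
    _ ∣ 4 * d := hd
    _ = 4 / Nat.gcd q 4 * d * Nat.gcd q 4 := by
      conv_lhs => rw [← h2]
      ring

/-- The two conditions form one class mod 4d. The number e(4da/q) is a nontrivial q-th root of
unity, at distance at least 2/q from 1, and the hypothesis on β lets the perturbation consume at
most half of this. -/
theorem norm_sum_linear_le {q d : ℕ} (hq : 0 < q) {a : ℤ} (ha : IsCoprime a (q : ℤ))
    (hd : d % 2 = 1) (hqd : ¬ q ∣ 4 * d) {β : ℝ}
    (hβ : 8 * Real.pi * q * d * |β| ≤ 1) (M : ℕ) :
    ‖∑ n ∈ Icc 1 M with n % 4 = 1 ∧ d ∣ n, eChar (n * ((a : ℝ) / q + β))‖ ≤ 2 * q := by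
  have hcop : Nat.Coprime 4 d := by
    have : Nat.Coprime 2 d := (Nat.coprime_two_left).2 (Nat.odd_iff.2 hd)
    exact Nat.Coprime.pow_left 2 this
  obtain ⟨s, hs1, hs2⟩ := Nat.chineseRemainder hcop 1 0
  have hfil : (Icc 1 M).filter (fun n => n % 4 = 1 ∧ d ∣ n) =
      (Icc 1 M).filter (fun n => n ≡ s [MOD 4 * d]) := by
    refine filter_congr fun n _ => ?_
    rw [← Nat.modEq_and_modEq_iff_modEq_mul hcop, ← Nat.modEq_zero_iff_dvd]
    exact ⟨fun h => ⟨Nat.ModEq.trans (show n % 4 = 1 % 4 from h.1) hs1.symm, h.2.trans hs2.symm⟩,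
      fun h => ⟨h.1.trans hs1, h.2.trans hs2⟩⟩
  rw [hfil]
  have hq' : (0 : ℝ) < q := by exact_mod_cast hq
  have hK : 0 < 4 * d := by omega
  have hne : eChar (((4 * d * a : ℤ) : ℝ) / q) ≠ 1 := by
    rw [Ne, eChar_div_eq_one_iff _ hq]
    intro h
    have h1 : (q : ℤ) ∣ (4 * d : ℤ) := ha.symm.dvd_of_dvd_mul_right h
    exact hqd (by exact_mod_cast h1)
  have hlow := two_div_le_norm_sub_one hq (eChar_div_pow (4 * d * a) hq) hne
  have hclose := norm_eChar_sub_eChar_le (((4 * d * a : ℤ) : ℝ) / q)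
    (((4 * d : ℕ) : ℝ) * ((a : ℝ) / q + β))
  have hdiff : ((4 * d * a : ℤ) : ℝ) / q - ((4 * d : ℕ) : ℝ) * ((a : ℝ) / q + β) =
      -(4 * d * β) := by
    push_cast; field_simp; ring
  rw [hdiff, abs_neg, abs_mul, abs_of_nonneg (by positivity : (0 : ℝ) ≤ 4 * d)] at hclose
  have hη : 1 / (q : ℝ) ≤ ‖eChar (((4 * d : ℕ) : ℝ) * ((a : ℝ) / q + β)) - 1‖ := by
    have h1 := norm_sub_le_norm_sub_add_norm_sub (eChar (((4 * d * a : ℤ) : ℝ) / q))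
      (eChar (((4 * d : ℕ) : ℝ) * ((a : ℝ) / q + β))) 1
    have h2 : 2 * Real.pi * (4 * d * |β|) ≤ 1 / q := by
      rw [le_div_iff₀ hq']; linarith
    have h3 : 2 / (q : ℝ) = 1 / q + 1 / q := by ring
    linarith
  have h := norm_sum_progression_le M s hK _ (by positivity : 0 < 1 / (q : ℝ)) hη
  refine h.trans (le_of_eq ?_)
  field_simp

end

/-! ### Chebyshev and Mertens type bounds, and Brun's sieve for the linear sum -/

section

open Finset

/-- Chebyshev's argument: the product of these primes is at least (2^i)^#B and divides a primorial,
which is at most 4^(2^(i+1)). -/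
theorem card_primes_dyadic_mul_le (i : ℕ) :
    #{p ∈ Ico (2 ^ i) (2 ^ (i + 1)) | p.Prime} * i ≤ 4 * 2 ^ i := by
  set B := (Ico (2 ^ i) (2 ^ (i + 1))).filter Nat.Prime with hB
  have h1 : (2 ^ i) ^ #B ≤ ∏ p ∈ B, p := by
    rw [← prod_const]
    exact prod_le_prod' fun p hp => (mem_Ico.1 (mem_filter.1 hp).1).1
  have h2 : ∏ p ∈ B, p ≤ primorial (2 ^ (i + 1)) := by
    refine Nat.le_of_dvd (primorial_pos _) ?_
    refine prod_primes_dvd _ (fun p hp => (mem_filter.1 hp).2.prime) fun p hp => ?_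
    have hp' := mem_filter.1 hp
    exact (hp'.2.dvd_primorial_iff).2 (mem_Ico.1 hp'.1).2.le
  have h3 := (h1.trans h2).trans (primorial_le_four_pow _)
  rw [← pow_mul, show (4 : ℕ) = 2 ^ 2 by norm_num, ← pow_mul] at h3
  have h4 := (Nat.pow_le_pow_iff_right (by norm_num)).1 h3
  calc #B * i = i * #B := mul_comm _ _
    _ ≤ 2 * 2 ^ (i + 1) := h4
    _ = 4 * 2 ^ i := by ring

theorem sum_primesThree_inv_le_harmonic (j : ℕ) :
    ∑ p ∈ primesThree (2 ^ (j + 1)), (1 : ℝ) / p ≤ 4 * ∑ i ∈ Icc 1 j, (1 : ℝ) / i := by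
  classical
  induction j with
  | zero =>
    have : primesThree (2 ^ (0 + 1)) = ∅ := by
      simp only [primesThree, filter_eq_empty_iff, mem_range]
      intro p hp h
      have := h.1.two_le
      omega
    rw [this]; simp
  | succ j ih =>
    have hsub : primesThree (2 ^ (j + 1 + 1)) ⊆ primesThree (2 ^ (j + 1)) ∪
        (Ico (2 ^ (j + 1)) (2 ^ (j + 1 + 1))).filter Nat.Prime := by
      intro p hp
      simp only [primesThree, mem_filter, mem_range, mem_union, mem_Ico] at hp ⊢
      by_cases h : p < 2 ^ (j + 1)
      · exact Or.inl ⟨h, hp.2⟩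
      · exact Or.inr ⟨⟨not_lt.1 h, hp.1⟩, hp.2.1⟩
    have h1 := sum_le_sum_of_subset_of_nonneg (f := fun p : ℕ => (1 : ℝ) / p) hsub
      (fun _ _ _ => by positivity)
    have hdis : Disjoint (primesThree (2 ^ (j + 1)))
        ((Ico (2 ^ (j + 1)) (2 ^ (j + 1 + 1))).filter Nat.Prime) := by
      rw [disjoint_left]
      intro p hp hq
      simp only [primesThree, mem_filter, mem_range, mem_Ico] at hp hq
      omega
    rw [sum_union hdis] at h1
    have h2 : ∑ p ∈ Ico (2 ^ (j + 1) : ℕ) (2 ^ (j + 1 + 1)) with p.Prime, (1 : ℝ) / p ≤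
        4 * (1 / ((j + 1 : ℕ) : ℝ)) := by
      have h3 : ∀ p ∈ (Ico (2 ^ (j + 1)) (2 ^ (j + 1 + 1))).filter Nat.Prime,
          (1 : ℝ) / p ≤ 1 / 2 ^ (j + 1) := by
        intro p hp
        have := (mem_Ico.1 (mem_filter.1 hp).1).1
        have h' : ((2 : ℝ) ^ (j + 1)) ≤ p := by exact_mod_cast this
        exact one_div_le_one_div_of_le (by positivity) h'
      refine (sum_le_card_nsmul _ _ _ h3).trans ?_
      rw [nsmul_eq_mul, mul_one_div, mul_one_div, div_le_div_iff₀ (by positivity) (by positivity)]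
      exact_mod_cast card_primes_dyadic_mul_le (j + 1)
    rw [sum_Icc_succ_top (by omega), mul_add]
    linarith

theorem sum_primesThree_inv_le (j : ℕ) :
    ∑ p ∈ primesThree (2 ^ (j + 1)), (1 : ℝ) / p ≤ 4 * (1 + Real.log j) := by
  refine (sum_primesThree_inv_le_harmonic j).trans ?_
  rw [sum_Icc_one_div_eq_harmonic]
  have := harmonic_le_one_add_log j
  linarith

-- Brun's sieve at truncation level k. The factor 2 before the exponential counts two truncation
-- errors: that of the sieve itself and that of the part with g ∣ d.
open Classical in
theorem norm_linear_sum_le {M q z k D : ℕ} (hq : 0 < q) {a : ℤ} (ha : IsCoprime a (q : ℤ))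
    {β : ℝ} (hD : 1 ≤ D) (hDz : D < z) (hβ : 8 * Real.pi * q * (z ^ k : ℕ) * |β| ≤ 1)
    (hk : #q.primeFactors ≤ k) {y : ℝ} (hy : 1 ≤ y) :
    ‖∑ n ∈ Icc 1 M with n % 4 = 1 ∧ SiftedThree z n, eChar (n * ((a : ℝ) / q + β))‖ ≤
      2 * M * (Real.exp (y * ∑ p ∈ primesThree z, (1 : ℝ) / p) / y ^ (k - #q.primeFactors)) +
        2 * q * (z ^ k : ℕ) + 4 * M / Nat.totient q / harmonicIn (· % 4 = 3) D + (D : ℝ) ^ 4 := by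
  set P := primesThree z with hP
  set g := q / Nat.gcd q 4 with hg
  set α : ℝ := (a : ℝ) / q + β with hα
  set I := (Icc 1 M).filter (fun n => n % 4 = 1) with hI
  have hgq : g ∣ q := Nat.div_dvd_of_dvd (Nat.gcd_dvd_left q 4)
  have hg0 : g ≠ 0 := fun h => by rw [h, zero_dvd_iff] at hgq; omega
  have hgk : #g.primeFactors ≤ #q.primeFactors :=
    card_le_card (Nat.primeFactors_mono hgq hq.ne')
  set E : ℝ := Real.exp (y * ∑ p ∈ P, (1 : ℝ) / p) / y ^ (k - #q.primeFactors) with hE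
  have hErr : ∀ m, k - #q.primeFactors ≤ m →
      ∑ n ∈ Icc 1 M, (#(powersetCard m (primesThreeOf z n)) : ℝ) ≤ M * E := by
    intro m hm
    refine (sum_card_powersetCard_le z M m).trans ?_
    refine mul_le_mul_of_nonneg_left ?_ (by positivity)
    refine (sum_powersetCard_inv_prod_le P m (y := y) (by linarith)).trans ?_
    rw [hE]
    gcongr
  -- W is the truncated sieve weight. W1 keeps the moduli for which the exponential sum cancels; W2
  -- keeps the multiples of g, which are estimated without cancellation in n.
  set W : ℕ → ℝ := fun n => ∑ A ∈ (primesThreeOf z n).powerset with #A ≤ k, (-1 : ℝ) ^ #A with hW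
  set W1 : ℕ → ℝ := fun n =>
    ∑ A ∈ (primesThreeOf z n).powerset with #A ≤ k ∧ ¬ g ∣ ∏ p ∈ A, p, (-1 : ℝ) ^ #A with hW1
  set W2 : ℕ → ℝ := fun n =>
    ∑ A ∈ (primesThreeOf z n).powerset with #A ≤ k ∧ g ∣ ∏ p ∈ A, p, (-1 : ℝ) ^ #A with hW2
  have hWsplit : ∀ n, W n = W2 n + W1 n := by
    intro n
    simp only [hW, hW1, hW2]
    rw [← sum_filter_add_sum_filter_not _ (fun A => g ∣ ∏ p ∈ A, p), filter_filter, filter_filter]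
  have hT : ∑ n ∈ Icc 1 M with n % 4 = 1 ∧ SiftedThree z n, eChar (n * α) =
      ∑ n ∈ I, ((((if primesThreeOf z n = ∅ then 1 else 0) - W n : ℝ) : ℂ) * eChar (n * α)) +
      ∑ n ∈ I, ((W2 n : ℝ) : ℂ) * eChar (n * α) + ∑ n ∈ I, ((W1 n : ℝ) : ℂ) * eChar (n * α) := by
    rw [← sum_add_distrib, ← sum_add_distrib, ← filter_filter, sum_filter]
    refine sum_congr rfl fun n _ => ?_
    rw [← add_mul, ← add_mul, ← Complex.ofReal_add, ← Complex.ofReal_add, hWsplit,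
      show ∀ x : ℝ, x - (W2 n + W1 n) + W2 n + W1 n = x from fun x => by ring]
    by_cases h : SiftedThree z n
    · rw [if_pos h, if_pos ((siftedThree_iff z n).1 h)]; simp
    · rw [if_neg h, if_neg (fun h' => h ((siftedThree_iff z n).2 h'))]; simp
  have hb0 : ‖∑ n ∈ I, ((((if primesThreeOf z n = ∅ then 1 else 0) - W n : ℝ) : ℂ) *
      eChar (n * α))‖ ≤ M * E := by
    refine (norm_sum_le _ _).trans (le_trans ?_ (hErr (k + 1) (by omega)))
    refine (sum_le_sum fun n _ => ?_).trans
      (sum_le_sum_of_subset_of_nonneg (filter_subset _ _) (fun _ _ _ => by positivity))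
    rw [norm_mul, norm_eChar, mul_one, Complex.norm_real, Real.norm_eq_abs, abs_sub_comm]
    exact abs_sum_powerset_card_le_sub_le _ _
  have hb2 : ‖∑ n ∈ I, ((W2 n : ℝ) : ℂ) * eChar (n * α)‖ ≤
      (4 * M / Nat.totient q / harmonicIn (· % 4 = 3) D + (D : ℝ) ^ 4) + M * E := by
    have h1 : ‖∑ n ∈ I, ((W2 n : ℝ) : ℂ) * eChar (n * α)‖ ≤ ∑ n ∈ Icc 1 M,
        ((if g ∣ n ∧ primesThreeOf z n \ g.primeFactors = ∅ then (1 : ℝ) else 0) +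
          #(powersetCard (k - #g.primeFactors + 1) (primesThreeOf z n))) := by
      refine (norm_sum_le _ _).trans ((sum_le_sum fun n _ => ?_).trans
        (sum_le_sum_of_subset_of_nonneg (filter_subset _ _) (fun _ _ _ => by positivity)))
      rw [norm_mul, norm_eChar, mul_one, Complex.norm_real, Real.norm_eq_abs]
      exact abs_sum_powerset_dvd_le (hgk.trans hk) n
    refine h1.trans ?_
    rw [sum_add_distrib]
    refine add_le_add ?_ (hErr _ (by omega))
    rw [← sum_filter, sum_const, nsmul_eq_mul, mul_one]
    have h2 := card_coprime_part_le hg0 hD hDz M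
    refine le_trans (by convert h2) (add_le_add ?_ le_rfl)
    have hφ := totient_pos_real hg0
    have hφq := totient_pos_real hq.ne'
    have hH := harmonicIn_pos (· % 4 = 3) hD
    refine div_le_div_of_nonneg_right ?_ hH.le
    rw [div_le_div_iff₀ hφ hφq]
    have h4 : (Nat.totient q : ℝ) ≤ 4 * Nat.totient g := by
      exact_mod_cast totient_le_four_mul_totient_div_gcd hq
    nlinarith [(Nat.cast_nonneg M : (0 : ℝ) ≤ M)]
  have hb1 : ‖∑ n ∈ I, ((W1 n : ℝ) : ℂ) * eChar (n * α)‖ ≤ 2 * q * (z ^ k : ℕ) := by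
    have h1 : ∑ n ∈ I, ((W1 n : ℝ) : ℂ) * eChar (n * α) =
        ∑ A ∈ P.powerset with #A ≤ k ∧ ¬ g ∣ ∏ p ∈ A, p,
          (-1 : ℂ) ^ #A * ∑ n ∈ Icc 1 M with n % 4 = 1 ∧ ∏ p ∈ A, p ∣ n, eChar (n * α) := by
      have h2 : ∀ n ∈ I, ((W1 n : ℝ) : ℂ) * eChar (n * α) =
          ∑ A ∈ P.powerset with #A ≤ k ∧ ¬ g ∣ ∏ p ∈ A, p,
            if ∏ p ∈ A, p ∣ n then (-1 : ℂ) ^ #A * eChar (n * α) else 0 := by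
        intro n _
        rw [← sum_filter]
        simp only [hW1]
        push_cast
        rw [sum_mul]
        refine sum_congr ?_ fun _ _ => rfl
        ext A
        simp only [mem_filter, mem_powerset, subset_primesThreeOf_iff]
        tauto
      rw [sum_congr rfl h2, sum_comm]
      refine sum_congr rfl fun A _ => ?_
      rw [← filter_filter, mul_sum, ← sum_filter]
    rw [h1]
    have h3 : ∀ A ∈ P.powerset.filter (fun A => #A ≤ k ∧ ¬ g ∣ ∏ p ∈ A, p),
        ‖(-1 : ℂ) ^ #A * ∑ n ∈ Icc 1 M with n % 4 = 1 ∧ ∏ p ∈ A, p ∣ n, eChar (n * α)‖ ≤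
          2 * q := by
      intro A hA
      have hA' := mem_filter.1 hA
      have hsub := mem_powerset.1 hA'.1
      rw [norm_mul, norm_pow, norm_neg, norm_one, one_pow, one_mul]
      refine norm_sum_linear_le hq ha ?_ (not_dvd_four_mul hq hA'.2.2) ?_ M
      · by_contra hodd
        obtain ⟨p, hp, h2p⟩ := (Nat.prime_two.prime.dvd_finsetProd_iff _).1
          (Nat.dvd_of_mod_eq_zero (n := ∏ p ∈ A, p) (m := 2) (by omega))
        have := (mem_filter.1 (hsub hp)).2.2
        omega
      · refine le_trans ?_ hβ
        have : ∏ p ∈ A, p ≤ z ^ k := by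
          refine (prod_le_pow_card A _ z fun p hp => ?_).trans
            (Nat.pow_le_pow_right (by omega) hA'.2.1)
          exact (mem_range.1 (mem_filter.1 (hsub hp)).1).le
        have h' : ((∏ p ∈ A, p : ℕ) : ℝ) ≤ (z ^ k : ℕ) := by exact_mod_cast this
        have := Real.pi_pos
        gcongr
    refine (norm_sum_le_of_le _ h3).trans ?_
    rw [sum_const, nsmul_eq_mul, mul_comm]
    have h4 := card_powerset_card_le_le (z := z) (k := k) (by omega) (fun d => ¬ g ∣ d)
    have h5 : ((#(P.powerset.filter (fun A => #A ≤ k ∧ ¬ g ∣ ∏ p ∈ A, p)) : ℕ) : ℝ) ≤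
        (z ^ k : ℕ) := by
      refine le_trans (le_of_eq ?_) (Nat.cast_le.2 h4)
      congr!
    gcongr
  rw [hT]
  refine (norm_add₃_le).trans ?_
  linarith

end

/-! ### The bilinear sums -/

section

open Finset

theorem conj_eChar (x : ℝ) : (starRingEnd ℂ) (eChar x) = eChar (-x) := by
  simp only [eChar]
  rw [← Complex.exp_conj]
  congr 1
  simp only [map_mul, Complex.conj_ofReal, Complex.conj_I, map_ofNat, Complex.ofReal_neg]
  ring

theorem sum_range_eChar_div {q : ℕ} (hq : 0 < q) (c : ℤ) :
    ∑ r ∈ range q, eChar (r * ((c : ℝ) / q)) = if (q : ℤ) ∣ c then (q : ℂ) else 0 := by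
  simp only [eChar_nat_mul]
  split_ifs with h
  · rw [(eChar_div_eq_one_iff c hq).2 h]; simp
  · have hne : eChar ((c : ℝ) / q) ≠ 1 := fun h' => h ((eChar_div_eq_one_iff c hq).1 h')
    rw [geom_sum_eq hne, eChar_div_pow c hq, sub_self, zero_div]

/-- Parseval on the residues mod q: expanding the square leaves the pairs of S congruent mod q. -/
theorem sum_norm_sq_eChar_eq {q : ℕ} (hq : 0 < q) {a : ℤ} (ha : IsCoprime a (q : ℤ))
    (S : Finset ℕ) :
    ∑ r ∈ range q, ‖∑ p ∈ S, eChar (p * r * ((a : ℝ) / q))‖ ^ 2 =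
      q * ∑ p ∈ S, (#{s ∈ S | s ≡ p [MOD q]} : ℝ) := by
  have h1 : ∀ r ∈ range q, ((‖∑ p ∈ S, eChar (p * r * ((a : ℝ) / q))‖ ^ 2 : ℝ) : ℂ) =
      ∑ p ∈ S, ∑ s ∈ S, eChar (r * ((((p : ℤ) - s) * a : ℤ) / q)) := by
    intro r _
    rw [Complex.ofReal_pow, ← Complex.mul_conj', map_sum, sum_mul_sum]
    refine sum_congr rfl fun p _ => sum_congr rfl fun s _ => ?_
    rw [conj_eChar, ← eChar_add]
    congr 1
    push_cast; ring
  have h2 : ((∑ r ∈ range q, ‖∑ p ∈ S, eChar (p * r * ((a : ℝ) / q))‖ ^ 2 : ℝ) : ℂ) =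
      ((q * ∑ p ∈ S, (#{s ∈ S | s ≡ p [MOD q]} : ℝ) : ℝ) : ℂ) := by
    rw [Complex.ofReal_sum, sum_congr rfl h1, sum_comm]
    push_cast
    rw [mul_sum]
    refine sum_congr rfl fun p _ => ?_
    rw [sum_comm]
    rw [card_eq_sum_ones, Nat.cast_sum, sum_filter, mul_sum]
    refine sum_congr rfl fun s _ => ?_
    have key := sum_range_eChar_div hq (((p : ℤ) - s) * a)
    push_cast at key
    rw [key]
    have : (q : ℤ) ∣ ((p : ℤ) - s) * a ↔ s ≡ p [MOD q] := by
      rw [Nat.modEq_iff_dvd]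
      exact ⟨fun h => ha.symm.dvd_of_dvd_mul_right h, fun h => h.mul_right a⟩
    simp only [this]
    split_ifs <;> simp
  exact_mod_cast h2

theorem eChar_mul_modEq {q : ℕ} (hq : 0 < q) (a : ℤ) {m r : ℕ} (h : m ≡ r [MOD q]) (p : ℕ) :
    eChar (p * m * ((a : ℝ) / q)) = eChar (p * r * ((a : ℝ) / q)) := by
  obtain ⟨c, hc⟩ := (Nat.modEq_iff_dvd.1 h.symm)
  have hq' : (q : ℝ) ≠ 0 := by exact_mod_cast hq.ne'
  have hm : (m : ℝ) = r + q * c := by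
    have : (m : ℤ) = r + q * c := by linarith
    exact_mod_cast this
  have : (p : ℝ) * m * ((a : ℝ) / q) = p * r * ((a : ℝ) / q) + ((p * c * a : ℤ) : ℝ) := by
    rw [hm]; push_cast; field_simp
  rw [this, eChar_add, eChar_int, mul_one]

/-- Cauchy-Schwarz over m; the inner sum depends only on m mod q, so W pays for the multiplicity of
each class and Parseval handles the classes. -/
theorem norm_bilinear_sq_le {q : ℕ} (hq : 0 < q) {a : ℤ} (ha : IsCoprime a (q : ℤ))
    (S T : Finset ℕ) {f : ℕ → ℂ} (hf : ∀ m, ‖f m‖ ≤ 1) {W R : ℝ} (hW0 : 0 ≤ W)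
    (hW : ∀ r, (#{m ∈ T | m ≡ r [MOD q]} : ℝ) ≤ W)
    (hR : ∀ r, (#{p ∈ S | p ≡ r [MOD q]} : ℝ) ≤ R) :
    ‖∑ m ∈ T, f m * ∑ p ∈ S, eChar (p * m * ((a : ℝ) / q))‖ ^ 2 ≤
      #T * W * (q * (#S * R)) := by
  set g : ℕ → ℝ := fun m => ‖∑ p ∈ S, eChar (p * m * ((a : ℝ) / q))‖ with hg
  have h1 : ‖∑ m ∈ T, f m * ∑ p ∈ S, eChar (p * m * ((a : ℝ) / q))‖ ≤ ∑ m ∈ T, 1 * g m := by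
    refine norm_sum_le_of_le _ fun m _ => ?_
    rw [norm_mul]
    exact mul_le_mul_of_nonneg_right (hf m) (norm_nonneg _)
  have h2 : (∑ m ∈ T, 1 * g m) ^ 2 ≤ (∑ m ∈ T, (1 : ℝ) ^ 2) * ∑ m ∈ T, g m ^ 2 :=
    sum_mul_sq_le_sq_mul_sq _ _ _
  have h3 : ∑ m ∈ T, g m ^ 2 ≤ W * ∑ r ∈ range q, g r ^ 2 := by
    have hmaps : ∀ m ∈ T, m % q ∈ range q := fun m _ => mem_range.2 (Nat.mod_lt _ hq)
    rw [← sum_fiberwise_of_maps_to hmaps, mul_sum]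
    refine sum_le_sum fun r hr => ?_
    have hval : ∀ m ∈ T.filter (fun m => m % q = r), g m ^ 2 = g r ^ 2 := by
      intro m hm
      have hmr : m ≡ r [MOD q] := by
        rw [Nat.ModEq, (mem_filter.1 hm).2, Nat.mod_eq_of_lt (mem_range.1 hr)]
      simp only [hg]
      rw [sum_congr rfl fun p _ => eChar_mul_modEq hq a hmr p]
    rw [sum_congr rfl hval, sum_const, nsmul_eq_mul]
    refine mul_le_mul_of_nonneg_right ?_ (by positivity)
    refine le_trans (le_of_eq ?_) (hW r)
    congr 2
    refine filter_congr fun m _ => ?_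
    rw [Nat.ModEq, Nat.mod_eq_of_lt (mem_range.1 hr)]
  have h4 : ∑ r ∈ range q, g r ^ 2 ≤ q * (#S * R) := by
    rw [sum_norm_sq_eChar_eq hq ha S]
    refine mul_le_mul_of_nonneg_left ?_ (by positivity)
    refine (sum_le_sum fun p _ => hR p).trans ?_
    rw [sum_const, nsmul_eq_mul]
  calc _ ≤ (∑ m ∈ T, 1 * g m) ^ 2 := by gcongr
    _ ≤ _ := h2
    _ ≤ (#T : ℝ) * (W * (q * (#S * R))) := by
      have : ∑ m ∈ T, (1 : ℝ) ^ 2 = #T := by simp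
      rw [this]
      refine mul_le_mul_of_nonneg_left (h3.trans ?_) (by positivity)
      exact mul_le_mul_of_nonneg_left h4 hW0
    _ = _ := by ring

/-- The sieve at level D = 2^h. The lower bound on X absorbs the error D⁴, since φ(q)√h ≤ q 2^h. -/
theorem card_sifted_three_le {q h X : ℕ} (hq : 0 < q) (hX : 2 ^ (5 * h) * q ≤ X) (hh : 1 ≤ h)
    (r x : ℕ) :
    ((#(siftedProgression (· % 4 = 3) q (2 ^ h) q r x X) : ℕ) : ℝ) ≤
      13 * X / (Nat.totient q * Real.sqrt h) := by
  have h1 := card_siftedProgression_le (· % 4 = 3) hq.ne' dvd_rfl (Nat.one_le_two_pow (n := h)) r x X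
  have hφ := totient_pos_real hq.ne'
  have hq' : (0 : ℝ) < q := by exact_mod_cast hq
  have hh' : (1 : ℝ) ≤ h := by exact_mod_cast hh
  have hs : 0 < Real.sqrt h := Real.sqrt_pos.2 (by linarith)
  have hH := sqrt_le_harmonicIn_three h
  have h2 : (X / q : ℝ) * (q / Nat.totient q) / harmonicIn (· % 4 = 3) (2 ^ h) ≤
      12 * X / (Nat.totient q * Real.sqrt h) := by
    calc _ ≤ (X / q : ℝ) * (q / Nat.totient q) / (Real.sqrt h / 12) := by gcongr
      _ = _ := by field_simp
  have h3 : (((2 ^ h : ℕ) : ℝ)) ^ 4 ≤ X / (Nat.totient q * Real.sqrt h) := by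
    rw [le_div_iff₀ (by positivity)]
    have e1 : (Nat.totient q : ℝ) ≤ q := by exact_mod_cast Nat.totient_le q
    have e2 : Real.sqrt h ≤ 2 ^ h := by
      have : (h : ℝ) ≤ 2 ^ h := by exact_mod_cast Nat.lt_two_pow_self.le
      refine le_trans ?_ this
      rw [Real.sqrt_le_left (by linarith)]
      nlinarith
    calc _ ≤ (((2 ^ h : ℕ) : ℝ)) ^ 4 * (q * 2 ^ h) := by gcongr
      _ = ((2 ^ (5 * h) * q : ℕ) : ℝ) := by push_cast; ring
      _ ≤ X := by exact_mod_cast hX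
  calc _ ≤ _ := h1
    _ ≤ _ := add_le_add h2 h3
    _ = _ := by ring

theorem card_sifted_all_le {q h X : ℕ} (hq : 0 < q) (hX : 2 ^ (5 * h) * q ≤ X) (hh : 1 ≤ h)
    (r x : ℕ) :
    ((#(siftedProgression (fun _ => True) q (2 ^ h) q r x X) : ℕ) : ℝ) ≤
      3 * X / (Nat.totient q * h) := by
  have h1 := card_siftedProgression_le (fun _ => True) hq.ne' dvd_rfl
    (Nat.one_le_two_pow (n := h)) r x X
  have hφ := totient_pos_real hq.ne'
  have hq' : (0 : ℝ) < q := by exact_mod_cast hq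
  have hh' : (1 : ℝ) ≤ h := by exact_mod_cast hh
  have hH := log_le_harmonicIn_true h
  have h2 : (X / q : ℝ) * (q / Nat.totient q) / harmonicIn (fun _ => True) (2 ^ h) ≤
      2 * X / (Nat.totient q * h) := by
    calc _ ≤ (X / q : ℝ) * (q / Nat.totient q) / ((h : ℝ) / 2) := by gcongr
      _ = _ := by field_simp
  have h3 : (((2 ^ h : ℕ) : ℝ)) ^ 4 ≤ X / (Nat.totient q * h) := by
    rw [le_div_iff₀ (by positivity)]
    have e1 : (Nat.totient q : ℝ) ≤ q := by exact_mod_cast Nat.totient_le q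
    have e2 : (h : ℝ) ≤ 2 ^ h := by exact_mod_cast Nat.lt_two_pow_self.le
    calc _ ≤ (((2 ^ h : ℕ) : ℝ)) ^ 4 * (q * 2 ^ h) := by gcongr
      _ = ((2 ^ (5 * h) * q : ℕ) : ℝ) := by push_cast; ring
      _ ≤ X := by exact_mod_cast hX
  calc _ ≤ _ := h1
    _ ≤ _ := add_le_add h2 h3
    _ = _ := by ring

end

/-! ### Blocks of nearly equal primes -/

section

open Finset

/-- A cofactor is lost either because it lies in (M/p, M/P] or because it has a prime factor in [P,
p); each case accounts for about MH/P² integers at most. -/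
theorem card_cofactors_sdiff_le {M P H p : ℕ} (hP : 0 < P) (hPp : P ≤ p) (hpH : p < P + H) :
    ((#(cofactors P (M / P) \ cofactors p (M / p)) : ℕ) : ℝ) ≤
      2 * (M * H / (P : ℝ) ^ 2) + 1 := by
  classical
  have hsub : cofactors P (M / P) \ cofactors p (M / p) ⊆
      Ioc (M / p) (M / P) ∪ (Ico P (P + H)).biUnion
        (fun s => (Icc 1 (M / P)).filter (fun m => s ∣ m)) := by
    intro m hm
    simp only [cofactors, mem_sdiff, mem_filter, mem_Icc] at hm
    obtain ⟨⟨⟨h1, hX⟩, h3, hs⟩, hnot⟩ := hm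
    rw [mem_union]
    by_cases hle : m ≤ M / p
    · right
      have : ¬ SiftedThree p m := fun h => hnot ⟨⟨h1, hle⟩, h3, h⟩
      simp only [SiftedThree] at this
      push Not at this
      obtain ⟨s, hsp, hs3, hslt, hsm⟩ := this
      have hPs : P ≤ s := by
        by_contra h
        exact hs s hsp hs3 (not_le.1 h) hsm
      exact mem_biUnion.2 ⟨s, mem_Ico.2 ⟨hPs, by omega⟩,
        mem_filter.2 ⟨mem_Icc.2 ⟨h1, hX⟩, hsm⟩⟩
    · left
      exact mem_Ioc.2 ⟨not_le.1 hle, hX⟩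
  have hP' : (0 : ℝ) < P := by exact_mod_cast hP
  have hp0 : 0 < p := by omega
  have hp' : (0 : ℝ) < p := by exact_mod_cast hp0
  have hPp' : (P : ℝ) ≤ p := by exact_mod_cast hPp
  have hpH' : (p : ℝ) ≤ P + H := by exact_mod_cast hpH.le
  have hX : ((M / P : ℕ) : ℝ) ≤ M / P := Nat.cast_div_le
  have h1 : ((#(Ioc (M / p) (M / P)) : ℕ) : ℝ) ≤ M * H / (P : ℝ) ^ 2 + 1 := by
    rw [Nat.card_Ioc, Nat.cast_sub (Nat.div_le_div_left hPp hP)]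
    have h2 : (M : ℝ) / p < (M / p : ℕ) + 1 := by
      rw [div_lt_iff₀ hp']
      have := Nat.lt_mul_div_succ M hp0
      have h' : (M : ℝ) < p * ((M / p : ℕ) + 1) := by exact_mod_cast this
      linarith
    have h3 : (M : ℝ) / P - M / p ≤ M * H / (P : ℝ) ^ 2 := by
      rw [div_sub_div _ _ hP'.ne' hp'.ne', div_le_div_iff₀ (by positivity) (by positivity)]
      have e1 : (M : ℝ) * p - P * M ≤ M * H := by
        nlinarith [(Nat.cast_nonneg M : (0 : ℝ) ≤ M)]
      calc _ ≤ (M * H : ℝ) * (P : ℝ) ^ 2 := by gcongr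
        _ = (M * H : ℝ) * (P * P) := by ring
        _ ≤ _ := by gcongr
    linarith
  have h2 : ((#((Ico P (P + H)).biUnion
      (fun s => (Icc 1 (M / P)).filter (fun m => s ∣ m))) : ℕ) : ℝ) ≤ M * H / (P : ℝ) ^ 2 := by
    have h3 := card_biUnion_le (s := Ico P (P + H))
      (t := fun s => (Icc 1 (M / P)).filter (fun m => s ∣ m))
    have h4 : ∑ s ∈ Ico P (P + H), ((#((Icc 1 (M / P)).filter (fun m => s ∣ m)) : ℕ) : ℝ) ≤
        ∑ s ∈ Ico P (P + H), (M / P : ℝ) / P := by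
      refine sum_le_sum fun s hs => (card_filter_dvd_le _ _).trans ?_
      have : (P : ℝ) ≤ s := by exact_mod_cast (mem_Ico.1 hs).1
      gcongr
    rw [sum_const, Nat.card_Ico, Nat.add_sub_cancel_left, nsmul_eq_mul] at h4
    calc _ ≤ ∑ s ∈ Ico P (P + H), ((#((Icc 1 (M / P)).filter (fun m => s ∣ m)) : ℕ) : ℝ) := by
          exact_mod_cast h3
      _ ≤ _ := h4
      _ = _ := by field_simp
  have h3 := (card_le_card hsub).trans (card_union_le _ _)
  have h4 : ((#(cofactors P (M / P) \ cofactors p (M / p)) : ℕ) : ℝ) ≤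
      (#(Ioc (M / p) (M / P)) : ℕ) + (#((Ico P (P + H)).biUnion
      (fun s => (Icc 1 (M / P)).filter (fun m => s ∣ m))) : ℕ) := by exact_mod_cast h3
  linarith

theorem cofactors_subset {M P p : ℕ} (hP : 0 < P) (hPp : P ≤ p) :
    cofactors p (M / p) ⊆ cofactors P (M / P) := by
  classical
  intro m hm
  simp only [cofactors, mem_filter, mem_Icc] at hm ⊢
  exact ⟨⟨hm.1.1, hm.1.2.trans (Nat.div_le_div_left hPp hP)⟩, hm.2.1,
    fun r hr h3 hrP => hm.2.2 r hr h3 (by omega)⟩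

/-- This is the price of replacing p by P in the range of m, in its sieve condition and in the slow
phase pmβ. Only the rational phase pma/q still depends on p, so the sum becomes truly bilinear. -/
theorem norm_sum_cofactors_sub_le {M P H p q : ℕ} (a : ℤ) (β : ℝ) (hP : 0 < P) (hPp : P ≤ p)
    (hpH : p < P + H) :
    ‖∑ m ∈ cofactors p (M / p), eChar ((p * m : ℕ) * ((a : ℝ) / q + β)) -
      ∑ m ∈ cofactors P (M / P), eChar (P * m * β) * eChar (p * m * ((a : ℝ) / q))‖ ≤
      M * H / (P : ℝ) ^ 2 * (2 * Real.pi * |β| * M + 2) + 1 := by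
  classical
  set T := cofactors P (M / P) with hT
  set T' := cofactors p (M / p) with hT'
  have hsub : T' ⊆ T := cofactors_subset hP hPp
  have hP' : (0 : ℝ) < P := by exact_mod_cast hP
  have hX : ((M / P : ℕ) : ℝ) ≤ M / P := Nat.cast_div_le
  have hPp' : (P : ℝ) ≤ p := by exact_mod_cast hPp
  have hpH' : (p : ℝ) ≤ P + H := by exact_mod_cast hpH.le
  have hTX : ∀ m ∈ T', (m : ℝ) ≤ M / P := by
    intro m hm
    have := (mem_Icc.1 (mem_filter.1 (hsub hm)).1).2
    exact le_trans (by exact_mod_cast this) hX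
  have hcard : ((#T' : ℕ) : ℝ) ≤ M / P := by
    have h1 : #T' ≤ #(Icc 1 (M / P)) := card_le_card (hsub.trans (filter_subset _ _))
    rw [Nat.card_Icc, Nat.add_sub_cancel] at h1
    exact le_trans (by exact_mod_cast h1) hX
  rw [← sum_sdiff hsub (f := fun m : ℕ => eChar (P * m * β) * eChar (p * m * ((a : ℝ) / q))),
    sub_add_eq_sub_sub_swap, ← sum_sub_distrib]
  have h1 : ‖∑ m ∈ T', (eChar ((p * m : ℕ) * ((a : ℝ) / q + β)) -
      eChar (P * m * β) * eChar (p * m * ((a : ℝ) / q)))‖ ≤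
      #T' * (2 * Real.pi * (H * (M / P) * |β|)) := by
    rw [← nsmul_eq_mul, ← sum_const]
    refine norm_sum_le_of_le _ fun m hm => ?_
    have e1 : ((p * m : ℕ) : ℝ) * ((a : ℝ) / q + β) = p * m * β + p * m * ((a : ℝ) / q) := by
      push_cast; ring
    rw [e1, eChar_add, ← sub_mul, norm_mul, norm_eChar, mul_one]
    refine (norm_eChar_sub_eChar_le _ _).trans ?_
    have e2 : (p : ℝ) * m * β - P * m * β = (p - P) * m * β := by ring
    rw [e2, abs_mul, abs_mul, Nat.abs_cast, abs_of_nonneg (by linarith)]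
    have := hTX m hm
    have hpi := Real.pi_pos
    have h5 : (p : ℝ) - P ≤ H := by linarith
    gcongr
  have h2 : ‖∑ m ∈ T \ T', eChar (P * m * β) * eChar (p * m * ((a : ℝ) / q))‖ ≤ #(T \ T') := by
    refine (norm_sum_le_of_le (f := fun m : ℕ =>
      eChar (P * m * β) * eChar (p * m * ((a : ℝ) / q))) (n := fun _ => 1) _ fun m _ => ?_).trans
      (by simp)
    rw [norm_mul, norm_eChar, norm_eChar, mul_one]
  have h3 := card_cofactors_sdiff_le (M := M) hP hPp hpH
  refine (norm_sub_le _ _).trans ?_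
  have h4 : (#T' : ℝ) * (2 * Real.pi * (H * (M / P) * |β|)) ≤
      M / P * (2 * Real.pi * (H * (M / P) * |β|)) := by
    have hpi := Real.pi_pos
    gcongr
  have h5 : (M : ℝ) / P * (2 * Real.pi * (H * (M / P) * |β|)) =
      M * H / (P : ℝ) ^ 2 * (2 * Real.pi * |β| * M) := by
    field_simp
  rw [mul_add]
  linarith

/-- Freeze the block at P and apply the bilinear bound with Selberg estimates for both variables,
overall and in classes mod q. The constant 39 is 13 · 3 from those estimates, and the last summand
is the total freezing error. -/
theorem norm_block_le {M q P H h : ℕ} (hq : 0 < q) {a : ℤ} (ha : IsCoprime a (q : ℤ)) (β : ℝ)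
    (hh : 1 ≤ h) (hHP : H ≤ P) (hH : 2 ^ (5 * h) * q ≤ H) {S : Finset ℕ}
    (hS : ∀ p ∈ S, p.Prime ∧ p * p ≤ M ∧ P ≤ p ∧ p < P + H) :
    ‖∑ p ∈ S, ∑ m ∈ cofactors p (M / p), eChar ((p * m : ℕ) * ((a : ℝ) / q + β))‖ ≤
      39 * (M / P * H * Real.sqrt q / (Nat.totient q * (h * Real.sqrt h))) +
        (M * H ^ 2 / (P : ℝ) ^ 2 * (2 * Real.pi * |β| * M + 2) + H) := by
  classical
  rcases S.eq_empty_or_nonempty with rfl | ⟨p₀, hp₀⟩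
  · rw [sum_empty, norm_zero]
    have := Real.pi_pos
    positivity
  have hDH : 2 ^ (5 * h) ≤ H := (Nat.le_mul_of_pos_right _ hq).trans hH
  have hDP : 2 ^ h < P := by
    have : 2 ^ h < 2 ^ (5 * h) := Nat.pow_lt_pow_right (by norm_num) (by omega)
    exact this.trans_le (hDH.trans hHP)
  have hP : 0 < P := (Nat.zero_le _).trans_lt hDP
  set X := M / P with hX
  -- A nonempty block contains p ≥ P with p² ≤ M. So the range of m is at least as long as P, hence
  -- as H, and the sieve level suits both variables.
  have hPX : P ≤ X := by
    obtain ⟨-, h1, h2, -⟩ := hS p₀ hp₀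
    exact (Nat.le_div_iff_mul_le hP).2 ((Nat.mul_le_mul h2 h2).trans h1)
  have hHX : 2 ^ (5 * h) * q ≤ X := by omega
  have hφ := totient_pos_real hq.ne'
  have hq' : (0 : ℝ) < q := by exact_mod_cast hq
  have hP' : (0 : ℝ) < P := by exact_mod_cast hP
  have hh' : (0 : ℝ) < h := by exact_mod_cast hh
  have hs : 0 < Real.sqrt h := Real.sqrt_pos.2 hh'
  set T := cofactors P X with hT
  have hTcard : (#T : ℝ) ≤ 13 * X / Real.sqrt h := by
    have h1 := card_sifted_three_le (q := 1) (X := X) one_pos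
      (by rw [mul_one]; exact hDH.trans (hHP.trans hPX)) hh 0 1
    have hsub : T ⊆ siftedProgression (· % 4 = 3) 1 (2 ^ h) 1 0 1 X := by
      intro m hm
      simp only [hT, cofactors, siftedProgression, mem_filter, mem_Icc, mem_Ico] at hm ⊢
      exact ⟨⟨hm.1.1, by omega⟩, Nat.modEq_one,
        fun p hp h3 hpD _ => hm.2.2 p hp h3 (by omega)⟩
    have h2 : (#T : ℝ) ≤ #(siftedProgression (· % 4 = 3) 1 (2 ^ h) 1 0 1 X) := by
      exact_mod_cast card_le_card hsub
    refine h2.trans (h1.trans (le_of_eq ?_))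
    simp
  have hTmod : ∀ r, (#{m ∈ T | m ≡ r [MOD q]} : ℝ) ≤ 13 * X / (Nat.totient q * Real.sqrt h) := by
    intro r
    refine le_trans ?_ (card_sifted_three_le hq hHX hh r 1)
    have hsub : T.filter (fun m => m ≡ r [MOD q]) ⊆
        siftedProgression (· % 4 = 3) q (2 ^ h) q r 1 X := by
      intro m hm
      simp only [hT, cofactors, siftedProgression, mem_filter, mem_Icc, mem_Ico] at hm ⊢
      exact ⟨⟨hm.1.1.1, by omega⟩, hm.2,
        fun p hp h3 hpD _ => hm.1.2.2 p hp h3 (by omega)⟩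
    exact_mod_cast card_le_card hsub
  have hprime : ∀ p ∈ S, ∀ s, s.Prime → s ≤ 2 ^ h → ¬ s ∣ p := by
    intro p hp s hs hsD hsp
    obtain ⟨h1, -, h2, -⟩ := hS p hp
    have := (Nat.prime_dvd_prime_iff_eq hs h1).1 hsp
    omega
  have hScard : (#S : ℝ) ≤ 3 * H / h := by
    have h1 := card_sifted_all_le (q := 1) (X := H) one_pos (by rw [mul_one]; exact hDH) hh 0 P
    have hsub : S ⊆ siftedProgression (fun _ => True) 1 (2 ^ h) 1 0 P H := by
      intro p hp
      obtain ⟨-, -, h2, h3⟩ := hS p hp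
      simp only [siftedProgression, mem_filter, mem_Ico]
      exact ⟨⟨h2, h3⟩, Nat.modEq_one, fun s hs _ hsD _ => hprime p hp s hs hsD⟩
    have h2 : (#S : ℝ) ≤ #(siftedProgression (fun _ => True) 1 (2 ^ h) 1 0 P H) := by
      exact_mod_cast card_le_card hsub
    refine h2.trans (h1.trans (le_of_eq ?_))
    simp
  have hSmod : ∀ r, (#{p ∈ S | p ≡ r [MOD q]} : ℝ) ≤ 3 * H / (Nat.totient q * h) := by
    intro r
    refine le_trans ?_ (card_sifted_all_le hq hH hh r P)
    have hsub : S.filter (fun p => p ≡ r [MOD q]) ⊆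
        siftedProgression (fun _ => True) q (2 ^ h) q r P H := by
      intro p hp
      have hp' := mem_filter.1 hp
      obtain ⟨-, -, h2, h3⟩ := hS p hp'.1
      simp only [siftedProgression, mem_filter, mem_Ico]
      exact ⟨⟨h2, h3⟩, hp'.2, fun s hs _ hsD _ => hprime p hp'.1 s hs hsD⟩
    exact_mod_cast card_le_card hsub
  set B := ∑ m ∈ T, eChar (P * m * β) * ∑ p ∈ S, eChar (p * m * ((a : ℝ) / q)) with hB
  have hBsq : ‖B‖ ^ 2 ≤
      (39 * (X * H * Real.sqrt q / (Nat.totient q * (h * Real.sqrt h)))) ^ 2 := by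
    have h1 := norm_bilinear_sq_le hq ha S T (f := fun m => eChar (P * m * β))
      (fun m => (norm_eChar _).le) (by positivity) hTmod hSmod
    refine h1.trans ?_
    calc _ ≤ (13 * X / Real.sqrt h) * (13 * X / (Nat.totient q * Real.sqrt h)) *
          (q * ((3 * H / h) * (3 * H / (Nat.totient q * h)))) := by gcongr
      _ = _ := by
        have e1 : Real.sqrt q ^ 2 = q := Real.sq_sqrt hq'.le
        rw [mul_pow, div_pow, mul_pow, mul_pow, e1]
        field_simp
        ring
  have hBle : ‖B‖ ≤ 39 * (M / P * H * Real.sqrt q / (Nat.totient q * (h * Real.sqrt h))) := by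
    refine (abs_le_of_sq_le_sq' hBsq (by positivity) |>.2).trans ?_
    have : (X : ℝ) ≤ M / P := Nat.cast_div_le
    gcongr
  have hdiff : ‖∑ p ∈ S, ∑ m ∈ cofactors p (M / p), eChar ((p * m : ℕ) * ((a : ℝ) / q + β)) - B‖ ≤
      #S * (M * H / (P : ℝ) ^ 2 * (2 * Real.pi * |β| * M + 2) + 1) := by
    have : B = ∑ p ∈ S, ∑ m ∈ T, eChar (P * m * β) * eChar (p * m * ((a : ℝ) / q)) := by
      rw [hB, sum_comm]
      exact sum_congr rfl fun m _ => mul_sum _ _ _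
    rw [this, ← sum_sub_distrib, ← nsmul_eq_mul, ← sum_const]
    refine norm_sum_le_of_le _ fun p hp => ?_
    obtain ⟨-, -, h2, h3⟩ := hS p hp
    exact norm_sum_cofactors_sub_le a β hP h2 h3
  have hSH : (#S : ℝ) ≤ H := by
    have : S ⊆ Ico P (P + H) := fun p hp => mem_Ico.2 ⟨(hS p hp).2.2.1, (hS p hp).2.2.2⟩
    have := card_le_card this
    rw [Nat.card_Ico, Nat.add_sub_cancel_left] at this
    exact_mod_cast this
  have hpi := Real.pi_pos
  have hE : (#S : ℝ) * (M * H / (P : ℝ) ^ 2 * (2 * Real.pi * |β| * M + 2) + 1) ≤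
      M * H ^ 2 / (P : ℝ) ^ 2 * (2 * Real.pi * |β| * M + 2) + H := by
    calc _ ≤ (H : ℝ) * (M * H / (P : ℝ) ^ 2 * (2 * Real.pi * |β| * M + 2) + 1) := by gcongr
      _ = _ := by ring
  have := norm_sub_norm_le (∑ p ∈ S, ∑ m ∈ cofactors p (M / p),
    eChar ((p * m : ℕ) * ((a : ℝ) / q + β))) B
  linarith

end

/-! ### Summation over all middle primes -/

section

open Finset

theorem one_div_mul_sqrt_le {j : ℕ} (hj : 1 ≤ j) :
    1 / ((j : ℝ) * Real.sqrt j) ≤ 4 * (1 / Real.sqrt j - 1 / Real.sqrt ((j + 1 : ℕ) : ℝ)) := by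
  have hj' : (1 : ℝ) ≤ j := by exact_mod_cast hj
  set u := Real.sqrt j with hu
  set v := Real.sqrt ((j + 1 : ℕ) : ℝ) with hv
  have hu0 : 0 < u := Real.sqrt_pos.2 (by linarith)
  have hv0 : 0 < v := Real.sqrt_pos.2 (by push_cast; linarith)
  have hu2 : u * u = j := Real.mul_self_sqrt (by linarith)
  have hv2 : v * v = j + 1 := by
    rw [hv, Real.mul_self_sqrt (by positivity)]; push_cast; ring
  have huv : u ≤ v := Real.sqrt_le_sqrt (by push_cast; linarith)
  have hv1 : v ≤ 3 / 2 * u := by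
    refine abs_le_of_sq_le_sq' ?_ (by positivity) |>.2
    nlinarith
  have hd : (v - u) * (v + u) = 1 := by ring_nf; nlinarith
  have hd2 : 1 ≤ (v - u) * (5 / 2 * u) := by
    rw [← hd]
    exact mul_le_mul_of_nonneg_left (by linarith) (by linarith)
  have hd3 : v ≤ 4 * (v - u) * (j : ℝ) := by
    rw [← hu2]
    nlinarith
  have e : 4 * (1 / u - 1 / v) = 4 * (v - u) / (u * v) := by field_simp
  rw [e, div_le_div_iff₀ (by positivity) (by positivity)]
  nlinarith

theorem sum_one_div_mul_sqrt_le {m n : ℕ} (hm : 1 ≤ m) :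
    ∑ j ∈ Ico m n, 1 / ((j : ℝ) * Real.sqrt j) ≤ 4 / Real.sqrt m := by
  rcases le_or_gt m n with h | h
  · have key : ∑ j ∈ Ico m n, 1 / ((j : ℝ) * Real.sqrt j) ≤
        4 / Real.sqrt m - 4 / Real.sqrt n := by
      induction n, h using Nat.le_induction with
      | base => simp
      | succ n hmn ih =>
        rw [sum_Ico_succ_top hmn]
        have := one_div_mul_sqrt_le (hm.trans hmn)
        have e : ∀ x : ℝ, 4 / x = 4 * (1 / x) := fun x => by ring
        rw [e, e] at ih ⊢
        linarith
    refine key.trans ?_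
    have : 0 ≤ 4 / Real.sqrt n := by positivity
    linarith
  · rw [Ico_eq_empty (by omega), sum_empty]
    positivity

/-- Passes from the sieve level 2^(j/10) back to the scale 2^j; 90 = 20 · 9/2, from j ≤ 20 ⌊j/10⌋
and √20 ≤ 9/2. -/
theorem one_div_div_ten_le {j : ℕ} (hj : 10 ≤ j) :
    1 / (((j / 10 : ℕ) : ℝ) * Real.sqrt ((j / 10 : ℕ) : ℝ)) ≤
      90 * (1 / ((j : ℝ) * Real.sqrt j)) := by
  set h := j / 10 with hh
  have h1 : j ≤ 20 * h := by omega
  have hj' : (10 : ℝ) ≤ j := by exact_mod_cast hj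
  have h1' : (j : ℝ) ≤ 20 * h := by exact_mod_cast h1
  have hpos : (0 : ℝ) < h := by linarith
  have h2 : Real.sqrt j ≤ 9 / 2 * Real.sqrt h := by
    rw [Real.sqrt_le_left (by positivity), mul_pow, Real.sq_sqrt hpos.le]
    linarith
  have hs : 0 < Real.sqrt h := Real.sqrt_pos.2 hpos
  have hs' : 0 < Real.sqrt j := Real.sqrt_pos.2 (by linarith)
  rw [mul_one_div, div_le_div_iff₀ (by positivity) (by positivity)]
  calc 1 * ((j : ℝ) * Real.sqrt j) ≤ 1 * (20 * h * (9 / 2 * Real.sqrt h)) := by gcongr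
    _ = _ := by ring

/-- Each dyadic range of p is cut into 2^κ equal blocks. Main terms at scale 2^j add up to a
multiple of j^(−3/2), whose sum over j ≥ j₁ is at most 4/√j₁, while the freezing errors gain a
factor 2^(−κ). -/
theorem norm_middle_sum_le {M q j₁ κ l : ℕ} (hq : 0 < q) {a : ℤ} (ha : IsCoprime a (q : ℤ))
    (β : ℝ) (hj : 10 ≤ j₁) (hql : q ≤ 2 ^ l) (hjl : 2 * (κ + l) ≤ j₁) :
    ‖∑ p ∈ middlePrimes (2 ^ j₁) M, ∑ m ∈ cofactors p (M / p),
        eChar ((p * m : ℕ) * ((a : ℝ) / q + β))‖ ≤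
      15000 * (M * Real.sqrt q / (Nat.totient q * Real.sqrt j₁)) +
        ((Nat.log 2 (Nat.sqrt M) + 1) * (M / 2 ^ κ * (2 * Real.pi * |β| * M + 2)) +
          2 * 2 ^ Nat.log 2 (Nat.sqrt M)) := by
  classical
  set J := Nat.log 2 (Nat.sqrt M) with hJ
  set F : ℕ → ℂ := fun p => ∑ m ∈ cofactors p (M / p),
    eChar ((p * m : ℕ) * ((a : ℝ) / q + β)) with hF
  set S := middlePrimes (2 ^ j₁) M with hS
  set φ : ℕ → ℕ × ℕ := fun p => (Nat.log 2 p, (p - 2 ^ Nat.log 2 p) / 2 ^ (Nat.log 2 p - κ)) with hφdef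
  set C : ℝ := 2 * Real.pi * |β| * M + 2 with hC
  have hpi := Real.pi_pos
  have hC0 : 0 ≤ C := by positivity
  have hmem : ∀ p ∈ S, p.Prime ∧ p * p ≤ M ∧ j₁ ≤ Nat.log 2 p ∧ Nat.log 2 p < J + 1 := by
    intro p hp
    simp only [hS, middlePrimes, mem_filter, mem_Icc] at hp
    refine ⟨hp.2.1, hp.2.2.2.2, ?_, ?_⟩
    · exact Nat.le_log_of_pow_le (by norm_num) hp.2.2.2.1
    · have : p ≤ Nat.sqrt M := Nat.le_sqrt.2 hp.2.2.2.2
      exact Nat.lt_succ_of_le (Nat.log_mono_right this)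
  have hmaps : ∀ p ∈ S, φ p ∈ Ico j₁ (J + 1) ×ˢ range (2 ^ κ) := by
    intro p hp
    obtain ⟨h1, h2, h3, h4⟩ := hmem p hp
    simp only [hφdef, mem_product, mem_Ico, mem_range]
    refine ⟨⟨h3, h4⟩, ?_⟩
    rw [Nat.div_lt_iff_lt_mul (by positivity), ← pow_add]
    have e : κ + (Nat.log 2 p - κ) = Nat.log 2 p := by omega
    rw [e]
    have := Nat.lt_pow_succ_log_self (b := 2) (by norm_num) p
    rw [pow_succ] at this
    omega
  have hblock : ∀ x ∈ Ico j₁ (J + 1) ×ˢ range (2 ^ κ),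
      ‖∑ p ∈ S with φ p = x, F p‖ ≤
        39 * (M / 2 ^ κ * Real.sqrt q / Nat.totient q *
          (90 * (1 / ((x.1 : ℝ) * Real.sqrt x.1)))) + (M / (2 ^ κ) ^ 2 * C + 2 ^ x.1 / 2 ^ κ) := by
    rintro ⟨j, i⟩ hx
    simp only [mem_product, mem_Ico, mem_range] at hx
    obtain ⟨⟨hj1, hjJ⟩, hi⟩ := hx
    set P := 2 ^ j + i * 2 ^ (j - κ) with hP
    set H := 2 ^ (j - κ) with hH
    have hHj : H * 2 ^ κ = 2 ^ j := by
      rw [hH, ← pow_add]; congr 1; omega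
    -- With h = j/10 the sieve needs 5h + l ≤ j − κ; this follows from 5h ≤ j/2 and 2(κ + l) ≤ j₁ ≤
    -- j.
    have hb := norm_block_le (M := M) (P := P) (H := H) (h := j / 10) hq ha β (by omega)
      ((Nat.pow_le_pow_right (by norm_num) (Nat.sub_le _ _)).trans (Nat.le_add_right _ _))
      (by
        calc 2 ^ (5 * (j / 10)) * q ≤ 2 ^ (5 * (j / 10)) * 2 ^ l := Nat.mul_le_mul_left _ hql
          _ = 2 ^ (5 * (j / 10) + l) := (pow_add _ _ _).symm
          _ ≤ 2 ^ (j - κ) := Nat.pow_le_pow_right (by norm_num) (by omega))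
      (S := S.filter (fun p => φ p = (j, i)))
      (by
        intro p hp
        have hp' := mem_filter.1 hp
        obtain ⟨h1, h2, h3, h4⟩ := hmem p hp'.1
        simp only [hφdef, Prod.mk.injEq] at hp'
        obtain ⟨e1, e2⟩ := hp'.2
        rw [e1] at e2
        have hjp : 2 ^ j ≤ p := by
          rw [← e1]; exact Nat.pow_log_le_self 2 h1.ne_zero
        have hdm := Nat.div_add_mod (p - 2 ^ j) (2 ^ (j - κ))
        have hlt := Nat.mod_lt (p - 2 ^ j) (y := 2 ^ (j - κ)) (by positivity)
        rw [e2, mul_comm] at hdm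
        refine ⟨h1, h2, ?_, ?_⟩ <;> omega)
    have hPj : (2 : ℝ) ^ j ≤ P := by
      have : 2 ^ j ≤ P := Nat.le_add_right _ _
      exact_mod_cast this
    have hHr : (H : ℝ) = 2 ^ j / 2 ^ κ := by
      rw [eq_div_iff (by positivity)]
      exact_mod_cast hHj
    have h10 := one_div_div_ten_le (hj.trans hj1)
    have hφ := totient_pos_real hq.ne'
    have hh0 : (0 : ℝ) < ((j / 10 : ℕ) : ℝ) := by
      have : 0 < j / 10 := by omega
      exact_mod_cast this
    have hs0 : 0 < Real.sqrt ((j / 10 : ℕ) : ℝ) := Real.sqrt_pos.2 hh0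
    refine hb.trans (add_le_add ?_ (add_le_add ?_ hHr.le))
    · refine mul_le_mul_of_nonneg_left ?_ (by norm_num)
      calc _ ≤ (M : ℝ) / 2 ^ j * H * Real.sqrt q /
            (Nat.totient q * (((j / 10 : ℕ) : ℝ) * Real.sqrt ((j / 10 : ℕ) : ℝ))) := by gcongr
        _ = M / 2 ^ κ * Real.sqrt q / Nat.totient q *
            (1 / (((j / 10 : ℕ) : ℝ) * Real.sqrt ((j / 10 : ℕ) : ℝ))) := by
          rw [hHr]; field_simp
        _ ≤ _ := by gcongr
    · calc _ ≤ (M : ℝ) * H ^ 2 / (2 ^ j) ^ 2 * C := by gcongr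
        _ = _ := by rw [hHr]; field_simp
  have hsum : ‖∑ p ∈ S, F p‖ ≤ ∑ x ∈ Ico j₁ (J + 1) ×ˢ range (2 ^ κ),
      (39 * (M / 2 ^ κ * Real.sqrt q / Nat.totient q *
          (90 * (1 / ((x.1 : ℝ) * Real.sqrt x.1)))) + (M / (2 ^ κ) ^ 2 * C + 2 ^ x.1 / 2 ^ κ)) := by
    rw [← sum_fiberwise_of_maps_to hmaps]
    exact norm_sum_le_of_le _ hblock
  refine hsum.trans ?_
  rw [sum_product]
  simp only [sum_const, card_range, nsmul_eq_mul]
  rw [← mul_sum, sum_add_distrib, sum_add_distrib, ← mul_sum, ← mul_sum, ← mul_sum, sum_const,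
    Nat.card_Ico, nsmul_eq_mul, ← sum_div]
  have hφ := totient_pos_real hq.ne'
  have hs := sum_one_div_mul_sqrt_le (m := j₁) (n := J + 1) (by omega)
  have hgeo : ∑ j ∈ Ico j₁ (J + 1), (2 : ℝ) ^ j ≤ 2 * 2 ^ J := by
    have h1 : ∑ j ∈ Ico j₁ (J + 1), (2 : ℝ) ^ j ≤ ∑ j ∈ range (J + 1), (2 : ℝ) ^ j :=
      sum_le_sum_of_subset_of_nonneg (fun x hx => mem_range.2 (mem_Ico.1 hx).2)
        (fun _ _ _ => by positivity)
    rw [geom_sum_eq (by norm_num), pow_succ] at h1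
    have : (0 : ℝ) ≤ 2 ^ J := by positivity
    linarith
  have hcard : ((J + 1 - j₁ : ℕ) : ℝ) ≤ J + 1 := by
    have : J + 1 - j₁ ≤ J + 1 := Nat.sub_le _ _
    exact_mod_cast this
  have hj0 : 0 < Real.sqrt j₁ := Real.sqrt_pos.2 (by
    have : 0 < j₁ := by omega
    exact_mod_cast this)
  have hmain : ((2 ^ κ : ℕ) : ℝ) * (39 * (M / 2 ^ κ * Real.sqrt q / Nat.totient q *
      (90 * ∑ j ∈ Ico j₁ (J + 1), 1 / ((j : ℝ) * Real.sqrt j)))) ≤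
      15000 * (M * Real.sqrt q / (Nat.totient q * Real.sqrt j₁)) := by
    calc _ ≤ ((2 ^ κ : ℕ) : ℝ) * (39 * (M / 2 ^ κ * Real.sqrt q / Nat.totient q *
          (90 * (4 / Real.sqrt j₁)))) := by gcongr
      _ = 14040 * (M * Real.sqrt q / (Nat.totient q * Real.sqrt j₁)) := by
        push_cast; field_simp; ring
      _ ≤ _ := by gcongr; norm_num
  have herr : ((2 ^ κ : ℕ) : ℝ) * (((J + 1 - j₁ : ℕ) : ℝ) * (M / (2 ^ κ) ^ 2 * C) +
      (∑ j ∈ Ico j₁ (J + 1), (2 : ℝ) ^ j) / 2 ^ κ) ≤ (J + 1) * (M / 2 ^ κ * C) + 2 * 2 ^ J := by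
    calc _ ≤ ((2 ^ κ : ℕ) : ℝ) * ((J + 1) * (M / (2 ^ κ) ^ 2 * C) + 2 * 2 ^ J / 2 ^ κ) := by
          gcongr
      _ = _ := by push_cast; field_simp
  rw [mul_add]
  exact add_le_add hmain herr

end

/-! ### Assembly of the linear and bilinear bounds -/

section

open Finset

theorem card_primeFactors_le_of_le_two_pow {q l : ℕ} (hq : 0 < q) (h : q ≤ 2 ^ l) :
    #q.primeFactors ≤ l := by
  have h1 : 2 ^ #q.primeFactors ≤ ∏ p ∈ q.primeFactors, p := by
    rw [← prod_const]
    exact prod_le_prod' fun p hp => (Nat.prime_of_mem_primeFactors hp).two_le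
  have h2 := Nat.le_of_dvd hq (Nat.prod_primeFactors_dvd q)
  exact (Nat.pow_le_pow_iff_right (by norm_num)).1 ((h1.trans h2).trans h)

theorem norm_gauss_sum_le {M q j₁ κ l k : ℕ} (hq : 0 < q) {a : ℤ} (ha : IsCoprime a (q : ℤ))
    (β : ℝ) (hj : 10 ≤ j₁) (hql : q ≤ 2 ^ l) (hjl : 2 * (κ + l) ≤ j₁) (hk : l ≤ k) (hk1 : 1 ≤ k)
    (hβ : 8 * Real.pi * q * 2 ^ (j₁ * k) * |β| ≤ 1) :
    ‖∑ n ∈ Icc 1 M, bGauss n * eChar (n * ((a : ℝ) / q + β))‖ ≤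
      15300 * (M * Real.sqrt q / (Nat.totient q * Real.sqrt j₁)) +
        ((Nat.log 2 (Nat.sqrt M) + 1) * (M / 2 ^ κ * (2 * Real.pi * |β| * M + 2)) +
          2 * 2 ^ Nat.log 2 (Nat.sqrt M)) +
        2 * M * Real.exp (32 * (1 + Real.log j₁) - 2 * (k - l : ℕ)) +
        3 * q * 2 ^ (j₁ * k) := by
  classical
  set h := j₁ / 10 with hh
  have hw := card_primeFactors_le_of_le_two_pow hq hql
  have hDz : 2 ^ h < 2 ^ j₁ := Nat.pow_lt_pow_right (by norm_num) (by omega)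
  have hzk : (((2 ^ j₁) ^ k : ℕ) : ℝ) = 2 ^ (j₁ * k) := by push_cast; rw [pow_mul]
  -- The choice y = e² makes the truncation error decay like exp(−2(k − l)), against a growth of at
  -- most exp(32(1 + log j₁)), where 32 = 8 · 4 with e² ≤ 8.
  have hlin := norm_linear_sum_le (M := M) (k := k) (z := 2 ^ j₁) (y := Real.exp 2) hq ha (β := β)
    (Nat.one_le_two_pow (n := h)) hDz (by rw [hzk]; exact hβ) (hw.trans hk)
    (Real.one_le_exp (by norm_num))
  rw [hzk] at hlin
  have hmid := norm_middle_sum_le (M := M) hq ha β hj hql hjl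
  have hB := buchstab_identity (2 ^ j₁) M (fun n => eChar (n * ((a : ℝ) / q + β)))
  have hS : ∑ n ∈ Icc 1 M, bGauss n * eChar (n * ((a : ℝ) / q + β)) =
      (∑ n ∈ Icc 1 M with n % 4 = 1 ∧ SiftedThree (2 ^ j₁) n, eChar (n * ((a : ℝ) / q + β))) -
      ∑ p ∈ middlePrimes (2 ^ j₁) M, ∑ m ∈ cofactors p (M / p),
        eChar ((p * m : ℕ) * ((a : ℝ) / q + β)) := by
    rw [eq_sub_iff_add_eq]
    convert hB.symm
  rw [hS]
  refine (norm_sub_le _ _).trans ?_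
  have hφ := totient_pos_real hq.ne'
  have hq1 : (1 : ℝ) ≤ q := by exact_mod_cast hq
  have hj' : (10 : ℝ) ≤ j₁ := by exact_mod_cast hj
  have hsj : 0 < Real.sqrt j₁ := Real.sqrt_pos.2 (by linarith)
  have e1 : 4 * (M : ℝ) / Nat.totient q / harmonicIn (· % 4 = 3) (2 ^ h) ≤
      216 * (M * Real.sqrt q / (Nat.totient q * Real.sqrt j₁)) := by
    have h1 := sqrt_le_harmonicIn_three h
    have h20 : j₁ ≤ 20 * h := by omega
    have h20' : (j₁ : ℝ) ≤ 20 * h := by exact_mod_cast h20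
    have h2 : Real.sqrt j₁ ≤ 9 / 2 * Real.sqrt h := by
      rw [Real.sqrt_le_left (by positivity), mul_pow, Real.sq_sqrt (by positivity)]
      linarith
    have h3 : Real.sqrt j₁ / 54 ≤ harmonicIn (· % 4 = 3) (2 ^ h) := by linarith
    have h4 : 1 ≤ Real.sqrt q := Real.one_le_sqrt.2 hq1
    calc _ ≤ 4 * (M : ℝ) / Nat.totient q / (Real.sqrt j₁ / 54) := by gcongr
      _ = 216 * (M * 1 / (Nat.totient q * Real.sqrt j₁)) := by field_simp; ring
      _ ≤ _ := by gcongr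
  have e2 : (((2 ^ h : ℕ) : ℝ)) ^ 4 ≤ q * 2 ^ (j₁ * k) := by
    have h1 : (2 ^ h) ^ 4 ≤ 2 ^ (j₁ * k) := by
      rw [← pow_mul]
      refine Nat.pow_le_pow_right (by norm_num) ?_
      calc h * 4 ≤ j₁ := by omega
        _ ≤ j₁ * k := Nat.le_mul_of_pos_right _ hk1
    have h2 : (((2 ^ h : ℕ) : ℝ)) ^ 4 ≤ 2 ^ (j₁ * k) := by exact_mod_cast h1
    refine h2.trans (le_mul_of_one_le_left (by positivity) hq1)
  have e3 : Real.exp (Real.exp 2 * ∑ p ∈ primesThree (2 ^ j₁), (1 : ℝ) / p) /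
      Real.exp 2 ^ (k - #q.primeFactors) ≤
      Real.exp (32 * (1 + Real.log j₁) - 2 * (k - l : ℕ)) := by
    rw [← Real.exp_nat_mul, ← Real.exp_sub]
    apply Real.exp_le_exp.2
    have h1 := sum_primesThree_inv_le (j₁ - 1)
    rw [Nat.sub_add_cancel (by omega)] at h1
    have h2 : Real.log ((j₁ - 1 : ℕ) : ℝ) ≤ Real.log j₁ := by
      apply Real.log_le_log
      · have : 0 < j₁ - 1 := by omega
        exact_mod_cast this
      · exact_mod_cast Nat.sub_le _ _
    have h3 : Real.exp 2 ≤ 8 := by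
      have : Real.exp 2 = Real.exp 1 * Real.exp 1 := by rw [← Real.exp_add]; norm_num
      rw [this]
      have := Real.exp_one_lt_d9
      have := Real.exp_pos 1
      nlinarith
    have h4 : 0 ≤ Real.log j₁ := Real.log_nonneg (by linarith)
    have h5 : Real.exp 2 * ∑ p ∈ primesThree (2 ^ j₁), (1 : ℝ) / p ≤
        8 * (4 * (1 + Real.log j₁)) := by
      gcongr
      linarith
    have h6 : ((k - l : ℕ) : ℝ) ≤ (k - #q.primeFactors : ℕ) := by
      exact_mod_cast Nat.sub_le_sub_left hw k
    linarith
  have e4 : 2 * (M : ℝ) * (Real.exp (Real.exp 2 * ∑ p ∈ primesThree (2 ^ j₁), (1 : ℝ) / p) /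
      Real.exp 2 ^ (k - #q.primeFactors)) ≤
      2 * M * Real.exp (32 * (1 + Real.log j₁) - 2 * (k - l : ℕ)) := by gcongr
  have e5 : (0 : ℝ) ≤ M * Real.sqrt q / (Nat.totient q * Real.sqrt j₁) := by positivity
  linarith

end

/-! ### Choice of parameters for large N -/

section

open Finset

/-- Each squared factor is small against √L: log L ≤ 4 L^(1/4) gives lam² ≤ 64√L, and the hypothesis
gives 141000 E² ≤ √L. -/
theorem sqrt_mul_le_of_two_mul_le {L E : ℝ} (hE : 2 ≤ E) (hL : 2 * 10 ^ 10 * E ^ 4 ≤ L)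
    {lam : ℝ} (hlam : lam ≤ Real.log L + 1) (hlam0 : 0 ≤ lam) (hlog : 1 ≤ Real.log L) :
    2000 * (lam * E) ^ 2 ≤ L := by
  have hE4 : 16 ≤ E ^ 4 := by
    calc (16 : ℝ) = 2 ^ 4 := by norm_num
      _ ≤ E ^ 4 := by gcongr
  have hLpos : 0 < L := by linarith
  set s := Real.sqrt L with hs
  set t := Real.sqrt s with ht
  have hs0 : 0 < s := Real.sqrt_pos.2 hLpos
  have ht0 : 0 < t := Real.sqrt_pos.2 hs0
  have hss : s * s = L := Real.mul_self_sqrt hLpos.le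
  have htt : t * t = s := Real.mul_self_sqrt hs0.le
  have hlog4 : Real.log L ≤ 4 * t := by
    have h1 : Real.log L = 4 * Real.log t := by
      rw [← hss, ← htt, Real.log_mul (by positivity) (by positivity),
        Real.log_mul (by positivity) (by positivity)]
      ring
    have h2 := Real.log_le_sub_one_of_pos ht0
    linarith
  have hlam2 : lam ≤ 8 * t := by linarith
  have hlam3 : lam ^ 2 ≤ 64 * s := by nlinarith
  have hsE : 141000 * E ^ 2 ≤ s := by
    refine Real.le_sqrt_of_sq_le ?_
    nlinarith
  calc 2000 * (lam * E) ^ 2 = 2000 * lam ^ 2 * E ^ 2 := by ring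
    _ ≤ 2000 * (64 * s) * E ^ 2 := by gcongr
    _ = 128000 * E ^ 2 * s := by ring
    _ ≤ s * s := by
      refine mul_le_mul_of_nonneg_right ?_ hs0.le
      nlinarith [sq_nonneg E]
    _ = L := hss

theorem eight_mul_pi_le_exp_four : 8 * Real.pi ≤ Real.exp 4 := by
  have h1 := Real.pi_lt_d2
  have h2 : Real.exp 4 = Real.exp 1 * Real.exp 1 * (Real.exp 1 * Real.exp 1) := by
    rw [← Real.exp_add, ← Real.exp_add]; norm_num
  have h3 : (2.7 : ℝ) ≤ Real.exp 1 := by linarith [Real.exp_one_gt_d9]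
  have h4 : (7.29 : ℝ) ≤ Real.exp 1 * Real.exp 1 := by nlinarith
  rw [h2]
  nlinarith

set_option maxHeartbeats 2000000 in
theorem norm_trigS_le_of_large {A B : ℕ} (hA : 1 ≤ A) (hB : 1 ≤ B) {N : ℝ} (hN : 0 < N)
    (hL : 2 * 10 ^ 10 * ((A + B : ℕ) : ℝ) ^ 4 ≤ Real.log N) {q : ℕ} (hq : 0 < q) {a : ℤ}
    (ha : IsCoprime a (q : ℤ)) {α : ℝ} (hqB : (q : ℝ) ≤ Real.log N ^ B)
    (hα : |α - (a : ℝ) / q| ≤ Real.log N ^ B / N) :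
    ‖trigS α N‖ ≤ N / Real.sqrt (Real.log N) *
      (300000 * (A + B : ℕ) * (Real.sqrt (q * Real.log (Real.log N)) / Nat.totient q) +
        25 / Real.log N ^ A) := by
  set L := Real.log N with hLdef
  set E : ℝ := ((A + B : ℕ) : ℝ) with hEdef
  have hE2 : 2 ≤ E := by
    have : 2 ≤ A + B := by omega
    rw [hEdef]
    exact_mod_cast this
  have hE4 : 16 ≤ E ^ 4 := by
    calc (16 : ℝ) = 2 ^ 4 := by norm_num
      _ ≤ E ^ 4 := by gcongr
  have hL9 : 9 ≤ L := by linarith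
  have hLpos : 0 < L := by linarith
  set ℓ := Real.log L with hℓ
  have hexpℓ : Real.exp ℓ = L := Real.exp_log hLpos
  have hexpL : Real.exp L = N := Real.exp_log hN
  have hℓ1 : 1 ≤ ℓ := by
    rw [hℓ, Real.le_log_iff_exp_le hLpos]
    linarith [Real.exp_one_lt_d9]
  set lam : ℕ := ⌈ℓ⌉₊ with hlam
  have hlam1 : ℓ ≤ lam := Nat.le_ceil _
  have hlam2 : (lam : ℝ) ≤ ℓ + 1 := (Nat.ceil_lt_add_one (by linarith)).le
  have hlampos : 1 ≤ lam := by
    have : (1 : ℝ) ≤ lam := by linarith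
    exact_mod_cast this
  set x : ℕ := lam * (A + B) with hx
  have hxr : (x : ℝ) = lam * E := by rw [hx, hEdef]; push_cast; ring
  have hH : 2000 * (x : ℝ) ^ 2 ≤ L := by
    rw [hxr]
    exact sqrt_mul_le_of_two_mul_le hE2 hL hlam2 (by positivity) hℓ1
  have hx2 : 2 ≤ x := by
    calc 2 ≤ A + B := by omega
      _ ≤ lam * (A + B) := Nat.le_mul_of_pos_left _ hlampos
  have hx2' : (2 : ℝ) ≤ x := by exact_mod_cast hx2
  have hxL : 4000 * (x : ℝ) ≤ L := by
    calc 4000 * (x : ℝ) = 2000 * (2 * x) := by ring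
      _ ≤ 2000 * (x * x) := by gcongr
      _ ≤ L := by rwa [← sq]
  have hEx : E * ℓ ≤ x := by
    rw [hxr, mul_comm]
    gcongr
  have hA' : (1 : ℝ) ≤ A := by exact_mod_cast hA
  have hB' : (1 : ℝ) ≤ B := by exact_mod_cast hB
  have hEAB : E = A + B := by rw [hEdef]; push_cast; ring
  have hAℓ : (A + 1 : ℝ) * ℓ ≤ x := by
    refine le_trans ?_ hEx
    gcongr
    linarith
  have hBℓ : (B : ℝ) * ℓ ≤ x := by
    refine le_trans ?_ hEx
    gcongr
    linarith
  -- The part 2B·lam equals l, so ω(q) ≤ l ≤ k; the remaining (50 + A)·lam makes Brun's error at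
  -- most (log N)^(−A−1), beating exp(32(1 + log j₁)).
  set k : ℕ := lam * (2 * B + 50 + A) with hk
  have hk1 : 1 ≤ k := Nat.mul_pos hlampos (by omega)
  have hkx : k ≤ 27 * x := by
    calc k = lam * (2 * B + 50 + A) := hk
      _ ≤ lam * (27 * (A + B)) := Nat.mul_le_mul_left _ (by omega)
      _ = 27 * x := by rw [hx]; ring
  have hk1' : (1 : ℝ) ≤ k := by exact_mod_cast hk1
  have hkx' : (k : ℝ) ≤ 27 * x := by exact_mod_cast hkx
  -- The largest scale with j₁k ≤ L/3, so that z^k = 2^(j₁k) ≤ N^(1/4).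
  set j₁ : ℕ := ⌊L / (3 * k)⌋₊ with hj₁
  have hj_le : (j₁ : ℝ) ≤ L / (3 * k) := Nat.floor_le (by positivity)
  have hj_gt : L / (3 * k) < j₁ + 1 := Nat.lt_floor_add_one _
  have hj_low : L / (81 * x) < j₁ + 1 := by
    refine lt_of_le_of_lt ?_ hj_gt
    exact div_le_div_of_nonneg_left hLpos.le (by linarith) (by linarith)
  have hjx : 24 * (x : ℝ) ≤ L / (81 * x) := by
    rw [le_div_iff₀ (by linarith)]
    nlinarith only [hH]
  have hjx' : 24 * x ≤ j₁ := by
    have : 24 * (x : ℝ) < j₁ + 1 := hjx.trans_lt hj_low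
    have : 24 * x < j₁ + 1 := by exact_mod_cast this
    omega
  have hjhalf : L ≤ 162 * x * j₁ := by
    have h1 : L / (81 * x) ≤ 2 * j₁ := by
      have : (1 : ℝ) ≤ j₁ := by
        have : 1 ≤ j₁ := by omega
        exact_mod_cast this
      linarith
    rw [div_le_iff₀ (by linarith)] at h1
    linarith
  have hjk : (j₁ : ℝ) * k ≤ L / 3 := by
    rw [le_div_iff₀ (by linarith)] at hj_le
    linarith
  have hjL : (j₁ : ℝ) ≤ L := by
    have : (j₁ : ℝ) * 1 ≤ j₁ * k := by gcongr
    linarith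
  set l : ℕ := 2 * B * lam with hl
  -- This makes 2^κ ≥ L^(A+B+3): L^B pays for β, one power of L for the number of dyadic scales, and
  -- A + 2 powers are left.
  set κ : ℕ := 2 * lam * (A + B + 3) with hκ
  have hpow : ∀ m : ℕ, L ^ m ≤ 2 ^ (2 * lam * m) := by
    intro m
    have h1 : L ≤ 2 ^ (2 * lam) := by
      rw [← hexpℓ]
      calc Real.exp ℓ ≤ Real.exp (lam * 1) := by
            apply Real.exp_le_exp.2; linarith
        _ = Real.exp 1 ^ lam := Real.exp_nat_mul _ _
        _ ≤ 4 ^ lam := by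
          gcongr
          linarith [Real.exp_one_lt_d9]
        _ = 2 ^ (2 * lam) := by rw [pow_mul]; norm_num
    calc L ^ m ≤ (2 ^ (2 * lam)) ^ m := by gcongr
      _ = _ := by rw [← pow_mul]
  have hql : q ≤ 2 ^ l := by
    have h1 := hqB.trans (hpow B)
    have h2 : (q : ℝ) ≤ ((2 ^ (2 * lam * B) : ℕ) : ℝ) := by push_cast; exact h1
    have h3 : q ≤ 2 ^ (2 * lam * B) := by exact_mod_cast h2
    rw [hl, show 2 * B * lam = 2 * lam * B by ring]
    exact h3
  have hjl : 2 * (κ + l) ≤ j₁ := by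
    refine le_trans ?_ hjx'
    calc 2 * (κ + l) = lam * (4 * (A + 2 * B + 3)) := by rw [hκ, hl]; ring
      _ ≤ lam * (24 * (A + B)) := Nat.mul_le_mul_left _ (by omega)
      _ = 24 * x := by rw [hx]; ring
  have hkl : k = l + lam * (50 + A) := by rw [hk, hl]; ring
  have hpowexp : ∀ m : ℕ, L ^ m = Real.exp (m * ℓ) := by
    intro m
    rw [Real.exp_nat_mul, hexpℓ]
  have htwo : (2 : ℝ) ^ (j₁ * k) ≤ Real.exp (L / 4) := by
    have h1 : (2 : ℝ) ^ (j₁ * k) = Real.exp ((j₁ * k : ℕ) * Real.log 2) := by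
      rw [Real.exp_nat_mul, Real.exp_log (by norm_num)]
    rw [h1]
    apply Real.exp_le_exp.2
    have := Real.log_two_lt_d9
    have := Real.log_two_gt_d9
    push_cast
    calc (j₁ : ℝ) * k * Real.log 2 ≤ L / 3 * (3 / 4) := by gcongr; linarith
      _ = L / 4 := by ring
  set β : ℝ := α - (a : ℝ) / q with hβdef
  have hβN : |β| ≤ Real.exp (B * ℓ - L) := by
    rw [Real.exp_sub, hexpL, ← hpowexp]; exact hα
  have hqexp : (q : ℝ) ≤ Real.exp (B * ℓ) := by rw [← hpowexp]; exact hqB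
  have hpi := Real.pi_pos
  have hpi4 := Real.pi_lt_d2
  have hβ : 8 * Real.pi * q * 2 ^ (j₁ * k) * |β| ≤ 1 := by
    have h26 := eight_mul_pi_le_exp_four
    calc _ ≤ Real.exp 4 * Real.exp (B * ℓ) * Real.exp (L / 4) * Real.exp (B * ℓ - L) := by gcongr
      _ = Real.exp (4 + B * ℓ + L / 4 + (B * ℓ - L)) := by simp only [Real.exp_add]
      _ ≤ 1 := by
        rw [Real.exp_le_one_iff]
        linarith
  set M : ℕ := ⌊N⌋₊ with hM
  have hMN : (M : ℝ) ≤ N := Nat.floor_le hN.le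
  have hkey := norm_gauss_sum_le (M := M) hq ha β (by omega) hql hjl (by omega) hk1 hβ
  have htrig : trigS α N = ∑ n ∈ Icc 1 M, bGauss n * eChar (n * ((a : ℝ) / q + β)) := by
    rw [trigS, hβdef, add_sub_cancel]
  rw [← htrig] at hkey
  refine hkey.trans ?_
  -- Z = L^(−A−1); the extra power of L pays for normalising by N/√L. The errors below total (18 + 2
  -- + 2 + 3) N Z = 25 N Z.
  set Z := Real.exp (-((A + 1 : ℝ) * ℓ)) with hZ
  have hZpow : Z * L ^ (A + 1) = 1 := by
    rw [hpowexp, hZ, ← Real.exp_add]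
    push_cast
    rw [neg_add_cancel, Real.exp_zero]
  have hZpos : 0 < Z := Real.exp_pos _
  have hφ := totient_pos_real hq.ne'
  have hsL : 0 < Real.sqrt L := Real.sqrt_pos.2 hLpos
  have hj0 : (0 : ℝ) < j₁ := by
    have : 0 < j₁ := by omega
    exact_mod_cast this
  have hsj : 0 < Real.sqrt j₁ := Real.sqrt_pos.2 hj0
  have hmain : 15300 * (M * Real.sqrt q / (Nat.totient q * Real.sqrt j₁)) ≤
      N / Real.sqrt L * (300000 * E * (Real.sqrt (q * ℓ) / Nat.totient q)) := by
    -- From L ≤ 162 x j₁ and x ≤ 2ℓE; here 324 = 18². This is where √(log log N) enters the main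
    -- term.
    have h1 : Real.sqrt L ≤ 18 * E * Real.sqrt ℓ * Real.sqrt j₁ := by
      rw [Real.sqrt_le_left (by positivity), mul_pow, mul_pow, mul_pow, Real.sq_sqrt hj0.le,
        Real.sq_sqrt (by linarith)]
      have h2 : (x : ℝ) ≤ 2 * ℓ * E := by
        rw [hxr]; gcongr; linarith
      calc L ≤ 162 * x * j₁ := hjhalf
        _ ≤ 162 * (2 * ℓ * E) * j₁ := by gcongr
        _ = 324 * E * ℓ * j₁ := by ring
        _ ≤ 18 ^ 2 * E ^ 2 * ℓ * j₁ := by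
          gcongr ?_ * ℓ * j₁
          nlinarith only [hE2]
    rw [Real.sqrt_mul (by positivity)]
    have h3 : 1 / Real.sqrt j₁ ≤ 18 * E * Real.sqrt ℓ / Real.sqrt L := by
      rw [div_le_div_iff₀ hsj hsL]; linarith
    calc _ = 15300 * (M * Real.sqrt q / Nat.totient q) * (1 / Real.sqrt j₁) := by field_simp
      _ ≤ 15300 * (N * Real.sqrt q / Nat.totient q) * (18 * E * Real.sqrt ℓ / Real.sqrt L) := by
        gcongr
      _ = N / Real.sqrt L * (275400 * E * (Real.sqrt q * Real.sqrt ℓ / Nat.totient q)) := by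
        field_simp; ring
      _ ≤ _ := by gcongr; norm_num
  have hJ : (2 : ℝ) ^ Nat.log 2 (Nat.sqrt M) ≤ Real.exp (L / 2) := by
    have h1 : 2 ^ Nat.log 2 (Nat.sqrt M) ≤ Nat.sqrt M := by
      refine Nat.pow_log_le_self 2 ?_
      have : 0 < Nat.sqrt M := by
        rw [Nat.sqrt_pos, hM, Nat.floor_pos, ← hexpL]
        exact Real.one_le_exp hLpos.le
      omega
    have h2 : ((Nat.sqrt M : ℕ) : ℝ) ≤ Real.sqrt M := Real.nat_sqrt_le_real_sqrt
    have h3 : Real.sqrt M ≤ Real.exp (L / 2) := by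
      rw [Real.exp_half, hexpL]
      exact Real.sqrt_le_sqrt hMN
    have h4 : (2 : ℝ) ^ Nat.log 2 (Nat.sqrt M) ≤ Nat.sqrt M := by exact_mod_cast h1
    linarith
  have hJL : (Nat.log 2 (Nat.sqrt M) : ℝ) + 1 ≤ 2 * L := by
    have h1 := Real.log_le_log (by positivity) hJ
    rw [Real.log_pow, Real.log_exp] at h1
    have h2 : (Nat.log 2 (Nat.sqrt M) : ℝ) * (1 / 2) ≤ L / 2 := by
      refine le_trans ?_ h1
      gcongr
      linarith only [Real.log_two_gt_d9]
    linarith only [h2, hL9]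
  have hE1 : ((Nat.log 2 (Nat.sqrt M) : ℝ) + 1) * (M / 2 ^ κ * (2 * Real.pi * |β| * M + 2)) ≤
      18 * (N * Z) := by
    have h1 : |β| * M ≤ L ^ B := by
      calc |β| * M ≤ L ^ B / N * N := by gcongr
        _ = L ^ B := by field_simp
    have hLB : 1 ≤ L ^ B := one_le_pow₀ (by linarith)
    have h2 : 2 * Real.pi * |β| * M + 2 ≤ 9 * L ^ B := by
      have : 2 * Real.pi * |β| * M = 2 * Real.pi * (|β| * M) := by ring
      rw [this]
      have : 2 * Real.pi * (|β| * M) ≤ 7 * L ^ B := by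
        gcongr
        linarith only [hpi4]
      linarith only [this, hLB]
    have h3 : (M : ℝ) / 2 ^ κ ≤ N / L ^ (A + B + 3) := by
      have := hpow (A + B + 3)
      gcongr
    calc _ ≤ 2 * L * (N / L ^ (A + B + 3) * (9 * L ^ B)) := by gcongr
      _ = 18 * (N * (1 / L ^ (A + 2))) := by
        rw [show A + B + 3 = A + 2 + 1 + B by ring, pow_add, pow_add L (A + 2) 1, pow_one]
        field_simp; ring
      _ ≤ 18 * (N * Z) := by
        gcongr
        rw [div_le_iff₀ (by positivity), show A + 2 = A + 1 + 1 by ring, pow_succ, ← mul_assoc,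
          hZpow]
        linarith only [hL9]
  have hexpcmp : ∀ u : ℝ, u + (A + 1 : ℝ) * ℓ ≤ L → Real.exp u ≤ N * Z := by
    intro u hu
    rw [← hexpL, hZ, ← Real.exp_add]
    apply Real.exp_le_exp.2
    linarith only [hu]
  have hE2' : 2 * (2 : ℝ) ^ Nat.log 2 (Nat.sqrt M) ≤ 2 * (N * Z) := by
    have := hexpcmp (L / 2) (by linarith only [hAℓ, hxL, hx2'])
    linarith only [this, hJ]
  have hE3 : 2 * M * Real.exp (32 * (1 + Real.log j₁) - 2 * (k - l : ℕ)) ≤ 2 * (N * Z) := by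
    have h1 : Real.log j₁ ≤ ℓ := Real.log_le_log hj0 hjL
    have h2 : ((k - l : ℕ) : ℝ) = lam * (50 + A) := by
      rw [hkl, Nat.add_sub_cancel_left]; push_cast; ring
    have h3 : Real.exp (32 * (1 + Real.log j₁) - 2 * (k - l : ℕ)) ≤ Z := by
      rw [hZ]
      apply Real.exp_le_exp.2
      rw [h2]
      have h4 : (A : ℝ) * ℓ ≤ A * lam := by gcongr
      have h5 : (0 : ℝ) ≤ A * lam := by positivity
      linarith only [h1, h4, h5, hlam1, hℓ1]
    calc _ ≤ 2 * N * Z := by gcongr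
      _ = _ := by ring
  have hE4' : 3 * q * (2 : ℝ) ^ (j₁ * k) ≤ 3 * (N * Z) := by
    have h1 := hexpcmp (B * ℓ + L / 4) (by linarith only [hAℓ, hBℓ, hxL, hx2'])
    rw [Real.exp_add] at h1
    calc 3 * q * (2 : ℝ) ^ (j₁ * k) ≤ 3 * Real.exp (B * ℓ) * Real.exp (L / 4) := by gcongr
      _ = 3 * (Real.exp (B * ℓ) * Real.exp (L / 4)) := by ring
      _ ≤ _ := by gcongr
  have hfin : 25 * (N * Z) ≤ N / Real.sqrt L * (25 / L ^ A) := by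
    have h1 : Real.sqrt L ≤ L := by
      rw [Real.sqrt_le_left hLpos.le]
      exact le_self_pow₀ (by linarith only [hL9]) two_ne_zero
    have h2 : Z ≤ 1 / (Real.sqrt L * L ^ A) := by
      rw [le_div_iff₀ (by positivity)]
      calc Z * (Real.sqrt L * L ^ A) ≤ Z * (L * L ^ A) := by gcongr
        _ = Z * L ^ (A + 1) := by ring
        _ = 1 := hZpow
    calc _ ≤ 25 * (N * (1 / (Real.sqrt L * L ^ A))) := by gcongr
      _ = _ := by field_simp
  rw [mul_add]
  linarith only [hmain, hE1, hE2', hE3, hE4', hfin]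

end

/-! ### The computable constant and the final estimate -/

/-- The constant in the main estimate, as a function of the two exponents. -/
def boundConst (a b : ℕ) : ℕ :=
  300000 * (a + b) + (2 * 10 ^ 10 * (a + b) ^ 4) ^ (a + 1)

theorem computable₂_boundConst : Computable₂ boundConst := by
  have hpow : Primrec₂ ((· ^ ·) : ℕ → ℕ → ℕ) := Primrec₂.unpaired'.1 Nat.Primrec.pow
  have hadd : Primrec₂ ((· + ·) : ℕ → ℕ → ℕ) := Primrec.nat_add
  have hbase : Primrec₂ fun a b : ℕ => 2 * 10 ^ 10 * (a + b) ^ 4 :=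
    Primrec.nat_mul.comp₂ (Primrec.const _) (hpow.comp₂ hadd (Primrec.const _))
  have hexp : Primrec₂ fun a _ : ℕ => a + 1 := Primrec.succ.comp₂ Primrec₂.left
  have hlin : Primrec₂ fun a b : ℕ => 300000 * (a + b) :=
    Primrec.nat_mul.comp₂ (Primrec.const _) hadd
  exact (hadd.comp₂ hlin (hpow.comp₂ hbase hexp)).to_comp

theorem norm_trigS_le_self (α : ℝ) {N : ℝ} (hN : 0 ≤ N) : ‖trigS α N‖ ≤ N := by
  calc ‖trigS α N‖ ≤ ∑ n ∈ Finset.Icc 1 ⌊N⌋₊, ‖bGauss n * eChar (n * α)‖ := norm_sum_le _ _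
    _ ≤ ∑ n ∈ Finset.Icc 1 ⌊N⌋₊, (1 : ℝ) := by
      refine Finset.sum_le_sum fun n _ => ?_
      rw [norm_mul, norm_eChar, mul_one, bGauss]
      split_ifs <;> simp
    _ = ⌊N⌋₊ := by simp
    _ ≤ N := Nat.floor_le hN

theorem mainTheorem10 :
    ∃ C : ℕ → ℕ → ℕ, Computable₂ C ∧
      ∀ A B : ℝ, 1 ≤ A → 1 ≤ B →
        ∀ N : ℝ, Real.exp (Real.exp 1) ≤ N →
          ∀ (q : ℕ) (a : ℤ) (α : ℝ), 1 ≤ q → (q : ℝ) ≤ (Real.log N) ^ B →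
            IsCoprime a (q : ℤ) →
            |α - (a : ℝ) / (q : ℝ)| ≤ (Real.log N) ^ B / N →
            ‖trigS α N‖ / (N / Real.sqrt (Real.log N)) ≤
              (C ⌈A⌉₊ ⌈B⌉₊ : ℝ) *
                (Real.sqrt ((q : ℝ) * Real.log (Real.log N)) *
                    Real.log (Real.log (Real.log N)) / (Nat.totient q : ℝ) +
                  1 / (Real.log N) ^ A) := by
  refine ⟨boundConst, computable₂_boundConst, ?_⟩
  intro A B hA hB N hN q a α hq hqB ha hα
  have hN0 : 0 < N := (Real.exp_pos _).trans_le hN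
  have hLe : Real.exp 1 ≤ Real.log N := (Real.le_log_iff_exp_le hN0).2 hN
  set L := Real.log N with hL
  have he1 : (1 : ℝ) ≤ Real.exp 1 := Real.one_le_exp zero_le_one
  have hL1 : 1 ≤ L := he1.trans hLe
  have hL0 : 0 < L := by linarith
  have hℓ1 : 1 ≤ Real.log L := (Real.le_log_iff_exp_le hL0).2 hLe
  have hℓℓ0 : 0 ≤ Real.log (Real.log L) := Real.log_nonneg hℓ1
  have ha1 : 1 ≤ ⌈A⌉₊ := Nat.one_le_ceil_iff.2 (by linarith)
  have hb1 : 1 ≤ ⌈B⌉₊ := Nat.one_le_ceil_iff.2 (by linarith)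
  set m := ⌈A⌉₊
  set k := ⌈B⌉₊
  -- Since log N ≥ 1, rounding B up only weakens the hypotheses and rounding A up only strengthens
  -- the conclusion, so integer exponents suffice.
  have hBk : L ^ B ≤ L ^ k := by
    rw [← Real.rpow_natCast]
    exact Real.rpow_le_rpow_of_exponent_le hL1 (Nat.le_ceil B)
  have hAm : L ^ A ≤ L ^ m := by
    rw [← Real.rpow_natCast]
    exact Real.rpow_le_rpow_of_exponent_le hL1 (Nat.le_ceil A)
  have hLA : 0 < L ^ A := Real.rpow_pos_of_pos hL0 A
  have hsL : 0 < Real.sqrt L := Real.sqrt_pos.2 hL0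
  have hden : 0 < N / Real.sqrt L := by positivity
  have hcast : (boundConst m k : ℝ) =
      300000 * (m + k : ℕ) + (2 * 10 ^ 10 * ((m + k : ℕ) : ℝ) ^ 4) ^ (m + 1) := by
    rw [boundConst]; push_cast; ring
  have hmk : (2 : ℝ) ≤ (m + k : ℕ) := by exact_mod_cast Nat.add_le_add ha1 hb1
  rw [div_le_iff₀ hden]
  -- Below the threshold log N is bounded in terms of the exponents, and the second summand of
  -- `boundConst` dominates √L · L^A, so the trivial bound |S| ≤ N is enough.
  by_cases hlarge : 2 * 10 ^ 10 * ((m + k : ℕ) : ℝ) ^ 4 ≤ L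
  · have hmain := norm_trigS_le_of_large ha1 hb1 hN0 hlarge hq ha (hqB.trans hBk)
      (hα.trans (by gcongr))
    -- 27 ≥ e³ gives log L ≥ 3 ≥ e, hence log log log N ≥ 1, and that factor may be inserted for
    -- free.
    have hL27 : (27 : ℝ) ≤ L := by
      have : (2 : ℝ) ^ 4 ≤ ((m + k : ℕ) : ℝ) ^ 4 := by gcongr
      linarith
    have he3 : Real.exp 1 ≤ 3 := by linarith [Real.exp_one_lt_d9]
    have hℓe : Real.exp 1 ≤ Real.log L := by
      refine he3.trans ((Real.le_log_iff_exp_le hL0).2 ?_)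
      calc Real.exp 3 = Real.exp 1 ^ 3 := by rw [← Real.exp_nat_mul]; norm_num
        _ ≤ 3 ^ 3 := by gcongr
        _ ≤ L := by linarith
    have hℓℓ1 : 1 ≤ Real.log (Real.log L) := (Real.le_log_iff_exp_le (by linarith)).2 hℓe
    have hC : (300000 * (m + k : ℕ) : ℝ) ≤ boundConst m k := by
      rw [hcast]
      have : (0 : ℝ) ≤ (2 * 10 ^ 10 * ((m + k : ℕ) : ℝ) ^ 4) ^ (m + 1) := by positivity
      linarith
    refine hmain.trans ?_
    rw [mul_comm, mul_add]
    refine mul_le_mul_of_nonneg_right (add_le_add ?_ ?_) hden.le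
    · refine mul_le_mul hC ?_ (by positivity) (by positivity)
      gcongr
      exact le_mul_of_one_le_right (Real.sqrt_nonneg _) hℓℓ1
    · rw [mul_one_div]
      have : (25 : ℝ) ≤ boundConst m k := by linarith
      gcongr
  · have hsmall : L ≤ 2 * 10 ^ 10 * ((m + k : ℕ) : ℝ) ^ 4 := (not_le.1 hlarge).le
    have hsqrt : Real.sqrt L ≤ L := by
      rw [Real.sqrt_le_left hL0.le]
      exact le_self_pow₀ hL1 two_ne_zero
    have hC : Real.sqrt L * L ^ A ≤ boundConst m k := by
      calc Real.sqrt L * L ^ A ≤ L * L ^ m := by gcongr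
        _ = L ^ (m + 1) := (pow_succ' L m).symm
        _ ≤ (2 * 10 ^ 10 * ((m + k : ℕ) : ℝ) ^ 4) ^ (m + 1) := by gcongr
        _ ≤ boundConst m k := by
          rw [hcast]
          exact le_add_of_nonneg_left (by positivity)
    calc ‖trigS α N‖ ≤ N := norm_trigS_le_self α hN0.le
      _ = Real.sqrt L * L ^ A * (1 / L ^ A) * (N / Real.sqrt L) := by field_simp
      _ ≤ boundConst m k * (1 / L ^ A) * (N / Real.sqrt L) := by gcongr
      _ ≤ _ := by
        gcongr
        exact le_add_of_nonneg_left (by positivity)
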